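/- Let $\chi_1$ and $\chi_2$ be nontrivial primitive Dirichlet characters modulo $q_1$ and $q_2$, respectively, such that $\chi_1(-1)\chi_2(-1)=1$. Let $B_1(x)=0$ for $x\in\mathbb{Z}$ and $B_1(x)=x-\lfloor x\rfloor-\tfrac12$ for $x\in\mathbb{R}\setminus\mathbb{Z}$. For a positive integer $c$ divisible by $q_1q_2$ and an integer $a$, define the generalized Dedekind sum \[ S_{\chi_1,\chi_2}(a,c)=\sum_{j \bmod c}\ \sum_{n \bmod q_1}\overline{\chi_2}(j)\,\overline{\chi_1}(n)\,B_1\!\left(\frac{j}{c}\right)B_1\!\left(\frac{n}{q_1}+\frac{aj}{c}\right). \] Then for every positive integer $c\equiv 0 \pmod{q_1q_2}$ there is an integer $a$ coprime to $c$ such that $S_{\chi_1,\chi_2}(a,c)\neq 0$. In particular, define $S_{\chi_1,\chi_2}$ on $\Gamma_0(q_1q_2)$ by setting, for $\gamma=\begin{pmatrix}a&b\\c&d\end{pmatrix}$, $S_{\chi_1,\chi_2}(\gamma)=S_{\chi_1,\chi_2}(a,c)$ if $c\geq 1$, $S_{\chi_1,\chi_2}(\gamma)=S_{\chi_1,\chi_2}(-a,-c)$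 if $c\leq -1$, and $S_{\chi_1,\chi_2}(\gamma)=0$ if $c=0$. Then $S_{\chi_1,\chi_2}$ is nontrivial, that is, there is $\gamma\in\Gamma_0(q_1q_2)$ with $S_{\chi_1,\chi_2}(\gamma)\neq 0$. -/

import Mathlib

open scoped MatrixGroups

/-- The first Bernoulli function `B₁ : ℝ → ℝ`: it vanishes at the integers, and
`B₁(x) = x - ⌊x⌋ - 1/2` at every other real number. -/
noncomputable def bernoulliB1 (x : ℝ) : ℝ :=
  open scoped Classical in
  if ∃ m : ℤ, x = (m : ℝ) then 0 else x - (⌊x⌋ : ℝ) - 1 / 2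

/-- The generalized Dedekind sum `S_{χ₁,χ₂}(a, c)`, for `χ₁` modulo `q₁` and `χ₂` modulo `q₂`:
`∑_{j mod c} ∑_{n mod q₁} conj(χ₂(j)) conj(χ₁(n)) B₁(j/c) B₁(n/q₁ + a j/c)`.
The residues `j` modulo `c` and `n` modulo `q₁` are represented by `0, …, c - 1` and
`0, …, q₁ - 1`; it is meant for `c ≥ 1` divisible by `q₁ q₂`, where the choice of the
representatives is immaterial. -/
noncomputable def dedekindSum {q₁ q₂ : ℕ} (χ₁ : DirichletCharacter ℂ q₁)
    (χ₂ : DirichletCharacter ℂ q₂) (a : ℤ) (c : ℕ) : ℂ :=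
  ∑ j ∈ Finset.range c, ∑ n ∈ Finset.range q₁,
    (starRingEnd ℂ) (χ₂ (j : ZMod q₂)) * (starRingEnd ℂ) (χ₁ (n : ZMod q₁)) *
      (bernoulliB1 ((j : ℝ) / (c : ℝ)) : ℂ) *
      (bernoulliB1 ((n : ℝ) / (q₁ : ℝ) + (a : ℝ) * (j : ℝ) / (c : ℝ)) : ℂ)

/-- The generalized Dedekind sum as a function on `Γ₀(q₁ q₂)`. For `γ = (a, b; c, d)` with `c ≥ 1`
it is `S_{χ₁,χ₂}(a, c)`. For the remaining `γ` it is given by the only values compatible with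
the rule `S(γ₁ γ₂) = S(γ₁) + χ₁(d₁) conj(χ₂(d₁)) S(γ₂)` when `χ₁(-1) χ₂(-1) = 1`: namely
`S(γ) = S(-γ)` if `c ≤ -1` and `S(γ) = 0` if `c = 0`. -/
noncomputable def dedekindSumGamma0 {q₁ q₂ : ℕ} (χ₁ : DirichletCharacter ℂ q₁)
    (χ₂ : DirichletCharacter ℂ q₂) (γ : CongruenceSubgroup.Gamma0 (q₁ * q₂)) : ℂ :=
  if 0 < (γ : SL(2, ℤ)) 1 0 then
    dedekindSum χ₁ χ₂ ((γ : SL(2, ℤ)) 0 0) ((γ : SL(2, ℤ)) 1 0).toNat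
  else if (γ : SL(2, ℤ)) 1 0 < 0 then
    dedekindSum χ₁ χ₂ (-(γ : SL(2, ℤ)) 0 0) (-(γ : SL(2, ℤ)) 1 0).toNat
  else 0

/-!
Fix `c` divisible by `q₁ q₂` and put `χ = χ₁⁻¹`, `ε = χ₂⁻¹`. If `S(a, c)` vanished for all `a` prime
to `c`, then so would its transform `∑ₐ ψ(a) S(a, c)` for every character `ψ` modulo `c`. The proof
produces a `ψ` at which the transform (`dedekindTransform`) does not vanish.

Write `f(x) = ∑ₙ χ(n) B₁(n/q₁ + x)` and `G(y) = ∑ₐ ψ(a) f(a y / d)` for `ψ` modulo `d`. If `ψ` is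
primitive modulo `d`, then `G(y) = ψ⁻¹(y) G(1)`, and the transform `∑ⱼ ε(j) B₁(j/c) G(j)` factors as
`G(1)` times the generalized Bernoulli number of `ε ψ⁻¹`. By the functional equation the first
factor is a nonzero multiple of `L(1, χ⁻¹ ψ⁻¹)` if `χ ψ` is odd, and the second one is a nonzero
multiple of `L(1, ε⁻¹ ψ)` if `ε ψ⁻¹` is odd and ramified at all primes that divide `c`. Both
`L`-values are nonzero (`dedekindTransform_ne_zero`). By the parity hypothesis on `χ₁ χ₂` the two
oddness conditions are the same.

A primitive `ψ` modulo `c` with all these properties need not exist, for instance if `c` is exactly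
divisible by `2`, `3` or `4`, where there are few primitive characters. Changing the modulus
helps: the distribution relation of `B₁` shows that replacing `c` by `p c`, or the level of `ψ`
by a multiple, multiplies the transform by an explicit factor. For a new prime `p ∤ q₂` the factor
is `u + p v - w - u v / w` with `u = χ₁(p)`, `v = ε(p)`, `w = ψ(p)`, and it never vanishes
(`euler_factor_ne_zero`); for a prime `p ∣ q₁` that divides the modulus but not `q₂` it is
`p v ≠ 0`; if only the level of `ψ` is raised by a prime `p ∣ q₂`, it is `u - w` for a new prime and
`u` otherwise. So `ψ` may be unramified at `2` or `3` if it avoids the values of `χ₁` there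
(`exists_dedekindTransform_ne_zero_of_isAdmissibleAt`).

It remains to choose the local components of `ψ`. Modulo prime powers other than `2`, `3` and `4`
there are two different primitive characters, and one of them is good
(`exists_isAdmissibleAt_local`). The component at the largest prime factor `p` of `q₁` adjusts the
parity and avoids the forbidden values at `2` and `3` (`HasAvoidingCharacter`); its level may be
lowered if `p ∤ q₂`. This can fail only for the three small moduli `4`, `3` and `5` at `p`, where
the other components have to satisfy one further condition `ψ(-3) ≠ -1`, `ψ(-2) ≠ -1` or `ψ(6) ≠
-1` (`exists_isAdmissibleAt_apply_ne`).
-/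

/-! ### Values of L-functions at 0 -/

open Filter Asymptotics Topology in
/-- The generating function `∑ Φ(n) e^{-nt}` of a periodic `Φ` of mean zero is `O(1)`; once its
limit at `t = 0` is removed it is `O(t)`. -/
theorem isBigO_periodic_generating_function {N : ℕ} [NeZero N] (Φ : ℕ → ℂ)
    (hsum : ∑ j ∈ Finset.range N, Φ j = 0) (g : ℂ)
    (hg : g = -(∑ j ∈ Finset.range N, Φ j * j) / N) :
    (fun t : ℝ ↦ (∑ j ∈ Finset.range N, Φ j * (Real.exp (-t) : ℂ) ^ j) /
      (1 - (Real.exp (-t) : ℂ) ^ N) - g * Real.exp (-t)) =O[𝓝[>] 0] (fun t : ℝ ↦ t) := by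
  set Q : ℂ → ℂ := fun x ↦ ∑ j ∈ Finset.range N, Φ j * ∑ i ∈ Finset.range j, x ^ i with hQ
  set S : ℂ → ℂ := fun x ↦ ∑ i ∈ Finset.range N, x ^ i with hS
  have hS1 : S 1 ≠ 0 := by simp [hS, NeZero.ne N]
  have hK1 : -Q 1 / S 1 - g * 1 = 0 := by simp [hQ, hS, hg]
  have hdiff : DifferentiableAt ℝ
      (fun t : ℝ ↦ -Q (Real.exp (-t) : ℂ) / S (Real.exp (-t) : ℂ) - g * (Real.exp (-t) : ℂ)) 0 := by
    have he : DifferentiableAt ℝ (fun t : ℝ ↦ (Real.exp (-t) : ℂ)) 0 := by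
      have : DifferentiableAt ℝ (fun t : ℝ ↦ Real.exp (-t)) 0 := by fun_prop
      exact (Complex.ofRealCLM.differentiableAt).comp (0 : ℝ) this
    have hQd : DifferentiableAt ℝ (fun t : ℝ ↦ Q (Real.exp (-t) : ℂ)) 0 := by
      simp only [hQ]; fun_prop
    have hSd : DifferentiableAt ℝ (fun t : ℝ ↦ S (Real.exp (-t) : ℂ)) 0 := by
      simp only [hS]; fun_prop
    refine (hQd.neg.fun_div hSd ?_).sub (he.const_mul g)
    simpa using hS1
  have hO := hdiff.isBigO_sub
  refine ((hO.mono nhdsWithin_le_nhds).congr' ?_ ?_)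
  · filter_upwards [self_mem_nhdsWithin] with t ht
    have hx : (Real.exp (-t) : ℂ) ≠ 1 := by
      have : Real.exp (-t) < 1 := by simpa using ht
      exact_mod_cast this.ne
    simp only [neg_zero, Real.exp_zero, Complex.ofReal_one]
    rw [hK1, sub_zero]
    congr 1
    set x : ℂ := (Real.exp (-t) : ℂ)
    have h1 : ∑ j ∈ Finset.range N, Φ j * x ^ j = (x - 1) * Q x := by
      rw [← sub_zero (∑ j ∈ Finset.range N, Φ j * x ^ j), ← hsum, ← Finset.sum_sub_distrib, hQ,
        Finset.mul_sum]
      refine Finset.sum_congr rfl fun j _ ↦ ?_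
      linear_combination -Φ j * geom_sum_mul x j
    have h2 : 1 - x ^ N = -((x - 1) * S x) := by
      linear_combination geom_sum_mul x N
    rw [h1, h2, div_neg, mul_div_mul_left _ _ (sub_ne_zero.mpr hx), neg_div]
  · filter_upwards with t
    simp

theorem ZMod.sum_eq_sum_range {N : ℕ} [NeZero N] {M : Type*} [AddCommMonoid M] (F : ZMod N → M) :
    ∑ j, F j = ∑ j ∈ Finset.range N, F (j : ZMod N) := by
  refine Finset.sum_nbij' (fun j ↦ j.val) (fun n ↦ (n : ZMod N)) ?_ ?_ ?_ ?_ ?_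
  · intro j _; simpa using ZMod.val_lt j
  · simp
  · simp
  · intro n hn; exact ZMod.val_cast_of_lt (Finset.mem_range.mp hn)
  · simp

open Filter Asymptotics Topology in
/-- The value at `0` of the `L`-function of a function `Φ` of mean zero on `ZMod N` that vanishes
at `0`. For `1 < re s` the function `L(Φ, s) - g` is `1 / Γ(s)` times the Mellin transform of the
generating function of `Φ`, corrected by `g e^{-t}`. With `g` the limit of the generating function
at `t = 0`, the Mellin integral still converges for `-1 < re s`, and `1 / Γ` vanishes at `0`. -/
theorem ZMod.LFunction_zero_of_sum_eq_zero {N : ℕ} [NeZero N] (Φ : ZMod N → ℂ)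
    (h0 : Φ 0 = 0) (hsum : ∑ j, Φ j = 0) :
    ZMod.LFunction Φ 0 = -(∑ j ∈ Finset.range N, Φ j * j) / N := by
  set g : ℂ := -(∑ j ∈ Finset.range N, Φ j * j) / N with hg
  have hsum' : ∑ j ∈ Finset.range N, Φ (j : ZMod N) = 0 := by
    rw [← ZMod.sum_eq_sum_range, hsum]
  -- The coefficients of the Dirichlet series `L(Φ, s) - g` and their generating function.
  set a : ℕ → ℂ := fun n ↦ Φ n - if n = 1 then g else 0 with ha
  set h : ℝ → ℂ := fun t ↦ (∑ j ∈ Finset.range N, Φ j * (Real.exp (-t) : ℂ) ^ j) /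
      (1 - (Real.exp (-t) : ℂ) ^ N) - g * Real.exp (-t) with hh
  have hbot : h =O[𝓝[>] 0] (fun t : ℝ ↦ t ^ (-(-1 : ℝ))) := by
    simpa only [neg_neg, Real.rpow_one] using
      isBigO_periodic_generating_function (fun n ↦ Φ n) hsum' g hg
  have htop : h =O[atTop] (fun t : ℝ ↦ Real.exp (-1 * t)) := by
    have hexp : Tendsto (fun t : ℝ ↦ (Real.exp (-t) : ℂ)) atTop (𝓝 0) := by
      exact_mod_cast (Complex.continuous_ofReal.tendsto 0).comp
        (Real.tendsto_exp_neg_atTop_nhds_zero)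
    have hone : (fun t : ℝ ↦ (1 - (Real.exp (-t) : ℂ) ^ N)⁻¹) =O[atTop] (fun _ ↦ (1 : ℝ)) := by
      have h1 : Tendsto (fun t : ℝ ↦ (1 - (Real.exp (-t) : ℂ) ^ N)⁻¹) atTop
          (𝓝 (1 - (0 : ℂ) ^ N)⁻¹) :=
        (tendsto_const_nhds.sub (hexp.pow N)).inv₀ (by simp [NeZero.ne N])
      exact h1.isBigO_one ℝ
    have hpow : ∀ j : ℕ, 1 ≤ j →
        (fun t : ℝ ↦ (Real.exp (-t) : ℂ) ^ j) =O[atTop] (fun t : ℝ ↦ Real.exp (-1 * t)) := by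
      intro j hj
      refine IsBigO.of_bound 1 ?_
      filter_upwards [eventually_ge_atTop 0] with t ht
      have h0 : 0 < Real.exp (-t) := Real.exp_pos _
      rw [norm_pow, Complex.norm_real, Real.norm_of_nonneg h0.le, neg_one_mul,
        Real.norm_of_nonneg h0.le, one_mul]
      exact pow_le_of_le_one h0.le (by simpa using ht) (by lia)
    refine IsBigO.sub ?_ ?_
    · have hP : (fun t : ℝ ↦ ∑ j ∈ Finset.range N, Φ j * (Real.exp (-t) : ℂ) ^ j) =O[atTop]
          (fun t : ℝ ↦ Real.exp (-1 * t)) := by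
        refine IsBigO.fun_sum fun j _ ↦ ?_
        rcases Nat.eq_zero_or_pos j with rfl | hj
        · simpa [h0] using isBigO_zero _ _
        · exact (hpow j hj).const_mul_left _
      simpa [div_eq_mul_inv] using hP.mul hone
    · simpa only [pow_one] using (hpow 1 le_rfl).const_mul_left g
  have hcont : ContinuousOn h (Set.Ioi 0) := by
    refine ContinuousOn.sub (ContinuousOn.div (by fun_prop) (by fun_prop) ?_) (by fun_prop)
    intro t ht
    have h1 : Real.exp (-t) ^ N < 1 :=
      pow_lt_one₀ (Real.exp_pos _).le (by simpa using ht) (NeZero.ne N)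
    rw [sub_ne_zero]
    exact_mod_cast h1.ne'
  have hdiff : ∀ s : ℂ, -1 < s.re → DifferentiableAt ℂ (mellin h) s := fun s hs ↦
    mellin_differentiableAt_of_isBigO_rpow_exp one_pos
      (hcont.locallyIntegrableOn measurableSet_Ioi) htop hbot hs
  obtain ⟨C, hC⟩ : ∃ C, ∀ n : ℕ, ‖Φ n‖ ≤ C :=
    ⟨∑ j, ‖Φ j‖, fun n ↦ Finset.single_le_sum (f := fun j ↦ ‖Φ j‖)
      (fun _ _ ↦ norm_nonneg _) (Finset.mem_univ _)⟩
  have hseries : ∀ t ∈ Set.Ioi (0 : ℝ),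
      HasSum (fun n : ℕ ↦ a n * Real.exp (-(n : ℝ) * t)) (h t) := by
    intro t ht
    set x : ℂ := (Real.exp (-t) : ℂ) with hx
    have hx1 : ‖x‖ < 1 := by
      rw [hx, Complex.norm_real, Real.norm_of_nonneg (Real.exp_pos _).le]
      simpa using ht
    have hxN : 1 - x ^ N ≠ 0 := by
      intro h1
      have : ‖x ^ N‖ < 1 := by
        rw [norm_pow]; exact pow_lt_one₀ (norm_nonneg _) hx1 (NeZero.ne N)
      rw [← sub_eq_zero.mp h1] at this
      simp at this
    have hsm : Summable fun n : ℕ ↦ Φ n * x ^ n := by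
      refine Summable.of_norm_bounded
        ((summable_geometric_of_lt_one (norm_nonneg x) hx1).mul_left C) fun n ↦ ?_
      rw [norm_mul, norm_pow]
      gcongr
      exact hC n
    have hT : ∑' n : ℕ, Φ n * x ^ n = (∑ j ∈ Finset.range N, Φ j * x ^ j) / (1 - x ^ N) := by
      rw [eq_div_iff hxN]
      have h1 := hsm.sum_add_tsum_nat_add N
      have h2 : ∀ n : ℕ, Φ (n + N : ℕ) * x ^ (n + N) = x ^ N * (Φ n * x ^ n) := fun n ↦ by
        push_cast; rw [ZMod.natCast_self, add_zero]; ring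
      simp_rw [h2, tsum_mul_left] at h1
      linear_combination -h1
    have h3 : HasSum (fun n : ℕ ↦ (if n = 1 then g else 0) * x ^ n) (g * x) := by
      simpa using hasSum_ite_eq (1 : ℕ) (g * x) |>.congr_fun fun n ↦ by
        split_ifs with h <;> simp [h]
    have h4 := hsm.hasSum.sub h3
    rw [hT] at h4
    refine h4.congr_fun fun n ↦ ?_
    have : (Real.exp (-(n : ℝ) * t) : ℂ) = x ^ n := by
      rw [hx, ← Complex.ofReal_pow, ← Real.exp_nat_mul]; congr 2; ring
    rw [this, ha]; ring
  have hL : ∀ s : ℂ, 1 < s.re → ZMod.LFunction Φ s - g = (Complex.Gamma s)⁻¹ * mellin h s := by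
    intro s hs
    have hs0 : 0 < s.re := by linarith
    have hΓ : Complex.Gamma s ≠ 0 := Complex.Gamma_ne_zero_of_re_pos hs0
    have hM : HasSum (fun n : ℕ ↦ Complex.Gamma s * a n / ((n : ℝ) : ℂ) ^ s) (mellin h s) := by
      refine hasSum_mellin (fun n ↦ ?_) hs0 hseries ?_
      · rcases Nat.eq_zero_or_pos n with rfl | hn
        · left; simp [ha, h0]
        · right; exact_mod_cast hn
      · refine Summable.of_nonneg_of_le (fun n ↦ by positivity) (fun n ↦ ?_)
          ((Real.summable_one_div_nat_rpow.mpr hs).mul_left (C + ‖g‖))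
        rw [mul_one_div]
        gcongr
        refine (norm_sub_le _ _).trans (add_le_add (hC n) ?_)
        split_ifs <;> simp
    have hΦ : HasSum (fun n : ℕ ↦ Φ n / (n : ℂ) ^ s) (ZMod.LFunction Φ s) := by
      rw [ZMod.LFunction_eq_LSeries Φ hs]
      refine (ZMod.LSeriesSummable_of_one_lt_re Φ hs).LSeriesHasSum.congr_fun fun n ↦ ?_
      rcases eq_or_ne n 0 with rfl | hn
      · simp [h0]
      · rw [LSeries.term_of_ne_zero hn]
    have h3 : HasSum (fun n : ℕ ↦ (if n = 1 then g else 0) / (n : ℂ) ^ s) g := by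
      refine (hasSum_ite_eq (1 : ℕ) g).congr_fun fun n ↦ ?_
      split_ifs with h <;> simp [h]
    rw [eq_inv_mul_iff_mul_eq₀ hΓ]
    refine HasSum.unique (((hΦ.sub h3).mul_left (Complex.Gamma s)).congr_fun fun n ↦ ?_) hM
    rw [ha]; push_cast; ring
  have key : Set.EqOn (fun s ↦ ZMod.LFunction Φ s - g) (fun s ↦ (Complex.Gamma s)⁻¹ * mellin h s)
      {s : ℂ | -1 < s.re} := by
    have hopen : IsOpen {s : ℂ | -1 < s.re} := isOpen_lt continuous_const Complex.continuous_re
    have hpre : IsPreconnected {s : ℂ | -1 < s.re} :=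
      (convex_halfSpace_re_gt (-1)).isPreconnected
    refine AnalyticOnNhd.eqOn_of_preconnected_of_eventuallyEq (z₀ := 2)
      (DifferentiableOn.analyticOnNhd ?_ hopen) (DifferentiableOn.analyticOnNhd ?_ hopen) hpre
      (by norm_num) ?_
    · exact ((ZMod.differentiable_LFunction_of_sum_zero hsum).sub_const g).differentiableOn
    · intro s hs
      exact ((Complex.differentiable_one_div_Gamma s).mul (hdiff s hs)).differentiableWithinAt
    · have : {s : ℂ | 1 < s.re} ∈ 𝓝 (2 : ℂ) :=
        (isOpen_lt continuous_const Complex.continuous_re).mem_nhds (by norm_num)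
      filter_upwards [this] with s hs using hL s hs
  have := key (show (0 : ℂ) ∈ {s : ℂ | -1 < s.re} by simp)
  simpa [sub_eq_zero] using this

/-- For an odd function `Φ` on `ZMod N`, the sum of `Φ` against the first Bernoulli function is
`-L(Φ, 0)`, which by the functional equation is a nonzero multiple of the value at `1` of the
`L`-function of the Fourier transform of `Φ`. -/
theorem sum_mul_bernoulliB1_ne_zero {N : ℕ} [NeZero N] (Φ : ZMod N → ℂ) (hodd : Φ.Odd)
    (hL : ZMod.LFunction (ZMod.dft Φ) 1 ≠ 0) :
    ∑ j ∈ Finset.range N, Φ j * (bernoulliB1 ((j : ℝ) / N) : ℂ) ≠ 0 := by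
  have h0 : Φ 0 = 0 := by
    have := hodd 0
    rw [neg_zero] at this
    exact self_eq_neg.mp this
  have hsum : ∑ j, Φ j = 0 := hodd.sum_eq_zero
  have h1 := ZMod.LFunction_one_sub Φ (s := 1) (fun n h ↦ ?_) (Or.inl h0)
  swap
  · have := congrArg Complex.re h
    simp at this
    have h2 : (0 : ℝ) ≤ n := n.cast_nonneg
    linarith
  have hneg : (fun x ↦ Φ (-x)) = (-1 : ℂ) • Φ := by
    ext x; simp [hodd x]
  have hLneg : ZMod.LFunction (ZMod.dft fun x ↦ Φ (-x)) 1 = -ZMod.LFunction (ZMod.dft Φ) 1 := by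
    rw [hneg, map_smul]
    simp [ZMod.LFunction]
  have e1 : Complex.exp (Real.pi * Complex.I * 1 / 2) = Complex.I := by
    rw [mul_one, mul_div_right_comm]; exact Complex.exp_pi_div_two_mul_I
  have e2 : Complex.exp (-Real.pi * Complex.I * 1 / 2) = -Complex.I := by
    rw [mul_one, mul_div_right_comm]; exact Complex.exp_neg_pi_div_two_mul_I
  rw [hLneg, sub_self, ZMod.LFunction_zero_of_sum_eq_zero Φ h0 hsum, e1, e2] at h1
  have h3 : ∑ j ∈ Finset.range N, Φ j * (bernoulliB1 ((j : ℝ) / N) : ℂ) =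
      (∑ j ∈ Finset.range N, Φ j * j) / N := by
    have h4 : ∑ j ∈ Finset.range N, Φ j * (1 / 2 : ℂ) = 0 := by
      rw [← Finset.sum_mul, ← ZMod.sum_eq_sum_range, hsum, zero_mul]
    rw [Finset.sum_div, ← sub_zero (∑ j ∈ Finset.range N, Φ j * j / N), ← h4,
      ← Finset.sum_sub_distrib]
    refine Finset.sum_congr rfl fun j hj ↦ ?_
    rcases Nat.eq_zero_or_pos j with rfl | hjpos
    · simp [h0]
    have hN : (0 : ℝ) < N := Nat.cast_pos.mpr (NeZero.pos N)
    have hlt : (j : ℝ) / N < 1 := by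
      rw [div_lt_one hN]; exact_mod_cast Finset.mem_range.mp hj
    have hpos : 0 < (j : ℝ) / N := by positivity
    have hfl : ⌊(j : ℝ) / N⌋ = 0 := Int.floor_eq_zero_iff.mpr ⟨hpos.le, hlt⟩
    have hnint : ¬ ∃ m : ℤ, (j : ℝ) / N = m := by
      rintro ⟨m, hm⟩
      rw [hm] at hlt hpos
      have h5 : m < 1 := by exact_mod_cast hlt
      have h6 : 0 < m := by exact_mod_cast hpos
      lia
    rw [bernoulliB1, if_neg hnint, hfl]
    push_cast
    ring
  rw [h3]
  intro h5
  rw [neg_div, h5] at h1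
  have hne :
      (2 * (Real.pi : ℂ)) ^ (-1 : ℂ) * (2 * Complex.I * ZMod.LFunction (ZMod.dft Φ) 1) ≠ 0 := by
    refine mul_ne_zero ?_ (mul_ne_zero (by simp) hL)
    simp [Complex.cpow_neg_one, Real.pi_ne_zero]
  apply hne
  simp only [Complex.cpow_zero, Complex.Gamma_one, mul_one, one_mul, neg_zero] at h1
  rw [h1]; ring

/-! ### The first Bernoulli function -/

theorem bernoulliB1_eq_fract (x : ℝ) :
    bernoulliB1 x = if Int.fract x = 0 then 0 else Int.fract x - 1 / 2 := by
  have h : (∃ m : ℤ, x = m) ↔ Int.fract x = 0 := by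
    rw [Int.fract_eq_zero_iff]
    exact ⟨fun ⟨m, hm⟩ ↦ ⟨m, hm.symm⟩, fun ⟨m, hm⟩ ↦ ⟨m, hm.symm⟩⟩
  rw [bernoulliB1, ← Int.fract]
  simp only [h]

theorem bernoulliB1_add_intCast (x : ℝ) (m : ℤ) : bernoulliB1 (x + m) = bernoulliB1 x := by
  simp [bernoulliB1_eq_fract]

/-- The distribution relation of the first Bernoulli function. -/
theorem sum_bernoulliB1_add_div {N : ℕ} (hN : 0 < N) (x : ℝ) :
    ∑ t ∈ Finset.range N, bernoulliB1 (x + t / N) = bernoulliB1 (N * x) := by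
  have hN' : (0 : ℝ) < N := Nat.cast_pos.mpr hN
  set F : ℝ → ℝ := fun x ↦ ∑ t ∈ Finset.range N, bernoulliB1 (x + t / N) - bernoulliB1 (N * x)
    with hF
  have hper : Function.Periodic F (1 / N : ℝ) := by
    intro x
    have h1 : ∑ t ∈ Finset.range N, bernoulliB1 (x + 1 / N + t / N) =
        ∑ t ∈ Finset.range N, bernoulliB1 (x + t / N) := by
      have h2 : ∀ t : ℕ, x + 1 / N + t / N = x + (t + 1 : ℕ) / N := fun t ↦ by push_cast; ring
      simp_rw [h2]
      have h3 := Finset.sum_range_succ (fun t : ℕ ↦ bernoulliB1 (x + t / N)) N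
      rw [Finset.sum_range_succ' (fun t : ℕ ↦ bernoulliB1 (x + t / N)) N] at h3
      have h4 : bernoulliB1 (x + (N : ℕ) / N) = bernoulliB1 (x + (0 : ℕ) / N) := by
        rw [div_self hN'.ne']
        simpa using bernoulliB1_add_intCast x 1
      linarith
    have h5 : bernoulliB1 (N * (x + 1 / N)) = bernoulliB1 (N * x) := by
      rw [mul_add, mul_one_div_cancel hN'.ne']
      exact_mod_cast bernoulliB1_add_intCast (N * x) 1
    simp only [hF]
    rw [h1, h5]
  -- By periodicity it is enough to treat `0 ≤ y < 1 / N`, where all fractional parts are explicit.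
  suffices h : F x = 0 from sub_eq_zero.mp h
  obtain ⟨y, ⟨hy0, hy1⟩, hxy⟩ := hper.exists_mem_Ico₀ (by positivity : (0 : ℝ) < 1 / N) x
  rw [hxy]
  have hNy : N * y < 1 := by rwa [lt_div_iff₀ hN', mul_comm] at hy1
  have hfr : ∀ t ∈ Finset.range N, Int.fract (y + t / N) = y + t / N := by
    intro t ht
    refine Int.fract_eq_self.mpr ⟨by positivity, ?_⟩
    have h1 : (t : ℝ) + 1 ≤ N := by exact_mod_cast Finset.mem_range.mp ht
    have h2 : (t : ℝ) / N ≤ (N - 1) / N := by gcongr; linarith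
    have h3 : ((N : ℝ) - 1) / N = 1 - 1 / N := by field_simp
    linarith
  have hsumid : ∑ t ∈ Finset.range N, ((t : ℝ) / N) = (N - 1) / 2 := by
    have h1 : (∑ t ∈ Finset.range N, (t : ℝ)) * 2 = N * (N - 1) := by
      have := Finset.sum_range_id_mul_two N
      have h2 : ((∑ t ∈ Finset.range N, t : ℕ) : ℝ) * 2 = (N * (N - 1 : ℕ) : ℕ) := by
        exact_mod_cast this
      push_cast [Nat.cast_pred hN] at h2
      exact h2
    rw [← Finset.sum_div]
    field_simp
    linarith
  have hfrN : Int.fract (N * y) = N * y := Int.fract_eq_self.mpr ⟨by positivity, hNy⟩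
  simp only [hF, sub_eq_zero]
  rcases hy0.eq_or_lt with rfl | hypos
  · obtain ⟨M, rfl⟩ : ∃ M, N = M + 1 := ⟨N - 1, by lia⟩
    have h1 : ∀ t ∈ Finset.range M, bernoulliB1 (0 + (t + 1 : ℕ) / (M + 1 : ℕ)) =
        ((t + 1 : ℕ) : ℝ) / (M + 1 : ℕ) - 1 / 2 := by
      intro t ht
      rw [bernoulliB1_eq_fract, hfr (t + 1) (by simpa using ht), zero_add, if_neg (by positivity)]
    rw [Finset.sum_range_succ', Finset.sum_congr rfl h1, Finset.sum_sub_distrib]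
    rw [Finset.sum_range_succ'] at hsumid
    simp only [Finset.sum_const, Finset.card_range]
    simp [bernoulliB1_eq_fract] at hsumid ⊢
    linarith
  · have h1 : ∀ t ∈ Finset.range N, bernoulliB1 (y + t / N) = y + t / N - 1 / 2 := by
      intro t ht
      rw [bernoulliB1_eq_fract, hfr t ht, if_neg (by positivity)]
    rw [Finset.sum_congr rfl h1, Finset.sum_sub_distrib, Finset.sum_add_distrib, hsumid,
      bernoulliB1_eq_fract, hfrN, if_neg (by positivity)]
    simp only [Finset.sum_const, Finset.card_range, nsmul_eq_mul]
    ring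

/-! ### Sums over a period -/

theorem Function.Periodic.exists_eq_zmod {N : ℕ} [NeZero N] {F : ℤ → ℂ}
    (hF : Function.Periodic F (N : ℤ)) : ∃ F' : ZMod N → ℂ, ∀ j : ℤ, F j = F' j := by
  refine ⟨fun z ↦ F z.val, fun j ↦ ?_⟩
  change F j = F ((j : ZMod N).val : ℤ)
  rw [ZMod.val_intCast]
  have h := hF.int_mul (j / N) (j % N)
  rw [Int.cast_id, Int.mul_comm, Int.emod_add_mul_ediv] at h
  exact h

theorem sum_range_mul_eq {N : ℕ} [NeZero N] {F : ℤ → ℂ} (hF : Function.Periodic F (N : ℤ)) {u : ℤ}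
    (hu : IsCoprime u N) :
    ∑ j ∈ Finset.range N, F (u * j) = ∑ j ∈ Finset.range N, F j := by
  obtain ⟨F', hF'⟩ := hF.exists_eq_zmod
  simp only [hF', Int.cast_mul, Int.cast_natCast]
  rw [← ZMod.sum_eq_sum_range (fun z : ZMod N ↦ F' (u * z)), ← ZMod.sum_eq_sum_range]
  obtain ⟨v, hv⟩ := (ZMod.coe_int_isUnit_iff_isCoprime u N).mpr hu.symm
  rw [← hv]
  exact Fintype.sum_equiv v.mulLeft _ _ fun _ ↦ rfl

theorem sum_range_mul_eq_sum_sum (F : ℤ → ℂ) (p M : ℕ) :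
    ∑ j ∈ Finset.range (p * M), F j =
      ∑ j ∈ Finset.range M, ∑ t ∈ Finset.range p, F (j + M * t) := by
  induction p with
  | zero => simp
  | succ p ih =>
    rw [Nat.succ_mul, Finset.sum_range_add, ih]
    simp_rw [Finset.sum_range_succ, Finset.sum_add_distrib]
    congr 1
    refine Finset.sum_congr rfl fun j _ ↦ ?_
    push_cast
    ring_nf

theorem sum_range_mul_ite_dvd (F : ℤ → ℂ) {p : ℕ} (hp : 0 < p) (M : ℕ) :
    ∑ j ∈ Finset.range (p * M), (if (p : ℤ) ∣ j then F j else 0) =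
      ∑ j ∈ Finset.range M, F (p * j) := by
  rw [mul_comm p M,
    sum_range_mul_eq_sum_sum (fun j : ℤ ↦ if (p : ℤ) ∣ j then F j else 0) M p,
    Finset.sum_eq_single 0]
  · simp
  · intro j hj hj0
    refine Finset.sum_eq_zero fun t _ ↦ if_neg ?_
    rw [dvd_add_left (dvd_mul_right _ _)]
    intro h
    exact hj0 (Nat.eq_zero_of_dvd_of_lt (Int.natCast_dvd_natCast.mp h) (Finset.mem_range.mp hj))
  · intro h; simp [hp] at h

theorem DirichletCharacter.periodic {N : ℕ} (χ : DirichletCharacter ℂ N) :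
    Function.Periodic (fun j : ℤ ↦ χ j) (N : ℤ) := by
  intro j; simp

/-- A Dirichlet character that is nontrivial on some `x ≡ 1 mod M` is orthogonal to every function
of period `M`. -/
theorem DirichletCharacter.sum_mul_periodic_eq_zero {N M : ℕ} [NeZero N]
    (χ : DirichletCharacter ℂ N) (hM : M ∣ N) {h : ℤ → ℂ} (hh : Function.Periodic h (M : ℤ))
    {x : ℤ} (hx : IsCoprime x N) (hx1 : (M : ℤ) ∣ x - 1) (hχ : χ x ≠ 1) :
    ∑ j ∈ Finset.range N, χ j * h j = 0 := by
  have hper : Function.Periodic (fun j : ℤ ↦ χ j * h j) (N : ℤ) := by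
    obtain ⟨k, rfl⟩ := hM
    refine χ.periodic.mul ?_
    have := hh.int_mul k
    rwa [show ((M * k : ℕ) : ℤ) = k * M by push_cast; ring]
  have h1 := sum_range_mul_eq hper hx
  have h2 : ∀ j : ℤ, h (x * j) = h j := by
    intro j
    obtain ⟨k, hk⟩ := hx1
    have : x * j = j + (k * j) * M := by linear_combination j * hk
    rw [this]
    exact hh.int_mul (k * j) j
  have h3 : ∑ j ∈ Finset.range N, χ ((x * j : ℤ) : ZMod N) * h (x * j) =
      χ x * ∑ j ∈ Finset.range N, χ j * h j := by
    rw [Finset.mul_sum]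
    refine Finset.sum_congr rfl fun j _ ↦ ?_
    rw [h2]; push_cast; rw [map_mul]; ring
  simp only [Int.cast_natCast] at h1
  rw [h3] at h1
  have h4 : (χ x - 1) * ∑ j ∈ Finset.range N, χ j * h j = 0 := by linear_combination h1
  exact (mul_eq_zero.mp h4).resolve_left (sub_ne_zero.mpr hχ)

/-- A primitive character is nontrivial on the residues `≡ 1 mod M` for every proper divisor `M` of
its level. -/
theorem DirichletCharacter.IsPrimitive.exists_apply_ne_one {N : ℕ} [NeZero N]
    {χ : DirichletCharacter ℂ N} (hχ : χ.IsPrimitive) {M : ℕ} (hM : M ∣ N) (hlt : M < N) :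
    ∃ x : ℤ, IsCoprime x N ∧ (M : ℤ) ∣ x - 1 ∧ χ x ≠ 1 := by
  by_contra! H
  have hf : χ.FactorsThrough M := by
    rw [DirichletCharacter.factorsThrough_iff_ker_unitsMap hM]
    intro u hu
    have hu1 : ((u.val.val : ℤ) : ZMod N) = u.val := by simp
    have hcop : IsCoprime (u.val.val : ℤ) N := by
      rw [isCoprime_comm, ← ZMod.coe_int_isUnit_iff_isCoprime, hu1]; exact u.isUnit
    have hdvd : (M : ℤ) ∣ u.val.val - 1 := by
      rw [MonoidHom.mem_ker, ← Units.val_inj, Units.val_one, ZMod.unitsMap_def, Units.coe_map] at hu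
      have h1 : ZMod.castHom hM (ZMod M) u.val = ((u.val.val : ℤ) : ZMod M) := by simp
      rw [MonoidHom.coe_coe, h1, ← Int.cast_one, eq_comm,
        ZMod.intCast_eq_intCast_iff_dvd_sub] at hu
      exact hu
    have h2 := H _ hcop hdvd
    rw [hu1] at h2
    rw [MonoidHom.mem_ker, ← Units.val_inj]
    simpa using h2
  have h3 : χ.conductor ≤ M := Nat.sInf_le hf
  rw [hχ] at h3
  lia

/-! ### Twisted Bernoulli functions and character sums -/

/-- The twist `x ↦ ∑_{n mod q} χ(n) B₁(n/q + x)` of the first Bernoulli function. -/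
noncomputable def twistedB1 {q : ℕ} (χ : DirichletCharacter ℂ q) (x : ℝ) : ℂ :=
  ∑ n ∈ Finset.range q, χ n * (bernoulliB1 ((n : ℝ) / q + x) : ℂ)

/-- The sum `y ↦ ∑_{a mod d} ψ(a) f(a y / d)`, where `f` is the twist of `B₁` by `χ`. -/
noncomputable def twistedB1Sum {q d : ℕ} (χ : DirichletCharacter ℂ q) (ψ : DirichletCharacter ℂ d)
    (y : ℤ) : ℂ :=
  ∑ a ∈ Finset.range d, ψ a * twistedB1 χ ((a : ℝ) * y / d)

/-- The sum `∑_{j mod c} ε(j) B₁(j/c) ∑_{a mod d} ψ(a) f(a j / d)`, where `f` is the twist of `B₁`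
by `χ`. For `d = c` it is the transform at `ψ` of the Dedekind sum `a ↦ S(a, c)` attached to `χ⁻¹`
and `ε⁻¹`. The modulus `d` of `ψ` is kept separate from `c`, so that it can be lowered for a
fixed `c`. -/
noncomputable def dedekindTransform {q₁ q₂ d : ℕ} (χ : DirichletCharacter ℂ q₁)
    (ε : DirichletCharacter ℂ q₂) (c : ℕ) (ψ : DirichletCharacter ℂ d) : ℂ :=
  ∑ j ∈ Finset.range c, ε j * (bernoulliB1 ((j : ℝ) / c) : ℂ) * twistedB1Sum χ ψ j

theorem twistedB1_add_intCast {q : ℕ} (χ : DirichletCharacter ℂ q) (x : ℝ) (m : ℤ) :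
    twistedB1 χ (x + m) = twistedB1 χ x := by
  simp only [twistedB1, ← add_assoc, bernoulliB1_add_intCast]

theorem periodic_bernoulliB1_div {c : ℕ} [NeZero c] (k : ℤ) (x : ℝ) :
    Function.Periodic (fun j : ℤ ↦ (bernoulliB1 ((k * j : ℝ) / c + x) : ℂ)) (c : ℤ) := by
  intro j
  have hc : (c : ℝ) ≠ 0 := NeZero.ne _
  have : (k * ((j + c : ℤ) : ℝ)) / c + x = (k * j : ℝ) / c + x + k := by
    push_cast; field_simp; ring
  simp only [this, bernoulliB1_add_intCast]

theorem periodic_twistedB1_div {q d : ℕ} [NeZero d] (χ : DirichletCharacter ℂ q) (k : ℤ) :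
    Function.Periodic (fun j : ℤ ↦ twistedB1 χ ((j * k : ℝ) / d)) (d : ℤ) := by
  intro j
  have hc : (d : ℝ) ≠ 0 := NeZero.ne _
  have : (((j + d : ℤ) : ℝ) * k) / d = (j * k : ℝ) / d + k := by
    push_cast; field_simp
  simp only [this, twistedB1_add_intCast]

theorem periodic_twistedB1Sum {q d : ℕ} [NeZero d] (χ : DirichletCharacter ℂ q)
    (ψ : DirichletCharacter ℂ d) : Function.Periodic (twistedB1Sum χ ψ) (d : ℤ) := by
  intro y
  have hc : (d : ℝ) ≠ 0 := NeZero.ne _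
  refine Finset.sum_congr rfl fun a _ ↦ ?_
  have : ((a : ℝ) * ((y + d : ℤ) : ℝ)) / d = (a : ℝ) * y / d + (a : ℤ) := by
    push_cast; field_simp
  rw [this, twistedB1_add_intCast]

theorem DirichletCharacter.mul_inv_apply_eq_one {N : ℕ} (χ : DirichletCharacter ℂ N) {a : ℤ}
    (ha : IsCoprime a N) : χ a * χ⁻¹ a = 1 := by
  rw [← MulChar.mul_apply, mul_inv_cancel,
    MulChar.one_apply ((ZMod.coe_int_isUnit_iff_isCoprime a N).mpr ha.symm)]

/-- The distribution relation of the twisted Bernoulli function at a prime. For `p ∣ q` both sides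
vanish, since `χ` is primitive. -/
theorem sum_twistedB1_add_div {q : ℕ} [NeZero q] {χ : DirichletCharacter ℂ q} (hχ : χ.IsPrimitive)
    {p : ℕ} (hp : p.Prime) (x : ℝ) :
    ∑ t ∈ Finset.range p, twistedB1 χ (x + t / p) = χ⁻¹ p * twistedB1 χ (p * x) := by
  have hq : (q : ℝ) ≠ 0 := NeZero.ne _
  have h1 : ∑ t ∈ Finset.range p, twistedB1 χ (x + t / p) =
      ∑ n ∈ Finset.range q, χ n * (bernoulliB1 (((p : ℤ) * (n : ℤ) : ℝ) / q + p * x) : ℂ) := by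
    simp only [twistedB1]
    rw [Finset.sum_comm]
    refine Finset.sum_congr rfl fun n _ ↦ ?_
    rw [← Finset.mul_sum]
    congr 1
    have := sum_bernoulliB1_add_div hp.pos ((n : ℝ) / q + x)
    simp_rw [← add_assoc]
    rw [← Complex.ofReal_sum, this]
    congr 2
    push_cast; ring
  rw [h1]
  by_cases hpq : p ∣ q
  · have hnu : χ⁻¹ (p : ZMod q) = 0 := by
      refine MulChar.map_nonunit _ fun h ↦ ?_
      rw [ZMod.isUnit_iff_coprime] at h
      exact (hp.coprime_iff_not_dvd.mp h) hpq
    rw [hnu, zero_mul]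
    obtain ⟨M, rfl⟩ := hpq
    have hM : 0 < M := Nat.pos_of_ne_zero fun h ↦ by simp [h] at hq
    have : NeZero M := ⟨hM.ne'⟩
    obtain ⟨y, hy, hy1, hχy⟩ := hχ.exists_apply_ne_one (M := M) (dvd_mul_left _ _)
      (by nlinarith [hp.two_le])
    refine χ.sum_mul_periodic_eq_zero (M := M) (dvd_mul_left _ _)
      (h := fun n : ℤ ↦ (bernoulliB1 (((p : ℤ) * n : ℝ) / (p * M : ℕ) + p * x) : ℂ)) ?_ hy hy1 hχy
    have h3 := periodic_bernoulliB1_div (c := M) 1 (p * x)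
    convert h3 using 4 with n
    have : (p : ℝ) ≠ 0 := by exact_mod_cast hp.ne_zero
    have : (M : ℝ) ≠ 0 := by exact_mod_cast hM.ne'
    push_cast; field_simp
  · have hcop : IsCoprime (p : ℤ) q := Nat.isCoprime_iff_coprime.mpr
      ((Nat.Prime.coprime_iff_not_dvd hp).mpr hpq)
    have hper : Function.Periodic
        (fun n : ℤ ↦ χ n * (bernoulliB1 (((1 : ℤ) * n : ℝ) / q + p * x) : ℂ)) (q : ℤ) :=
      χ.periodic.mul (periodic_bernoulliB1_div 1 (p * x))
    have h2 := sum_range_mul_eq hper hcop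
    have h4 := χ.mul_inv_apply_eq_one hcop
    simp only [Int.cast_mul, Int.cast_natCast, Int.cast_one, one_mul, map_mul] at h2 h4
    rw [twistedB1, ← h2, Finset.mul_sum]
    refine Finset.sum_congr rfl fun n _ ↦ ?_
    simp only [Int.cast_natCast]
    linear_combination -(χ n * (bernoulliB1 ((p * n : ℝ) / q + p * x) : ℂ)) * h4

/-! ### Change of modulus -/

section changeOfModulus

variable {q d : ℕ} {χ : DirichletCharacter ℂ q} {p : ℕ}

/-- The sum defining `twistedB1Sum`, extended to the modulus `p d`, at an argument prime to `p`: the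
residues modulo `p d` above a residue modulo `d` are summed by the distribution relation. -/
theorem sum_mul_twistedB1_of_not_dvd [NeZero q] [NeZero d] (hχ : χ.IsPrimitive) (hp : p.Prime)
    (ψ : DirichletCharacter ℂ d) {y : ℤ} (hy : ¬ (p : ℤ) ∣ y) :
    ∑ a ∈ Finset.range (p * d), ψ a * twistedB1 χ ((a : ℝ) * y / (p * d : ℕ)) =
      χ⁻¹ p * twistedB1Sum χ ψ y := by
  have hd : (d : ℝ) ≠ 0 := NeZero.ne _
  have hp0 : (p : ℝ) ≠ 0 := by exact_mod_cast hp.ne_zero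
  have : NeZero p := ⟨hp.ne_zero⟩
  have h1 := sum_range_mul_eq_sum_sum
    (fun a : ℤ ↦ ψ a * twistedB1 χ ((a : ℝ) * y / (p * d : ℕ))) p d
  simp only [Int.cast_natCast] at h1
  rw [h1, twistedB1Sum, Finset.mul_sum]
  refine Finset.sum_congr rfl fun a _ ↦ ?_
  have hcop : IsCoprime y (p : ℤ) :=
    ((Nat.prime_iff_prime_int.mp hp).coprime_iff_not_dvd.mpr hy).symm
  have hper : Function.Periodic
      (fun t : ℤ ↦ twistedB1 χ ((a : ℝ) * y / (p * d : ℕ) + t / p)) (p : ℤ) := by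
    intro t
    have : (a : ℝ) * y / (p * d : ℕ) + ((t + p : ℤ) : ℝ) / p =
        (a : ℝ) * y / (p * d : ℕ) + t / p + (1 : ℤ) := by
      push_cast; field_simp; ring
    simp only [this, twistedB1_add_intCast]
  have h2 := sum_range_mul_eq hper hcop
  simp only [Int.cast_natCast] at h2
  rw [sum_twistedB1_add_div hχ hp] at h2
  have h3 : (p : ℝ) * ((a : ℝ) * y / (p * d : ℕ)) = a * y / d := by
    push_cast; field_simp
  rw [h3] at h2
  rw [mul_left_comm, ← h2, Finset.mul_sum]
  refine Finset.sum_congr rfl fun t _ ↦ ?_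
  congr 1
  · simp
  · congr 1
    push_cast
    field_simp

/-- The sum defining `twistedB1Sum`, extended to the modulus `p d`, at a multiple of `p`. -/
theorem sum_mul_twistedB1_mul [NeZero d] (hp : p.Prime) (ψ : DirichletCharacter ℂ d) (y : ℤ) :
    ∑ a ∈ Finset.range (p * d), ψ a * twistedB1 χ ((a : ℝ) * (p * y : ℤ) / (p * d : ℕ)) =
      p * twistedB1Sum χ ψ y := by
  have hd : (d : ℝ) ≠ 0 := NeZero.ne _
  have hp0 : (p : ℝ) ≠ 0 := by exact_mod_cast hp.ne_zero
  have h1 := sum_range_mul_eq_sum_sum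
    (fun a : ℤ ↦ ψ a * twistedB1 χ ((a : ℝ) * (p * y : ℤ) / (p * d : ℕ))) p d
  simp only [Int.cast_natCast] at h1
  rw [h1, twistedB1Sum, Finset.mul_sum]
  refine Finset.sum_congr rfl fun a _ ↦ ?_
  have h2 : ∀ z : ℂ, (p : ℂ) * z = ∑ _t ∈ Finset.range p, z := fun z ↦ by simp
  rw [h2]
  refine Finset.sum_congr rfl fun t _ ↦ ?_
  congr 1
  · simp
  · rw [← twistedB1_add_intCast χ ((a : ℝ) * y / d) (t * y)]
    congr 1
    push_cast
    field_simp

theorem DirichletCharacter.changeLevel_apply_intCast {m n : ℕ} (ψ : DirichletCharacter ℂ m)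
    (h : m ∣ n) (a : ℤ) :
    DirichletCharacter.changeLevel h ψ a = if IsCoprime a n then ψ a else 0 := by
  split_ifs with ha
  · exact DirichletCharacter.changeLevel_eq_cast_of_dvd' ψ h ha
  · exact (DirichletCharacter.apply_eq_zero_iff _ a).mpr ha

theorem DirichletCharacter.changeLevel_apply_of_dvd (ψ : DirichletCharacter ℂ d)
    (hpd : p ∣ d) (a : ℤ) :
    DirichletCharacter.changeLevel (dvd_mul_left d p) ψ a = ψ a := by
  rw [DirichletCharacter.changeLevel_apply_intCast]
  split_ifs with ha
  · rfl
  · refine ((DirichletCharacter.apply_eq_zero_iff _ a).mpr fun h ↦ ha ?_).symm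
    push_cast
    exact (h.of_isCoprime_of_dvd_right (by exact_mod_cast hpd)).mul_right h

theorem DirichletCharacter.changeLevel_apply_of_not_dvd (hp : p.Prime) (ψ : DirichletCharacter ℂ d)
    (a : ℤ) :
    DirichletCharacter.changeLevel (dvd_mul_left d p) ψ a =
      ψ a - if (p : ℤ) ∣ a then ψ a else 0 := by
  rw [DirichletCharacter.changeLevel_apply_intCast]
  have hpa : IsCoprime a (p : ℤ) ↔ ¬ (p : ℤ) ∣ a := by
    rw [isCoprime_comm]; exact (Nat.prime_iff_prime_int.mp hp).coprime_iff_not_dvd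
  have hpd : IsCoprime a ((p * d : ℕ) : ℤ) ↔ ¬ (p : ℤ) ∣ a ∧ IsCoprime a d := by
    rw [Nat.cast_mul, IsCoprime.mul_right_iff, hpa]
  simp only [hpd]
  by_cases h1 : (p : ℤ) ∣ a
  · simp [h1]
  · simp only [h1, not_false_eq_true, true_and, if_false, sub_zero]
    split_ifs with h2
    · rfl
    · exact ((DirichletCharacter.apply_eq_zero_iff _ a).mpr h2).symm

theorem twistedB1Sum_changeLevel_of_dvd (ψ : DirichletCharacter ℂ d)
    (hpd : p ∣ d) (y : ℤ) :
    twistedB1Sum χ (DirichletCharacter.changeLevel (dvd_mul_left d p) ψ) y =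
      ∑ a ∈ Finset.range (p * d), ψ a * twistedB1 χ ((a : ℝ) * y / (p * d : ℕ)) := by
  refine Finset.sum_congr rfl fun a _ ↦ ?_
  have := DirichletCharacter.changeLevel_apply_of_dvd ψ hpd a
  rw [Int.cast_natCast, Int.cast_natCast] at this
  rw [this]

theorem twistedB1Sum_changeLevel [NeZero d] (hp : p.Prime) (ψ : DirichletCharacter ℂ d)
    (y : ℤ) :
    twistedB1Sum χ (DirichletCharacter.changeLevel (dvd_mul_left d p) ψ) y =
      ∑ a ∈ Finset.range (p * d), ψ a * twistedB1 χ ((a : ℝ) * y / (p * d : ℕ)) -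
        ψ p * twistedB1Sum χ ψ y := by
  have hd : (d : ℝ) ≠ 0 := NeZero.ne _
  have hp0 : (p : ℝ) ≠ 0 := by exact_mod_cast hp.ne_zero
  have h1 := sum_range_mul_ite_dvd
    (fun a : ℤ ↦ ψ a * twistedB1 χ ((a : ℝ) * y / (p * d : ℕ))) hp.pos d
  have h2 : ψ p * twistedB1Sum χ ψ y = ∑ a ∈ Finset.range d,
      ψ ((p * a : ℤ) : ZMod d) * twistedB1 χ (((p * a : ℤ) : ℝ) * y / (p * d : ℕ)) := by
    rw [twistedB1Sum, Finset.mul_sum]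
    refine Finset.sum_congr rfl fun a _ ↦ ?_
    rw [← mul_assoc]
    congr 1
    · push_cast; rw [map_mul]
    · congr 1; push_cast; field_simp
  rw [h2, ← h1, ← Finset.sum_sub_distrib]
  refine Finset.sum_congr rfl fun a _ ↦ ?_
  have := DirichletCharacter.changeLevel_apply_of_not_dvd hp ψ a
  simp only [Int.cast_natCast] at this ⊢
  rw [this]
  split_ifs <;> ring

/-- The character sum is an eigenvector of the dilations by units. -/
theorem twistedB1Sum_mul [NeZero d] (χ : DirichletCharacter ℂ q) (ψ : DirichletCharacter ℂ d)
    {u : ℤ} (hu : IsCoprime u d) (y : ℤ) :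
    twistedB1Sum χ ψ (u * y) = ψ⁻¹ u * twistedB1Sum χ ψ y := by
  have hper := ψ.periodic.mul (periodic_twistedB1_div χ (d := d) y)
  have h := sum_range_mul_eq hper hu
  have h1 := ψ.mul_inv_apply_eq_one hu
  simp only [Pi.mul_apply, Int.cast_mul, Int.cast_natCast, map_mul] at h
  rw [twistedB1Sum, twistedB1Sum, ← h, Finset.mul_sum]
  refine Finset.sum_congr rfl fun a _ ↦ ?_
  have h2 : (a : ℝ) * (u * y : ℤ) / d = u * a * y / d := by push_cast; ring
  rw [h2]
  linear_combination -(ψ a * twistedB1 χ (u * a * y / d)) * h1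

end changeOfModulus

/-! ### Change of modulus in the transform of the Dedekind sum -/

/-- Sums against `B₁(j / c)` do not depend on the choice of the period `c`. -/
theorem sum_mul_bernoulliB1_div_mul {c p : ℕ} (hc : 0 < c) (hp : 0 < p) {H : ℤ → ℂ}
    (hH : Function.Periodic H (c : ℤ)) :
    ∑ j ∈ Finset.range (p * c), H j * (bernoulliB1 ((j : ℝ) / (p * c : ℕ)) : ℂ) =
      ∑ j ∈ Finset.range c, H j * (bernoulliB1 ((j : ℝ) / c) : ℂ) := by
  have hc0 : (c : ℝ) ≠ 0 := by exact_mod_cast hc.ne'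
  have hp0 : (p : ℝ) ≠ 0 := by exact_mod_cast hp.ne'
  have h1 := sum_range_mul_eq_sum_sum
    (fun j : ℤ ↦ H j * (bernoulliB1 ((j : ℝ) / (p * c : ℕ)) : ℂ)) p c
  simp only [Int.cast_natCast] at h1
  rw [h1]
  refine Finset.sum_congr rfl fun j _ ↦ ?_
  have h2 : ∀ t : ℕ, H (j + c * t) = H j := fun t ↦ by
    have := hH.int_mul t j
    rwa [Int.cast_natCast, mul_comm] at this
  simp_rw [h2]
  rw [← Finset.mul_sum, ← Complex.ofReal_sum]
  congr 2
  have h3 := sum_bernoulliB1_add_div hp ((j : ℝ) / (p * c : ℕ))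
  have h4 : (p : ℝ) * ((j : ℝ) / (p * c : ℕ)) = j / c := by push_cast; field_simp
  rw [h4] at h3
  rw [← h3]
  refine Finset.sum_congr rfl fun t _ ↦ ?_
  congr 1
  push_cast
  field_simp

theorem sum_ite_dvd_mul_bernoulliB1 {c p : ℕ} (hp : 0 < p) (H : ℤ → ℂ) :
    ∑ j ∈ Finset.range (p * c),
      (if (p : ℤ) ∣ j then H j * (bernoulliB1 ((j : ℝ) / (p * c : ℕ)) : ℂ) else 0) =
      ∑ j ∈ Finset.range c, H (p * j) * (bernoulliB1 ((j : ℝ) / c) : ℂ) := by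
  have hp0 : (p : ℝ) ≠ 0 := by exact_mod_cast hp.ne'
  have h := sum_range_mul_ite_dvd
    (fun j : ℤ ↦ H j * (bernoulliB1 ((j : ℝ) / (p * c : ℕ)) : ℂ)) hp c
  simp only [Int.cast_natCast] at h
  rw [h]
  refine Finset.sum_congr rfl fun j _ ↦ ?_
  congr 3
  push_cast
  rcases eq_or_ne (c : ℝ) 0 with h0 | h0
  · simp [h0]
  · field_simp

theorem periodic_mul_twistedB1Sum {q₁ q₂ c d : ℕ} [NeZero d] (χ : DirichletCharacter ℂ q₁)
    (ε : DirichletCharacter ℂ q₂) (ψ : DirichletCharacter ℂ d) (hq : q₂ ∣ c) (hd : d ∣ c) :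
    Function.Periodic (fun j : ℤ ↦ ε j * twistedB1Sum χ ψ j) (c : ℤ) := by
  refine Function.Periodic.mul ?_ ?_
  · obtain ⟨k, rfl⟩ := hq
    have := ε.periodic.int_mul k
    rwa [show ((q₂ * k : ℕ) : ℤ) = (k : ℤ) * q₂ by push_cast; ring]
  · obtain ⟨k, rfl⟩ := hd
    have := (periodic_twistedB1Sum χ ψ).int_mul k
    rwa [show ((d * k : ℕ) : ℤ) = (k : ℤ) * d by push_cast; ring]

theorem dedekindTransform_eq_sum {q₁ q₂ c d : ℕ} (χ : DirichletCharacter ℂ q₁)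
    (ε : DirichletCharacter ℂ q₂) (ψ : DirichletCharacter ℂ d) :
    dedekindTransform χ ε c ψ =
      ∑ j ∈ Finset.range c, (ε ((j : ℤ) : ZMod q₂) * twistedB1Sum χ ψ j) *
        (bernoulliB1 ((j : ℝ) / c) : ℂ) := by
  refine Finset.sum_congr rfl fun j _ ↦ ?_
  rw [Int.cast_natCast]
  ring

section changeOfModulus

variable {q₁ q₂ p : ℕ} [NeZero q₁] {χ : DirichletCharacter ℂ q₁} {ε : DirichletCharacter ℂ q₂}

/-- Raising the modulus by a new prime `p` multiplies the transform by an Euler-type factor. -/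
theorem dedekindTransform_mul_of_not_dvd {c : ℕ} [NeZero c] (hχ : χ.IsPrimitive) (hp : p.Prime)
    (hq : q₂ ∣ c) (hpc : ¬ p ∣ c) (ψ : DirichletCharacter ℂ c) :
    dedekindTransform χ ε (p * c) (DirichletCharacter.changeLevel (dvd_mul_left c p) ψ) =
      (χ⁻¹ p + p * ε p - ψ p - χ⁻¹ p * ε p * ψ⁻¹ p) * dedekindTransform χ ε c ψ := by
  set u := χ⁻¹ (p : ZMod q₁)
  set v := ε (p : ZMod q₂)
  set w := ψ (p : ZMod c)
  have hcop : IsCoprime (p : ℤ) c :=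
    Nat.isCoprime_iff_coprime.mpr (hp.coprime_iff_not_dvd.mpr hpc)
  have hw : w * ψ⁻¹ (p : ZMod c) = 1 := by
    simpa using ψ.mul_inv_apply_eq_one hcop
  set H : ℤ → ℂ := fun j ↦ ε j * twistedB1Sum χ ψ j with hH
  have hHper : Function.Periodic H (c : ℤ) := periodic_mul_twistedB1Sum χ ε ψ hq dvd_rfl
  have hHp : ∀ j : ℤ, H (p * j) = v * ψ⁻¹ p * H j := by
    intro j
    simp only [hH]
    rw [twistedB1Sum_mul χ ψ hcop, Int.cast_mul, map_mul, Int.cast_natCast, Int.cast_natCast]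
    ring
  have hsplit : ∀ j : ℤ, ε j *
      twistedB1Sum χ (DirichletCharacter.changeLevel (dvd_mul_left c p) ψ) j =
      (u - w) * H j + if (p : ℤ) ∣ j then (p * w - u) * H j else 0 := by
    intro j
    rw [twistedB1Sum_changeLevel hp]
    split_ifs with hj
    · obtain ⟨y, rfl⟩ := hj
      rw [sum_mul_twistedB1_mul hp]
      have h1 := twistedB1Sum_mul χ ψ hcop y
      rw [Int.cast_natCast] at h1
      simp only [hH]
      rw [h1]
      linear_combination -(p : ℂ) * ε ((p * y : ℤ) : ZMod q₂) * twistedB1Sum χ ψ y * hw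
    · rw [sum_mul_twistedB1_of_not_dvd hχ hp ψ hj]
      simp only [hH]
      ring
  have h1 := sum_mul_bernoulliB1_div_mul (NeZero.pos c) hp.pos hHper
  have h2 := sum_ite_dvd_mul_bernoulliB1 (c := c) hp.pos H
  simp_rw [hHp, mul_assoc (v * _), ← Finset.mul_sum] at h2
  rw [dedekindTransform_eq_sum, dedekindTransform_eq_sum]
  calc _ = ∑ j ∈ Finset.range (p * c), ((u - w) *
        (H j * (bernoulliB1 ((j : ℝ) / (p * c : ℕ)) : ℂ)) + (p * w - u) *
        (if (p : ℤ) ∣ j then H j * (bernoulliB1 ((j : ℝ) / (p * c : ℕ)) : ℂ) else 0)) := by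
        refine Finset.sum_congr rfl fun j _ ↦ ?_
        rw [hsplit]
        split_ifs <;> ring
    _ = _ := by
        rw [Finset.sum_add_distrib, ← Finset.mul_sum, ← Finset.mul_sum, h1, h2]
        simp only [hH]
        linear_combination (p : ℂ) * v * (∑ j ∈ Finset.range c, (ε ((j : ℤ) : ZMod q₂) *
          twistedB1Sum χ ψ j) * (bernoulliB1 ((j : ℝ) / c) : ℂ)) * hw

/-- Raising the modulus by a prime `p` that divides it already, when `p` divides the conductor of
`χ`. -/
theorem dedekindTransform_mul_of_dvd {c : ℕ} [NeZero c] (hχ : χ.IsPrimitive) (hp : p.Prime)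
    (hpq : p ∣ q₁) (hpc : p ∣ c) (ψ : DirichletCharacter ℂ c) :
    dedekindTransform χ ε (p * c) (DirichletCharacter.changeLevel (dvd_mul_left c p) ψ) =
      p * ε p * dedekindTransform χ ε c ψ := by
  have hu : χ⁻¹ (p : ZMod q₁) = 0 := by
    refine MulChar.map_nonunit _ fun h ↦ ?_
    rw [ZMod.isUnit_iff_coprime] at h
    exact (hp.coprime_iff_not_dvd.mp h) hpq
  set H : ℤ → ℂ := fun j ↦ ε j *
      twistedB1Sum χ (DirichletCharacter.changeLevel (dvd_mul_left c p) ψ) j with hH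
  have h0 : ∀ j : ℤ, ¬ (p : ℤ) ∣ j → H j = 0 := by
    intro j hj
    simp only [hH]
    rw [twistedB1Sum_changeLevel_of_dvd ψ hpc, sum_mul_twistedB1_of_not_dvd hχ hp ψ hj, hu]
    simp
  rw [dedekindTransform_eq_sum, dedekindTransform_eq_sum]
  calc _ = ∑ j ∈ Finset.range (p * c),
        (if (p : ℤ) ∣ j then H j * (bernoulliB1 ((j : ℝ) / (p * c : ℕ)) : ℂ) else 0) := by
        refine Finset.sum_congr rfl fun j _ ↦ ?_
        split_ifs with hj
        · rfl
        · have := h0 j hj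
          simp only [hH] at this
          rw [this, zero_mul]
    _ = _ := by
        rw [sum_ite_dvd_mul_bernoulliB1 hp.pos, Finset.mul_sum]
        refine Finset.sum_congr rfl fun j _ ↦ ?_
        simp only [hH]
        rw [twistedB1Sum_changeLevel_of_dvd ψ hpc, sum_mul_twistedB1_mul hp, Int.cast_mul, map_mul,
          Int.cast_natCast, Int.cast_natCast]
        ring

theorem apply_eq_zero_of_dvd {p q : ℕ} (hp : p.Prime) (hpq : p ∣ q) (ε : DirichletCharacter ℂ q)
    {j : ℕ} (hj : p ∣ j) : ε j = 0 := by
  refine MulChar.map_nonunit _ fun h ↦ ?_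
  rw [ZMod.isUnit_iff_coprime] at h
  exact hp.one_lt.ne' (Nat.Coprime.eq_one_of_dvd (h.coprime_dvd_left hj) hpq)

/-- Raising the level of `ψ` alone by a prime `p` of `q₂` that divides it already. -/
theorem dedekindTransform_changeLevel_of_dvd {c d : ℕ} [NeZero d] (hχ : χ.IsPrimitive)
    (hp : p.Prime) (hpq : p ∣ q₂) (hpd : p ∣ d) (ψ : DirichletCharacter ℂ d) :
    dedekindTransform χ ε c (DirichletCharacter.changeLevel (dvd_mul_left d p) ψ) =
      χ⁻¹ p * dedekindTransform χ ε c ψ := by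
  rw [dedekindTransform, dedekindTransform, Finset.mul_sum]
  refine Finset.sum_congr rfl fun j _ ↦ ?_
  by_cases hj : p ∣ j
  · simp [apply_eq_zero_of_dvd hp hpq ε hj]
  · rw [twistedB1Sum_changeLevel_of_dvd ψ hpd, sum_mul_twistedB1_of_not_dvd hχ hp ψ
      (by exact_mod_cast hj)]
    ring

/-- Raising the level of `ψ` alone by a new prime `p` of `q₂`. -/
theorem dedekindTransform_changeLevel {c d : ℕ} [NeZero d] (hχ : χ.IsPrimitive)
    (hp : p.Prime) (hpq : p ∣ q₂) (ψ : DirichletCharacter ℂ d) :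
    dedekindTransform χ ε c (DirichletCharacter.changeLevel (dvd_mul_left d p) ψ) =
      (χ⁻¹ p - ψ p) * dedekindTransform χ ε c ψ := by
  rw [dedekindTransform, dedekindTransform, Finset.mul_sum]
  refine Finset.sum_congr rfl fun j _ ↦ ?_
  by_cases hj : p ∣ j
  · simp [apply_eq_zero_of_dvd hp hpq ε hj]
  · rw [twistedB1Sum_changeLevel hp ψ, sum_mul_twistedB1_of_not_dvd hχ hp ψ
      (by exact_mod_cast hj)]
    ring

end changeOfModulus

theorem norm_sub_lt_norm_mul_sub {v w : ℂ} (hv : ‖v‖ = 1) (hw : ‖w‖ = 1) {p : ℕ} (hp : 2 ≤ p) :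
    ‖v - w‖ < ‖p * v - w‖ := by
  have hp' : (2 : ℝ) ≤ p := by exact_mod_cast hp
  have hv2 : v.re ^ 2 + v.im ^ 2 = 1 := by
    have := Complex.sq_norm v
    rw [hv, Complex.normSq_apply] at this; linarith
  have hw2 : w.re ^ 2 + w.im ^ 2 = 1 := by
    have := Complex.sq_norm w
    rw [hw, Complex.normSq_apply] at this; linarith
  refine lt_of_pow_lt_pow_left₀ 2 (norm_nonneg _) ?_
  rw [Complex.sq_norm, Complex.sq_norm, Complex.normSq_apply, Complex.normSq_apply]
  simp only [Complex.sub_re, Complex.sub_im, Complex.mul_re, Complex.mul_im, Complex.natCast_re,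
    Complex.natCast_im, zero_mul, sub_zero, add_zero]
  have h1 : v.re * w.re + v.im * w.im ≤ 1 := by
    nlinarith [sq_nonneg (v.re - w.re), sq_nonneg (v.im - w.im)]
  have h2 : 0 ≤ ((p : ℝ) - 1) * (1 - (v.re * w.re + v.im * w.im)) :=
    mul_nonneg (by linarith) (by linarith)
  nlinarith [sq_nonneg ((p : ℝ) - 1)]

/-- The Euler-type factor at a new prime never vanishes. -/
theorem euler_factor_ne_zero {u v w w' : ℂ} (hu : u = 0 ∨ ‖u‖ = 1) (hv : ‖v‖ = 1) (hw : ‖w‖ = 1)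
    (hww : w * w' = 1) {p : ℕ} (hp : 2 ≤ p) : u + p * v - w - u * v * w' ≠ 0 := by
  intro h
  have h1 := norm_sub_lt_norm_mul_sub hv hw hp
  rcases hu with rfl | hu
  · have h2 : p * v - w = 0 := by linear_combination h
    rw [h2, norm_zero] at h1
    exact (norm_nonneg _).not_gt h1
  · have h2 := norm_sub_lt_norm_mul_sub hw hu hp
    -- If the factor vanishes, clearing the denominator `w` and multiplying by `p v - u` gives an
    -- equality of two products, the second of which is smaller in absolute value.
    have h3 : v * (p * v - w) * (p * w - u) = u * (w - u) * (v - w) := by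
      linear_combination w * (p * v - u) * h +
        u * v * (p * v - u) * hww
    have h4 := congrArg norm h3
    simp only [norm_mul, hu, hv, one_mul] at h4
    have h5 := mul_lt_mul'' h1 h2 (norm_nonneg _) (norm_nonneg _)
    rw [mul_comm ‖w - u‖] at h4
    linarith

/-- A new prime `p ∤ q₂` may be added to the modulus. -/
theorem exists_dedekindTransform_ne_zero_mul_of_not_dvd {q₁ q₂ p c : ℕ} [NeZero q₁] [NeZero c]
    {χ : DirichletCharacter ℂ q₁} {ε : DirichletCharacter ℂ q₂} (hχ : χ.IsPrimitive)
    (hp : p.Prime) (hq : q₂ ∣ c) (hpc : ¬ p ∣ c)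
    (h : ∃ ψ : DirichletCharacter ℂ c, dedekindTransform χ ε c ψ ≠ 0) :
    ∃ ψ : DirichletCharacter ℂ (p * c), dedekindTransform χ ε (p * c) ψ ≠ 0 := by
  obtain ⟨ψ, hψ⟩ := h
  refine ⟨DirichletCharacter.changeLevel (dvd_mul_left c p) ψ, ?_⟩
  rw [dedekindTransform_mul_of_not_dvd hχ hp hq hpc]
  refine mul_ne_zero ?_ hψ
  have hcop : p.Coprime c := hp.coprime_iff_not_dvd.mpr hpc
  have hnorm : ∀ {N : ℕ} (θ : DirichletCharacter ℂ N), p.Coprime N → ‖θ p‖ = 1 := fun θ hN ↦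
    θ.unit_norm_eq_one ((ZMod.isUnit_iff_coprime _ _).mpr hN).unit
  refine euler_factor_ne_zero ?_ (hnorm ε (hcop.coprime_dvd_right hq)) (hnorm ψ hcop) ?_ hp.two_le
  · by_cases hpq : p ∣ q₁
    · exact Or.inl (apply_eq_zero_of_dvd hp hpq _ dvd_rfl)
    · exact Or.inr (hnorm _ (hp.coprime_iff_not_dvd.mpr hpq))
  · simpa using ψ.mul_inv_apply_eq_one (Nat.isCoprime_iff_coprime.mpr hcop)

/-- A prime `p` with `p ∣ q₁` and `p ∤ q₂` that divides the modulus already may be added to it. -/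
theorem exists_dedekindTransform_ne_zero_mul_of_dvd {q₁ q₂ p c : ℕ} [NeZero q₁] [NeZero c]
    {χ : DirichletCharacter ℂ q₁} {ε : DirichletCharacter ℂ q₂} (hχ : χ.IsPrimitive)
    (hp : p.Prime) (hpq : p ∣ q₁) (hpq' : ¬ p ∣ q₂) (hpc : p ∣ c)
    (h : ∃ ψ : DirichletCharacter ℂ c, dedekindTransform χ ε c ψ ≠ 0) :
    ∃ ψ : DirichletCharacter ℂ (p * c), dedekindTransform χ ε (p * c) ψ ≠ 0 := by
  obtain ⟨ψ, hψ⟩ := h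
  refine ⟨DirichletCharacter.changeLevel (dvd_mul_left c p) ψ, ?_⟩
  rw [dedekindTransform_mul_of_dvd hχ hp hpq hpc]
  refine mul_ne_zero (mul_ne_zero (by exact_mod_cast hp.ne_zero) ?_) hψ
  have := DirichletCharacter.apply_ne_zero_iff ε (p : ℤ)
  rw [Int.cast_natCast] at this
  exact this.mpr (Nat.isCoprime_iff_coprime.mpr (hp.coprime_iff_not_dvd.mpr hpq'))

/-! ### Nonvanishing at the bottom level -/

theorem DirichletCharacter.LFunction_const_mul_one_ne_zero {N : ℕ} [NeZero N]
    {χ : DirichletCharacter ℂ N} (hχ : χ ≠ 1) {C : ℂ} (hC : C ≠ 0) :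
    ZMod.LFunction (fun k ↦ C * χ k) 1 ≠ 0 := by
  have h : ZMod.LFunction (fun k ↦ C * χ k) 1 = C * DirichletCharacter.LFunction χ 1 := by
    simp only [DirichletCharacter.LFunction, ZMod.LFunction, Finset.mul_sum]
    exact Finset.sum_congr rfl fun _ _ ↦ by ring
  rw [h]
  exact mul_ne_zero hC (DirichletCharacter.LFunction_apply_one_ne_zero hχ)

theorem DirichletCharacter.Odd.ne_one {N : ℕ} {χ : DirichletCharacter ℂ N} (hχ : χ.Odd) :
    χ ≠ 1 := by
  rintro rfl
  have h : (1 : DirichletCharacter ℂ N) (-1) = 1 := MulChar.one_apply isUnit_one.neg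
  rw [DirichletCharacter.Odd, h] at hχ
  norm_num at hχ

theorem DirichletCharacter.IsPrimitive.gaussSum_ne_zero {N : ℕ} [NeZero N]
    {χ : DirichletCharacter ℂ N} (hχ : χ.IsPrimitive) : gaussSum χ ZMod.stdAddChar ≠ 0 := by
  intro h
  have h1 : ZMod.dft (χ : ZMod N → ℂ) = 0 := by
    ext k
    rw [hχ.fourierTransform_eq_inv_mul_gaussSum, h, mul_zero, Pi.zero_apply]
  have h2 : (χ : ZMod N → ℂ) = 0 := (LinearEquiv.map_eq_zero_iff _).mp h1
  have h3 := congrFun h2 1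
  simp at h3

theorem DirichletCharacter.inv_apply_neg_one {N : ℕ} (χ : DirichletCharacter ℂ N) :
    χ⁻¹ (-1) = χ (-1) := by
  rw [MulChar.inv_apply, Ring.inverse_of_isUnit isUnit_one.neg]
  congr 1
  rw [Units.inv_eq_of_mul_eq_one_left]
  simp

/-- The generalized Bernoulli number of an odd character does not vanish, if all primes that divide
its level divide its conductor. -/
theorem DirichletCharacter.sum_apply_mul_bernoulliB1_ne_zero {c : ℕ} [NeZero c]
    {θ : DirichletCharacter ℂ c} (hodd : θ.Odd)
    (hcond : ∀ p : ℕ, p.Prime → p ∣ c → p ∣ θ.conductor) :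
    ∑ j ∈ Finset.range c, θ j * (bernoulliB1 ((j : ℝ) / c) : ℂ) ≠ 0 := by
  have hC0 : θ.conductor ≠ 0 := θ.conductor_ne_zero
  have : NeZero θ.conductor := ⟨hC0⟩
  set η := θ.primitiveCharacter with hη
  have hprim : η.IsPrimitive := θ.primitiveCharacter_isPrimitive
  have heq : ∀ j : ℤ, θ j = η j := by
    intro j
    by_cases hj : IsCoprime j c
    · exact (θ.primitiveCharacter_apply_of_isCoprime hj).symm
    · rw [(DirichletCharacter.apply_eq_zero_iff θ j).mpr hj, eq_comm,
        DirichletCharacter.apply_eq_zero_iff]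
      rw [Int.isCoprime_iff_nat_coprime, Nat.Prime.not_coprime_iff_dvd] at hj ⊢
      obtain ⟨p, hp, h1, h2⟩ := hj
      exact ⟨p, hp, h1, by simpa using hcond p hp (by simpa using h2)⟩
  have hηodd : η.Odd := by
    have := heq (-1)
    push_cast at this
    rw [DirichletCharacter.Odd, ← this]
    exact hodd
  obtain ⟨k, hk⟩ := θ.conductor_dvd_level
  have hk0 : 0 < k := Nat.pos_of_ne_zero fun h ↦ NeZero.ne c (by rw [hk, h, mul_zero])
  have h1 := sum_mul_bernoulliB1_div_mul (NeZero.pos θ.conductor) hk0 η.periodic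
  have h2 : ∑ j ∈ Finset.range c, θ j * (bernoulliB1 ((j : ℝ) / c) : ℂ) =
      ∑ j ∈ Finset.range θ.conductor, η j * (bernoulliB1 ((j : ℝ) / θ.conductor) : ℂ) := by
    simp only [Int.cast_natCast] at h1
    rw [mul_comm k, ← hk] at h1
    rw [← h1]
    refine Finset.sum_congr rfl fun j _ ↦ ?_
    have := heq j
    simp only [Int.cast_natCast] at this
    rw [this]
  rw [h2]
  refine sum_mul_bernoulliB1_ne_zero (η : ZMod θ.conductor → ℂ) hηodd.to_fun ?_
  have h3 : ZMod.dft (η : ZMod θ.conductor → ℂ) =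
      fun k ↦ (η (-1) * gaussSum η ZMod.stdAddChar) * η⁻¹ k := by
    ext k
    rw [hprim.fourierTransform_eq_inv_mul_gaussSum, ← neg_one_mul, map_mul,
      DirichletCharacter.inv_apply_neg_one]
    ring
  rw [h3]
  refine DirichletCharacter.LFunction_const_mul_one_ne_zero ?_
    (mul_ne_zero ?_ hprim.gaussSum_ne_zero)
  · rw [ne_eq, inv_eq_one]; exact hηodd.ne_one
  · rw [hηodd]; norm_num

/-- For a primitive character the sum is an eigenvector of all dilations, not only those by
units. -/
theorem twistedB1Sum_eq_inv_mul {q d : ℕ} [NeZero d] (χ : DirichletCharacter ℂ q)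
    {ψ : DirichletCharacter ℂ d} (hψ : ψ.IsPrimitive) (y : ℤ) :
    twistedB1Sum χ ψ y = ψ⁻¹ y * twistedB1Sum χ ψ 1 := by
  by_cases hy : IsCoprime y d
  · simpa using twistedB1Sum_mul χ ψ hy 1
  · rw [(DirichletCharacter.apply_eq_zero_iff _ y).mpr hy, zero_mul]
    rw [Int.isCoprime_iff_nat_coprime, Nat.Prime.not_coprime_iff_dvd] at hy
    obtain ⟨p, hp, h1, h2⟩ := hy
    obtain ⟨z, rfl⟩ : (p : ℤ) ∣ y := Int.natCast_dvd.mpr h1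
    obtain ⟨M, rfl⟩ : p ∣ d := by simpa using h2
    have hM : M ≠ 0 := fun h ↦ NeZero.ne (p * M) (by rw [h, mul_zero])
    have : NeZero M := ⟨hM⟩
    obtain ⟨x, hx, hx1, hψx⟩ := hψ.exists_apply_ne_one (M := M) (dvd_mul_left _ _)
      (by nlinarith [hp.two_le, Nat.pos_of_ne_zero hM])
    have h3 := ψ.sum_mul_periodic_eq_zero (M := M) (dvd_mul_left _ _)
      (periodic_twistedB1_div χ (d := M) z) hx hx1 hψx
    rw [twistedB1Sum, ← h3]
    refine Finset.sum_congr rfl fun a _ ↦ ?_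
    congr 2
    have : (p : ℝ) ≠ 0 := by exact_mod_cast hp.ne_zero
    have : (M : ℝ) ≠ 0 := by exact_mod_cast hM
    push_cast
    field_simp

theorem ZMod.stdAddChar_neg_mul_mul {N d q : ℕ} [NeZero N] [NeZero d] (hN : N = d * q) (a k : ℕ) :
    ZMod.stdAddChar (-(((a * q : ℕ) : ZMod N) * (k : ZMod N))) =
      ZMod.stdAddChar (-((a : ZMod d) * (k : ZMod d))) := by
  have hN0 : (N : ℂ) ≠ 0 := NeZero.ne _
  have h1 := ZMod.stdAddChar_coe (N := N) (-(a * q * k : ℕ))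
  have h2 := ZMod.stdAddChar_coe (N := d) (-(a * k : ℕ))
  rw [hN] at hN0
  push_cast at h1 h2 hN0 ⊢
  obtain ⟨hd, hq⟩ := mul_ne_zero_iff.mp hN0
  rw [h1, h2, hN]
  congr 1
  push_cast
  field_simp

/-- The sum `G(1)` pairs `B₁` with the push-forward of `ψ ⊗ χ` to `ℤ/dq`, whose Fourier transform is
the product of those of `ψ` and `χ`, hence a nonzero multiple of the odd character `ψ⁻¹ χ⁻¹`. -/
theorem twistedB1Sum_one_ne_zero {q d : ℕ} [NeZero q] [NeZero d] {χ : DirichletCharacter ℂ q}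
    (hχ : χ.IsPrimitive) {ψ : DirichletCharacter ℂ d} (hψ : ψ.IsPrimitive)
    (hodd : χ (-1) * ψ (-1) = -1) : twistedB1Sum χ ψ 1 ≠ 0 := by
  have hd : (d : ℝ) ≠ 0 := NeZero.ne _
  have hq : (q : ℝ) ≠ 0 := NeZero.ne _
  -- The push-forward of `ψ ⊗ χ` to `ℤ/dq` along `(a, n) ↦ a q + n d`.
  set Φ : ZMod (d * q) → ℂ := fun b ↦ ∑ a ∈ Finset.range d, ∑ n ∈ Finset.range q,
    if ((a * q + n * d : ℕ) : ZMod (d * q)) = b then ψ a * χ n else 0 with hΦ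
  have hpush : ∀ F : ZMod (d * q) → ℂ, ∑ b, F b * Φ b =
      ∑ a ∈ Finset.range d, ∑ n ∈ Finset.range q,
        F ((a * q + n * d : ℕ) : ZMod (d * q)) * (ψ a * χ n) := by
    intro F
    simp only [hΦ, Finset.mul_sum]
    rw [Finset.sum_comm]
    refine Finset.sum_congr rfl fun a _ ↦ ?_
    rw [Finset.sum_comm]
    refine Finset.sum_congr rfl fun n _ ↦ ?_
    simp
  set θ : DirichletCharacter ℂ (d * q) :=
    DirichletCharacter.changeLevel (dvd_mul_right d q) ψ⁻¹ *
      DirichletCharacter.changeLevel (dvd_mul_left q d) χ⁻¹ with hθ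
  have hθapply : ∀ k : ℤ, θ k = ψ⁻¹ k * χ⁻¹ k := by
    intro k
    rw [hθ, MulChar.mul_apply, DirichletCharacter.changeLevel_apply_intCast,
      DirichletCharacter.changeLevel_apply_intCast]
    split_ifs with hk
    · rfl
    · rw [Nat.cast_mul, IsCoprime.mul_right_iff, not_and_or] at hk
      rcases hk with hk | hk
      · rw [(DirichletCharacter.apply_eq_zero_iff ψ⁻¹ k).mpr hk]; ring
      · rw [(DirichletCharacter.apply_eq_zero_iff χ⁻¹ k).mpr hk]; ring
  have hθodd : θ.Odd := by
    have := hθapply (-1)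
    push_cast at this
    rw [DirichletCharacter.inv_apply_neg_one, DirichletCharacter.inv_apply_neg_one] at this
    rw [DirichletCharacter.Odd, this, mul_comm (ψ (-1)), hodd]
  set C : ℂ := -(gaussSum ψ ZMod.stdAddChar * gaussSum χ ZMod.stdAddChar) with hC
  have hdft : ZMod.dft Φ = fun k ↦ C * θ k := by
    ext k
    obtain ⟨m, rfl⟩ : ∃ m : ℕ, k = m := ⟨k.val, by simp⟩
    have h1 : ZMod.dft Φ (m : ZMod (d * q)) = ZMod.dft (ψ : ZMod d → ℂ) (m : ZMod d) *
        ZMod.dft (χ : ZMod q → ℂ) (m : ZMod q) := by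
      simp only [ZMod.dft_apply, smul_eq_mul]
      rw [hpush (fun j ↦ ZMod.stdAddChar (-(j * (m : ZMod (d * q))))),
        ZMod.sum_eq_sum_range (fun j : ZMod d ↦ ZMod.stdAddChar (-(j * (m : ZMod d))) * ψ j),
        ZMod.sum_eq_sum_range (fun j : ZMod q ↦ ZMod.stdAddChar (-(j * (m : ZMod q))) * χ j),
        Finset.sum_mul_sum]
      refine Finset.sum_congr rfl fun a _ ↦ Finset.sum_congr rfl fun n _ ↦ ?_
      have h2 := ZMod.stdAddChar_neg_mul_mul (N := d * q) rfl a m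
      have h3 := ZMod.stdAddChar_neg_mul_mul (mul_comm d q) n m
      rw [← h2, ← h3, Nat.cast_add, add_mul, neg_add, AddChar.map_add_eq_mul]
      ring
    rw [h1, hψ.fourierTransform_eq_inv_mul_gaussSum, hχ.fourierTransform_eq_inv_mul_gaussSum]
    have h2 := hθapply m
    rw [Int.cast_natCast, Int.cast_natCast, Int.cast_natCast] at h2
    rw [h2, ← neg_one_mul (m : ZMod d), ← neg_one_mul (m : ZMod q), map_mul, map_mul,
      DirichletCharacter.inv_apply_neg_one, DirichletCharacter.inv_apply_neg_one, hC]
    linear_combination (ψ⁻¹ (m : ZMod d) * χ⁻¹ (m : ZMod q) * gaussSum ψ ZMod.stdAddChar *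
      gaussSum χ ZMod.stdAddChar) * hodd
  have hΦodd : Φ.Odd := by
    rw [← ZMod.dft_odd_iff, hdft]
    intro k
    simp only [hθodd.eval_neg, mul_neg]
  have hne := sum_mul_bernoulliB1_ne_zero Φ hΦodd (by
    rw [hdft]
    exact DirichletCharacter.LFunction_const_mul_one_ne_zero hθodd.ne_one
      (neg_ne_zero.mpr (mul_ne_zero hψ.gaussSum_ne_zero hχ.gaussSum_ne_zero)))
  obtain ⟨F, hF⟩ := (periodic_bernoulliB1_div (c := d * q) 1 0).exists_eq_zmod
  have hF' : ∀ j : ℕ, (bernoulliB1 ((j : ℝ) / (d * q : ℕ)) : ℂ) = F j := fun j ↦ by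
    simpa using hF j
  have hsum : ∑ j ∈ Finset.range (d * q), Φ j * (bernoulliB1 ((j : ℝ) / (d * q : ℕ)) : ℂ) =
      twistedB1Sum χ ψ 1 := by
    simp_rw [hF', mul_comm (Φ _)]
    rw [← ZMod.sum_eq_sum_range (fun b ↦ F b * Φ b), hpush, twistedB1Sum]
    refine Finset.sum_congr rfl fun a _ ↦ ?_
    rw [twistedB1, Finset.mul_sum]
    refine Finset.sum_congr rfl fun n _ ↦ ?_
    rw [← hF']
    have : ((a * q + n * d : ℕ) : ℝ) / (d * q : ℕ) = n / q + (a : ℝ) * (1 : ℤ) / d := by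
      push_cast; field_simp; ring
    rw [this]
    ring
  rwa [hsum] at hne

/-- The transform at a primitive `ψ` does not vanish, if all primes that divide `c` divide the
conductor of the product of `ε` and `ψ⁻¹`. -/
theorem dedekindTransform_ne_zero {q₁ q₂ c d : ℕ} [NeZero q₁] [NeZero c] [NeZero d]
    {χ : DirichletCharacter ℂ q₁} (hχ : χ.IsPrimitive) (ε : DirichletCharacter ℂ q₂)
    {ψ : DirichletCharacter ℂ d} (hψ : ψ.IsPrimitive) (hq : q₂ ∣ c) (hd : d ∣ c)
    (hoddχ : χ (-1) * ψ (-1) = -1) (hoddε : ε (-1) * ψ (-1) = -1)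
    (hrad : ∀ p : ℕ, p.Prime → p ∣ c → p ∣ q₂ ∨ p ∣ d)
    (hram : ∀ p : ℕ, p.Prime → p ∣ c → ∃ x : ℤ, IsCoprime x c ∧
      ((ordCompl[p] c : ℕ) : ℤ) ∣ x - 1 ∧ ε x * ψ⁻¹ x ≠ 1) :
    dedekindTransform χ ε c ψ ≠ 0 := by
  set θ : DirichletCharacter ℂ c :=
    DirichletCharacter.changeLevel hq ε * DirichletCharacter.changeLevel hd ψ⁻¹ with hθ
  have hθapply : ∀ k : ℤ, θ k = ε k * ψ⁻¹ k := by
    intro k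
    rw [hθ, MulChar.mul_apply, DirichletCharacter.changeLevel_apply_intCast,
      DirichletCharacter.changeLevel_apply_intCast]
    split_ifs with hk
    · rfl
    · rw [Int.isCoprime_iff_nat_coprime, Nat.Prime.not_coprime_iff_dvd] at hk
      obtain ⟨p, hp, h1, h2⟩ := hk
      rcases hrad p hp (by simpa using h2) with h | h
      · have : ε k = 0 := by
          rw [DirichletCharacter.apply_eq_zero_iff, Int.isCoprime_iff_nat_coprime,
            Nat.Prime.not_coprime_iff_dvd]
          exact ⟨p, hp, h1, by simpa using h⟩
        rw [this]; ring
      · have : ψ⁻¹ k = 0 := by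
          rw [DirichletCharacter.apply_eq_zero_iff, Int.isCoprime_iff_nat_coprime,
            Nat.Prime.not_coprime_iff_dvd]
          exact ⟨p, hp, h1, by simpa using h⟩
        rw [this]; ring
  have hθodd : θ.Odd := by
    have := hθapply (-1)
    push_cast at this
    rw [DirichletCharacter.inv_apply_neg_one, hoddε] at this
    exact this
  have hsum : dedekindTransform χ ε c ψ = twistedB1Sum χ ψ 1 *
      ∑ j ∈ Finset.range c, θ j * (bernoulliB1 ((j : ℝ) / c) : ℂ) := by
    rw [dedekindTransform, Finset.mul_sum]
    refine Finset.sum_congr rfl fun j _ ↦ ?_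
    have := hθapply j
    simp only [Int.cast_natCast] at this
    rw [twistedB1Sum_eq_inv_mul χ hψ, this, Int.cast_natCast]
    ring
  rw [hsum]
  refine mul_ne_zero (twistedB1Sum_one_ne_zero hχ hψ hoddχ)
    (DirichletCharacter.sum_apply_mul_bernoulliB1_ne_zero hθodd fun p hp hpc ↦ ?_)
  by_contra hpC
  obtain ⟨x, hx, hx1, hne⟩ := hram p hp hpc
  -- If `p` does not divide the conductor of `θ`, then `θ` is determined modulo the prime-to-`p`
  -- part of `c`.
  have hdvd : θ.conductor ∣ ordCompl[p] c :=
    Nat.Coprime.dvd_of_dvd_mul_left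
      (Nat.Coprime.pow_right _ ((hp.coprime_iff_not_dvd.mpr hpC).symm))
      (by rw [Nat.ordProj_mul_ordCompl_eq_self]; exact θ.conductor_dvd_level)
  have h1 : θ x = 1 := by
    rw [← θ.primitiveCharacter_apply_of_isCoprime hx]
    have h2 : ((x : ℤ) : ZMod θ.conductor) = ((1 : ℤ) : ZMod θ.conductor) := by
      rw [eq_comm, ZMod.intCast_eq_intCast_iff_dvd_sub]
      exact (Int.natCast_dvd_natCast.mpr hdvd).trans hx1
    rw [h2]; simp
  exact hne (by rw [← hθapply, h1])

/-! ### Admissible characters -/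

/-- A character `ψ` whose level divides `c` is admissible at `p` (relative to `ε` and `c`) if its
`p`-component is primitive modulo the exact power of `p` in `c`, and the product of `ε` and `ψ⁻¹`
is ramified at `p`. The first condition is witnessed by an integer that is `1` modulo `c / p`, the
second one by an integer that is `1` modulo the prime-to-`p` part of `c`. -/
structure IsAdmissibleAt {q d : ℕ} (ε : DirichletCharacter ℂ q) (c : ℕ)
    (ψ : DirichletCharacter ℂ d) (p : ℕ) : Prop where
  primitive : ∃ x : ℤ, IsCoprime x c ∧ ((c / p : ℕ) : ℤ) ∣ x - 1 ∧ ψ x ≠ 1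
  ramified : ∃ x : ℤ, IsCoprime x c ∧ ((ordCompl[p] c : ℕ) : ℤ) ∣ x - 1 ∧ ε x * ψ⁻¹ x ≠ 1

theorem DirichletCharacter.apply_eq_of_dvd_sub {N : ℕ} (χ : DirichletCharacter ℂ N) {x y : ℤ}
    (h : (N : ℤ) ∣ x - y) : χ x = χ y := by
  congr 1
  rw [eq_comm, ZMod.intCast_eq_intCast_iff_dvd_sub]
  exact h

theorem DirichletCharacter.apply_eq_one_of_dvd_sub_one {N : ℕ} (χ : DirichletCharacter ℂ N) {x : ℤ}
    (h : (N : ℤ) ∣ x - 1) : χ x = 1 := by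
  rw [χ.apply_eq_of_dvd_sub h]; simp

theorem DirichletCharacter.inv_apply_eq {N : ℕ} (χ : DirichletCharacter ℂ N) (a : ZMod N) :
    χ⁻¹ a = (χ a)⁻¹ := MulChar.inv_apply_eq_inv' χ a

theorem ordCompl_dvd_div {c p : ℕ} (hp : p.Prime) (hpc : p ∣ c) : ordCompl[p] c ∣ c / p := by
  rcases Nat.eq_zero_or_pos c with rfl | hc
  · simp
  · refine Nat.Coprime.dvd_of_dvd_mul_left
      ((Nat.coprime_ordCompl hp hc.ne').symm) ?_
    rw [Nat.mul_div_cancel' hpc]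
    exact Nat.ordCompl_dvd c p

/-- An integer prime to `p` can be prescribed modulo the `p`-part of `c`, and to be `1` modulo the
rest. -/
theorem exists_int_modEq_ordProj {c p : ℕ} (hp : p.Prime) (hc : c ≠ 0) {y : ℤ}
    (hy : IsCoprime y p) : ∃ x : ℤ, IsCoprime x c ∧ ((ordProj[p] c : ℕ) : ℤ) ∣ x - y ∧
      ((ordCompl[p] c : ℕ) : ℤ) ∣ x - 1 := by
  have hcop : IsCoprime ((ordProj[p] c : ℕ) : ℤ) ((ordCompl[p] c : ℕ) : ℤ) :=
    Nat.isCoprime_iff_coprime.mpr (Nat.Coprime.pow_left _ (Nat.coprime_ordCompl hp hc))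
  obtain ⟨a, b, hab⟩ := hcop
  set A : ℤ := ((ordProj[p] c : ℕ) : ℤ)
  set C : ℤ := ((ordCompl[p] c : ℕ) : ℤ)
  have h1 : A ∣ (a * A + b * C * y) - y := ⟨a - a * y, by linear_combination y * hab⟩
  have h2 : C ∣ (a * A + b * C * y) - 1 := ⟨b * y - b, by linear_combination hab⟩
  refine ⟨a * A + b * C * y, ?_, h1, h2⟩
  have hAC : (c : ℤ) = A * C := by
    rw [← Nat.cast_mul, Nat.ordProj_mul_ordCompl_eq_self]
  rw [hAC]
  refine IsCoprime.mul_right ?_ ?_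
  · have : IsCoprime y A := by
      simp only [A, Nat.cast_pow]
      exact hy.pow_right
    obtain ⟨k, hk⟩ := h1
    rw [sub_eq_iff_eq_add'.mp hk]
    exact this.add_mul_left_left k
  · obtain ⟨k, hk⟩ := h2
    rw [sub_eq_iff_eq_add'.mp hk]
    exact isCoprime_one_left.add_mul_left_left k

namespace IsAdmissibleAt

variable {q d : ℕ} {ε : DirichletCharacter ℂ q} {c p : ℕ}

theorem of_dvd {ψ : DirichletCharacter ℂ d} (h : IsAdmissibleAt ε c ψ p) {c' : ℕ}
    (hc' : c' ∣ c) (hp : p ∣ c') : IsAdmissibleAt ε c' ψ p := by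
  obtain ⟨⟨x, hx, hx1, hx2⟩, ⟨y, hy, hy1, hy2⟩⟩ := h
  have hcop : ∀ {x : ℤ}, IsCoprime x c → IsCoprime x c' := fun h ↦
    h.of_isCoprime_of_dvd_right (Int.natCast_dvd_natCast.mpr hc')
  refine ⟨⟨x, hcop hx, dvd_trans ?_ hx1, hx2⟩, ⟨y, hcop hy, dvd_trans ?_ hy1, hy2⟩⟩
  · exact Int.natCast_dvd_natCast.mpr (Nat.div_dvd_div hp hc')
  · exact Int.natCast_dvd_natCast.mpr (Nat.ordCompl_dvd_ordCompl_of_dvd hc' p)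

theorem mul {d₁ d₂ : ℕ} {ψ : DirichletCharacter ℂ d} {ψ₁ : DirichletCharacter ℂ d₁}
    {ψ₂ : DirichletCharacter ℂ d₂} (hψ : ∀ x : ℤ, IsCoprime x c → ψ x = ψ₁ x * ψ₂ x)
    (hp : p.Prime) (hpc : p ∣ c) (hd₂ : d₂ ∣ c) (hpd : ¬ p ∣ d₂) (h : IsAdmissibleAt ε c ψ₁ p) :
    IsAdmissibleAt ε c ψ p := by
  obtain ⟨⟨x, hx, hx1, hx2⟩, ⟨y, hy, hy1, hy2⟩⟩ := h
  have hdvd : d₂ ∣ ordCompl[p] c := Nat.Coprime.dvd_of_dvd_mul_left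
      (Nat.Coprime.pow_right _ ((hp.coprime_iff_not_dvd.mpr hpd).symm))
      (by rwa [Nat.ordProj_mul_ordCompl_eq_self])
  have key : ∀ x : ℤ, IsCoprime x c → ((ordCompl[p] c : ℕ) : ℤ) ∣ x - 1 → ψ x = ψ₁ x := by
    intro x hx hx1
    rw [hψ x hx, ψ₂.apply_eq_one_of_dvd_sub_one
      ((Int.natCast_dvd_natCast.mpr hdvd).trans hx1), mul_one]
  refine ⟨⟨x, hx, hx1, ?_⟩, ⟨y, hy, hy1, ?_⟩⟩
  · rwa [key x hx ((Int.natCast_dvd_natCast.mpr (ordCompl_dvd_div hp hpc)).trans hx1)]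
  · rwa [ψ.inv_apply_eq, key y hy hy1, ← ψ₁.inv_apply_eq]

end IsAdmissibleAt

/-- The condition `IsAdmissibleAt.primitive` for a character modulo the exact power of `p` in `c`
can be checked modulo that power. -/
theorem exists_primitive_of_local {c p k : ℕ} (hp : p.Prime) (hc : c ≠ 0)
    (hk : c.factorization p = k) (hk1 : 1 ≤ k) {φ : DirichletCharacter ℂ (p ^ k)}
    (h : ∃ y : ℤ, IsCoprime y p ∧ ((p ^ (k - 1) : ℕ) : ℤ) ∣ y - 1 ∧ φ y ≠ 1) :
    ∃ x : ℤ, IsCoprime x c ∧ ((c / p : ℕ) : ℤ) ∣ x - 1 ∧ φ x ≠ 1 := by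
  obtain ⟨y, hy, hy1, hφ⟩ := h
  obtain ⟨x, hx, hx1, hx2⟩ := exists_int_modEq_ordProj hp hc hy
  rw [hk] at hx1
  refine ⟨x, hx, ?_, ?_⟩
  · have h1 : c / p = p ^ (k - 1) * ordCompl[p] c := by
      refine Nat.div_eq_of_eq_mul_right hp.pos ?_
      rw [← mul_assoc, ← pow_succ', Nat.sub_add_cancel hk1]
      conv_lhs => rw [← Nat.ordProj_mul_ordCompl_eq_self c p]
      rw [hk]
    rw [h1, Nat.cast_mul]
    refine IsCoprime.mul_dvd ?_ ?_ hx2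
    · exact Nat.isCoprime_iff_coprime.mpr (Nat.Coprime.pow_left _ (Nat.coprime_ordCompl hp hc))
    · have h2 : ((p ^ (k - 1) : ℕ) : ℤ) ∣ x - y :=
        (Int.natCast_dvd_natCast.mpr (pow_dvd_pow p (Nat.sub_le k 1))).trans hx1
      have := dvd_add h2 hy1
      rwa [sub_add_sub_cancel] at this
  · rwa [φ.apply_eq_of_dvd_sub hx1]

/-- If `q` divides `c / p`, then `ε` is trivial on the integers `≡ 1 mod c / p`, so that a witness
of primitivity also shows that `ε` times `ψ⁻¹` is ramified. -/
theorem isAdmissibleAt_of_dvd_div {q d c p : ℕ} {ε : DirichletCharacter ℂ q}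
    {ψ : DirichletCharacter ℂ d} (hp : p.Prime) (hpc : p ∣ c) (hq : q ∣ c / p)
    (h : ∃ x : ℤ, IsCoprime x c ∧ ((c / p : ℕ) : ℤ) ∣ x - 1 ∧ ψ x ≠ 1) :
    IsAdmissibleAt ε c ψ p := by
  refine ⟨h, ?_⟩
  obtain ⟨x, hx, hx1, hx2⟩ := h
  refine ⟨x, hx, (Int.natCast_dvd_natCast.mpr (ordCompl_dvd_div hp hpc)).trans hx1, ?_⟩
  rw [ε.apply_eq_one_of_dvd_sub_one ((Int.natCast_dvd_natCast.mpr hq).trans hx1), one_mul,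
    ψ.inv_apply_eq]
  simpa using hx2

/-- Of two different primitive characters modulo the exact power of `p` in `c`, at least one is
admissible at `p`. -/
theorem isAdmissibleAt_or_isAdmissibleAt {q c p k : ℕ} (ε : DirichletCharacter ℂ q) (hp : p.Prime)
    (hc : c ≠ 0) (hk : c.factorization p = k) (hk1 : 1 ≤ k) {φ₁ φ₂ : DirichletCharacter ℂ (p ^ k)}
    (h₁ : ∃ y : ℤ, IsCoprime y p ∧ ((p ^ (k - 1) : ℕ) : ℤ) ∣ y - 1 ∧ φ₁ y ≠ 1)
    (h₂ : ∃ y : ℤ, IsCoprime y p ∧ ((p ^ (k - 1) : ℕ) : ℤ) ∣ y - 1 ∧ φ₂ y ≠ 1)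
    (hne : φ₁ ≠ φ₂) : IsAdmissibleAt ε c φ₁ p ∨ IsAdmissibleAt ε c φ₂ p := by
  by_contra! H
  apply hne
  have key : ∀ {φ : DirichletCharacter ℂ (p ^ k)}, ¬ IsAdmissibleAt ε c φ p →
      (∃ y : ℤ, IsCoprime y p ∧ ((p ^ (k - 1) : ℕ) : ℤ) ∣ y - 1 ∧ φ y ≠ 1) →
      ∀ x : ℤ, IsCoprime x c → ((ordCompl[p] c : ℕ) : ℤ) ∣ x - 1 → ε x * φ⁻¹ x = 1 := by
    intro φ hφ h x hx hx1
    by_contra hne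
    exact hφ ⟨exists_primitive_of_local hp hc hk hk1 h, ⟨x, hx, hx1, hne⟩⟩
  have hneq : NeZero (p ^ k) := ⟨pow_ne_zero _ hp.ne_zero⟩
  refine MulChar.ext fun a ↦ ?_
  obtain ⟨y, hy⟩ : ∃ y : ℤ, (y : ZMod (p ^ k)) = a := ⟨(a : ZMod (p ^ k)).val, by simp⟩
  have hyp : IsCoprime y p := by
    have h1 := (ZMod.coe_int_isUnit_iff_isCoprime y (p ^ k)).mp (by rw [hy]; exact a.isUnit)
    exact h1.symm.of_isCoprime_of_dvd_right
      (Int.natCast_dvd_natCast.mpr (dvd_pow_self p (by lia)))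
  obtain ⟨x, hx, hx1, hx2⟩ := exists_int_modEq_ordProj hp hc hyp
  rw [hk] at hx1
  have e1 := key H.1 h₁ x hx hx2
  have e2 := key H.2 h₂ x hx hx2
  rw [DirichletCharacter.inv_apply_eq] at e1 e2
  have h3 : φ₁ x ≠ 0 := fun h ↦ by simp [h] at e1
  have h4 : φ₂ x ≠ 0 := fun h ↦ by simp [h] at e2
  rw [mul_inv_eq_one₀ h3] at e1
  rw [mul_inv_eq_one₀ h4] at e2
  rw [← hy, ← φ₁.apply_eq_of_dvd_sub hx1, ← φ₂.apply_eq_of_dvd_sub hx1, ← e1, e2]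

/-- Raising the level of `ψ` by a power of a new prime `p ∣ q₂`. -/
theorem exists_dedekindTransform_ne_zero_pow_mul {q₁ q₂ c d p : ℕ} [NeZero q₁] [NeZero d]
    {χ : DirichletCharacter ℂ q₁} {ε : DirichletCharacter ℂ q₂} (hχ : χ.IsPrimitive)
    (hp : p.Prime) {ψ : DirichletCharacter ℂ d} {k : ℕ}
    (hψ : k ≠ 0 → p ∣ q₂ ∧ ¬ p ∣ q₁ ∧ ψ p ≠ χ⁻¹ p) (h : dedekindTransform χ ε c ψ ≠ 0) :
    ∃ ψ' : DirichletCharacter ℂ (p ^ k * d), dedekindTransform χ ε c ψ' ≠ 0 ∧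
      ∀ x : ℤ, IsCoprime x ((p ^ k * d : ℕ) : ℤ) → ψ' x = ψ x := by
  have : NeZero p := ⟨hp.ne_zero⟩
  rcases Nat.eq_zero_or_pos k with rfl | hk
  · rw [pow_zero, one_mul]
    exact ⟨ψ, h, fun _ _ ↦ rfl⟩
  obtain ⟨hpq₂, hpq₁, hne⟩ := hψ hk.ne'
  clear hψ
  induction k, hk using Nat.le_induction with
  | base =>
    rw [pow_one]
    refine ⟨DirichletCharacter.changeLevel (dvd_mul_left d p) ψ, ?_, fun x hx ↦ ?_⟩
    · rw [dedekindTransform_changeLevel hχ hp hpq₂]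
      exact mul_ne_zero (sub_ne_zero.mpr hne.symm) h
    · exact DirichletCharacter.changeLevel_eq_cast_of_dvd' _ _ hx
  | succ k hk ih =>
    obtain ⟨ψ', h1, h2⟩ := ih
    have hdvd : p ∣ p ^ k * d := (dvd_pow_self p (by lia)).mul_right d
    rw [pow_succ', mul_assoc]
    refine ⟨DirichletCharacter.changeLevel (dvd_mul_left (p ^ k * d) p) ψ', ?_, fun x hx ↦ ?_⟩
    · rw [dedekindTransform_changeLevel_of_dvd hχ hp hpq₂ hdvd]
      refine mul_ne_zero ?_ h1
      have := DirichletCharacter.apply_ne_zero_iff χ⁻¹ (p : ℤ)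
      rw [Int.cast_natCast] at this
      exact this.mpr (Nat.isCoprime_iff_coprime.mpr (hp.coprime_iff_not_dvd.mpr hpq₁))
    · rw [DirichletCharacter.changeLevel_eq_cast_of_dvd' _ _ hx]
      exact h2 x (hx.of_isCoprime_of_dvd_right (Int.natCast_dvd_natCast.mpr (dvd_mul_left _ _)))

/-- A character `ψ` that is admissible at all primes of its level `d` provides a nonvanishing
transform, where `c = m d`. At the primes of `m`, which divide `q₂`, the character `ψ` is unramified
and has to avoid the value of `χ⁻¹`. -/
theorem exists_dedekindTransform_ne_zero_of_isAdmissibleAt {q₁ q₂ c m d : ℕ} [NeZero q₁] [NeZero q₂]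
    [NeZero c] {χ : DirichletCharacter ℂ q₁} {ε : DirichletCharacter ℂ q₂} (hχ : χ.IsPrimitive)
    (hε : ε.IsPrimitive) (hq : q₂ ∣ c) (hc : c = m * d) (hcop : m.Coprime d)
    {a b : ℕ} (hm : m = 2 ^ b * 3 ^ a) (ψ : DirichletCharacter ℂ d)
    (hmp : ∀ p : ℕ, p.Prime → p ∣ m → p ∣ q₂ ∧ ¬ p ∣ q₁ ∧ ψ p ≠ χ⁻¹ p)
    (hψ : ∀ p : ℕ, p.Prime → p ∣ d → IsAdmissibleAt ε c ψ p)
    (hoddχ : χ (-1) * ψ (-1) = -1) (hoddε : ε (-1) * ψ (-1) = -1) :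
    ∃ ψ' : DirichletCharacter ℂ c, dedekindTransform χ ε c ψ' ≠ 0 := by
  have hc0 : c ≠ 0 := NeZero.ne c
  have hd0 : NeZero d := ⟨fun h ↦ hc0 (by rw [hc, h, mul_zero])⟩
  have hdc : d ∣ c := hc ▸ dvd_mul_left d m
  have hprim : ψ.IsPrimitive := by
    by_contra hne
    obtain ⟨k, hk⟩ := ψ.conductor_dvd_level
    have hk1 : k ≠ 1 := fun h ↦ hne (by rw [h, mul_one] at hk; exact hk.symm)
    obtain ⟨p, hp, l, rfl⟩ := Nat.exists_prime_and_dvd hk1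
    have hpd : p ∣ d := by rw [hk]; exact (dvd_mul_right p l).mul_left _
    obtain ⟨x, hx, hx1, hx2⟩ := (hψ p hp hpd).primitive
    have hdvd : ψ.conductor ∣ c / p := by
      refine Dvd.dvd.trans ?_ (Nat.div_dvd_div hpd hdc)
      refine ⟨l, Nat.div_eq_of_eq_mul_right hp.pos ?_⟩
      conv_lhs => rw [hk]
      ring
    apply hx2
    rw [← ψ.primitiveCharacter_apply_of_isCoprime
      (hx.of_isCoprime_of_dvd_right (Int.natCast_dvd_natCast.mpr hdc))]
    exact DirichletCharacter.apply_eq_one_of_dvd_sub_one _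
      ((Int.natCast_dvd_natCast.mpr hdvd).trans hx1)
  have hR : dedekindTransform χ ε c ψ ≠ 0 := by
    refine dedekindTransform_ne_zero hχ ε hprim hq hdc hoddχ hoddε (fun p hp hpc ↦ ?_)
      fun p hp hpc ↦ ?_
    · rw [hc] at hpc
      exact (hp.dvd_mul.mp hpc).imp_left fun h ↦ (hmp p hp h).1
    · by_cases hpd : p ∣ d
      · exact (hψ p hp hpd).ramified
      · have hpm : p ∣ m := by
          rw [hc] at hpc
          exact (hp.dvd_mul.mp hpc).resolve_right hpd
        obtain ⟨hpq, -, -⟩ := hmp p hp hpm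
        obtain ⟨y, hy, hy1, hy2⟩ := hε.exists_apply_ne_one (M := q₂ / p) (Nat.div_dvd_of_dvd hpq)
          (Nat.div_lt_self (NeZero.pos q₂) hp.one_lt)
        have hyp : IsCoprime y p :=
          hy.of_isCoprime_of_dvd_right (Int.natCast_dvd_natCast.mpr hpq)
        obtain ⟨x, hx, hx1, hx2⟩ := exists_int_modEq_ordProj hp hc0 hyp
        refine ⟨x, hx, hx2, ?_⟩
        have h1 : ψ⁻¹ x = 1 := by
          refine DirichletCharacter.apply_eq_one_of_dvd_sub_one _ (Dvd.dvd.trans ?_ hx2)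
          refine Int.natCast_dvd_natCast.mpr (Nat.Coprime.dvd_of_dvd_mul_left
            (Nat.Coprime.pow_right (c.factorization p) (hp.coprime_iff_not_dvd.mpr hpd).symm) ?_)
          rwa [Nat.ordProj_mul_ordCompl_eq_self]
        have h2 : ε x = ε y := by
          refine DirichletCharacter.apply_eq_of_dvd_sub _ ?_
          rw [← Nat.ordProj_mul_ordCompl_eq_self q₂ p, Nat.cast_mul]
          refine IsCoprime.mul_dvd ?_ ?_ ?_
          · exact Nat.isCoprime_iff_coprime.mpr
              (Nat.Coprime.pow_left _ (Nat.coprime_ordCompl hp (NeZero.ne q₂)))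
          · exact (Int.natCast_dvd_natCast.mpr (Nat.ordProj_dvd_ordProj_of_dvd hc0 hq p)).trans hx1
          · have h3 := (Int.natCast_dvd_natCast.mpr
              (Nat.ordCompl_dvd_ordCompl_of_dvd hq p)).trans hx2
            have h4 := (Int.natCast_dvd_natCast.mpr (ordCompl_dvd_div hp hpq)).trans hy1
            have := dvd_sub h3 h4
            rwa [sub_sub_sub_cancel_right] at this
        rwa [h1, mul_one, h2]
  -- The level is raised to `c`, at `3` before `2`; the value at `2` is not affected by the former.
  obtain ⟨ψ₃, h₃, hval⟩ := exists_dedekindTransform_ne_zero_pow_mul hχ Nat.prime_three (k := a)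
    (fun ha ↦ hmp 3 Nat.prime_three (hm ▸ (dvd_pow_self 3 ha).mul_left _)) hR
  have : NeZero (3 ^ a * d) := ⟨mul_ne_zero (by positivity) hd0.ne⟩
  obtain ⟨ψ₂, h₂, -⟩ := exists_dedekindTransform_ne_zero_pow_mul hχ Nat.prime_two (ψ := ψ₃) (k := b)
    (fun hb ↦ by
      have h2m : 2 ∣ m := hm ▸ (dvd_pow_self 2 hb).mul_right _
      obtain ⟨h4, h5, h6⟩ := hmp 2 Nat.prime_two h2m
      have h7 : Nat.Coprime 2 d := hcop.coprime_dvd_left h2m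
      have h8 : Nat.Coprime 2 (3 ^ a * d) := (Nat.Coprime.pow_right a (by norm_num)).mul_right h7
      refine ⟨h4, h5, ?_⟩
      have := hval 2 (Nat.isCoprime_iff_coprime.mpr h8)
      rw [Int.cast_ofNat, Int.cast_ofNat] at this
      rwa [Nat.cast_ofNat, this, ← Nat.cast_ofNat, ← Nat.cast_ofNat]) h₃
  have hlevel : ∀ D : ℕ, D = c → (∃ φ : DirichletCharacter ℂ D, dedekindTransform χ ε c φ ≠ 0) →
      ∃ φ : DirichletCharacter ℂ c, dedekindTransform χ ε c φ ≠ 0 := by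
    rintro _ rfl h
    exact h
  exact hlevel _ (by rw [hc, hm, mul_assoc]) ⟨ψ₂, h₂⟩

/-! ### Characters modulo prime powers -/

theorem DirichletCharacter.pow_apply_intCast {N : ℕ} (χ : DirichletCharacter ℂ N) {x : ℤ}
    (hx : IsCoprime x N) (n : ℕ) : (χ ^ n) x = χ x ^ n := by
  have h := (ZMod.coe_int_isUnit_iff_isCoprime x N).mpr hx.symm
  have := MulChar.pow_apply_coe χ n h.unit
  rwa [h.unit_spec] at this

theorem DirichletCharacter.apply_pow_intCast {N : ℕ} (χ : DirichletCharacter ℂ N) (x : ℤ) (n : ℕ) :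
    χ ((x ^ n : ℤ) : ZMod N) = χ x ^ n := by
  rw [Int.cast_pow, map_pow]

/-- Modulo a power of an odd prime there is a character that is injective on units. -/
theorem exists_faithful_character {p : ℕ} (hp : p.Prime) (hp2 : p ≠ 2) (k : ℕ) :
    ∃ ω : DirichletCharacter ℂ (p ^ k), ∀ x : ℤ, ω x = 1 → ((p ^ k : ℕ) : ℤ) ∣ x - 1 := by
  have : NeZero (p ^ k) := ⟨pow_ne_zero _ hp.ne_zero⟩
  have hcyc := ZMod.isCyclic_units_of_prime_pow p hp hp2 k
  obtain ⟨e⟩ := DirichletCharacter.mulEquiv_units ℂ (p ^ k)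
  have hcyc' : IsCyclic (DirichletCharacter ℂ (p ^ k)) :=
    isCyclic_of_surjective e.symm e.symm.surjective
  obtain ⟨ω, hω⟩ := IsCyclic.exists_monoid_generator (α := DirichletCharacter ℂ (p ^ k))
  refine ⟨ω, fun x hx ↦ ?_⟩
  by_contra hne
  have hne' : (x : ZMod (p ^ k)) ≠ 1 := by
    intro h
    apply hne
    have h1 : ((1 : ℤ) : ZMod (p ^ k)) = x := by rw [h]; simp
    exact (ZMod.intCast_eq_intCast_iff_dvd_sub _ _ _).mp h1
  obtain ⟨χ, hχ⟩ := DirichletCharacter.exists_apply_ne_one_of_hasEnoughRootsOfUnity ℂ hne'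
  obtain ⟨n, rfl⟩ := Submonoid.mem_powers_iff _ _ |>.mp (hω χ)
  have hcop : IsCoprime x ((p ^ k : ℕ) : ℤ) := by
    rw [← DirichletCharacter.apply_ne_zero_iff ω, hx]; exact one_ne_zero
  rw [DirichletCharacter.pow_apply_intCast ω hcop, hx, one_pow] at hχ
  exact hχ rfl

section faithful

variable {p k : ℕ} {ω : DirichletCharacter ℂ (p ^ k)}

theorem faithful_apply_neg_one (hp : p.Prime) (hp2 : p ≠ 2) (hk : 1 ≤ k)
    (hω : ∀ x : ℤ, ω x = 1 → ((p ^ k : ℕ) : ℤ) ∣ x - 1) : ω (-1) = -1 := by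
  have h1 : ω (-1) * ω (-1) = 1 := by rw [← map_mul]; simp
  rcases mul_self_eq_one_iff.mp h1 with h | h
  · exfalso
    have h2 := hω (-1) (by push_cast; exact h)
    have h3 : (p : ℤ) ∣ 2 := by
      have : (p : ℤ) ∣ ((p ^ k : ℕ) : ℤ) := by exact_mod_cast dvd_pow_self p (by lia)
      have := this.trans h2
      rw [show (-1 - 1 : ℤ) = -2 by norm_num, dvd_neg] at this
      exact this
    have h4 : p ∣ 2 := by exact_mod_cast h3
    exact hp2 ((Nat.prime_dvd_prime_iff_eq hp Nat.prime_two).mp h4)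
  · exact h

/-- Two powers of a faithful character agree at `x` only if `x` has small order. -/
theorem dvd_pow_sub_one_of_faithful (hω : ∀ x : ℤ, ω x = 1 → ((p ^ k : ℕ) : ℤ) ∣ x - 1)
    {x : ℤ} (hx : IsCoprime x ((p ^ k : ℕ) : ℤ)) {i j : ℕ} (hij : i ≤ j)
    (h : (ω ^ i) x = (ω ^ j) x) : ((p ^ k : ℕ) : ℤ) ∣ x ^ (j - i) - 1 := by
  rw [ω.pow_apply_intCast hx, ω.pow_apply_intCast hx] at h
  have h0 : ω x ≠ 0 := (ω.apply_ne_zero_iff x).mpr hx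
  refine hω _ ?_
  rw [ω.apply_pow_intCast]
  obtain ⟨t, rfl⟩ := Nat.exists_eq_add_of_le hij
  rw [pow_add] at h
  rw [Nat.add_sub_cancel_left]
  exact mul_left_cancel₀ (pow_ne_zero i h0) (by rw [← h, mul_one])

/-- Powers of a faithful character with exponent prime to `p` are primitive modulo `p ^ k`,
`2 ≤ k`. -/
theorem faithful_pow_primitive (hp : p.Prime) (hk : 2 ≤ k)
    (hω : ∀ x : ℤ, ω x = 1 → ((p ^ k : ℕ) : ℤ) ∣ x - 1) {e : ℕ} (he : ¬ p ∣ e) :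
    ∃ y : ℤ, IsCoprime y p ∧ ((p ^ (k - 1) : ℕ) : ℤ) ∣ y - 1 ∧ (ω ^ e) y ≠ 1 := by
  set t : ℤ := ((p ^ (k - 1) : ℕ) : ℤ) with ht
  have hpt : (p : ℤ) ∣ t := by rw [ht]; exact_mod_cast dvd_pow_self p (by lia)
  have hcop : IsCoprime (1 + t) (p : ℤ) := by
    obtain ⟨s, hs⟩ := hpt
    rw [hs]
    exact isCoprime_one_left.add_mul_left_left s
  refine ⟨1 + t, hcop, ⟨1, by ring⟩, fun h ↦ he ?_⟩
  have hcop' : IsCoprime (1 + t) ((p ^ k : ℕ) : ℤ) := by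
    rw [Nat.cast_pow]; exact hcop.pow_right
  have h1 := hω ((1 + t) ^ e) (by
    rw [ω.apply_pow_intCast, ← ω.pow_apply_intCast hcop', h])
  have hexp : ∀ e : ℕ, ∃ r : ℤ, (1 + t) ^ e = 1 + e * t + t ^ 2 * r := by
    intro e
    induction e with
    | zero => exact ⟨0, by simp⟩
    | succ e ih =>
      obtain ⟨r, hr⟩ := ih
      exact ⟨e + r * (1 + t), by rw [pow_succ, hr]; push_cast; ring⟩
  obtain ⟨r, hr⟩ := hexp e
  have hpk : ((p ^ k : ℕ) : ℤ) = t * p := by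
    rw [ht, ← Nat.cast_mul, ← pow_succ, Nat.sub_add_cancel (by lia)]
  have ht0 : t ≠ 0 := by rw [ht]; exact_mod_cast pow_ne_zero _ hp.ne_zero
  rw [hr, hpk, show 1 + e * t + t ^ 2 * r - 1 = t * (e + t * r) by ring,
    mul_dvd_mul_iff_left ht0, dvd_add_left (hpt.mul_right r)] at h1
  exact_mod_cast h1

theorem primitive_of_ne_one (hk : k = 1) {φ : DirichletCharacter ℂ (p ^ k)} (hp : p.Prime)
    (hφ : φ ≠ 1) : ∃ y : ℤ, IsCoprime y p ∧ ((p ^ (k - 1) : ℕ) : ℤ) ∣ y - 1 ∧ φ y ≠ 1 := by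
  have : NeZero (p ^ k) := ⟨pow_ne_zero _ hp.ne_zero⟩
  obtain ⟨a, ha⟩ := MulChar.ne_one_iff.mp hφ
  have h1 : (((a : ZMod (p ^ k)).val : ℤ) : ZMod (p ^ k)) = a := by simp
  refine ⟨(a : ZMod (p ^ k)).val, ?_, by simp [hk], by rwa [h1]⟩
  have h2 := (ZMod.coe_int_isUnit_iff_isCoprime _ (p ^ k)).mp (by rw [h1]; exact a.isUnit)
  exact h2.symm.of_isCoprime_of_dvd_right
    (Int.natCast_dvd_natCast.mpr (dvd_pow_self p (by lia)))

theorem faithful_pow_ne_one (hp : p.Prime) (hk : 1 ≤ k)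
    (hω : ∀ x : ℤ, ω x = 1 → ((p ^ k : ℕ) : ℤ) ∣ x - 1) {e : ℕ} (he : ¬ (p - 1) ∣ e) :
    ω ^ e ≠ 1 := by
  intro h
  have : Fact p.Prime := ⟨hp⟩
  apply he
  rw [← ZMod.card p, ← FiniteField.forall_pow_eq_one_iff (ZMod p) e]
  intro u
  obtain ⟨x, hx⟩ : ∃ x : ℤ, (x : ZMod p) = u := ⟨(u : ZMod p).val, by simp⟩
  have hcop : IsCoprime x ((p ^ k : ℕ) : ℤ) := by
    rw [Nat.cast_pow]
    refine IsCoprime.pow_right ?_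
    exact ((ZMod.coe_int_isUnit_iff_isCoprime x p).mp (by rw [hx]; exact u.isUnit)).symm
  have h1 := hω (x ^ e) (by
    rw [ω.apply_pow_intCast, ← ω.pow_apply_intCast hcop, h]
    exact MulChar.one_apply ((ZMod.coe_int_isUnit_iff_isCoprime x _).mpr hcop.symm))
  have h2 : (p : ℤ) ∣ x ^ e - 1 :=
    (Int.natCast_dvd_natCast.mpr (dvd_pow_self p (by lia))).trans h1
  rw [← Units.val_inj, Units.val_pow_eq_pow_val, Units.val_one, ← hx]
  have h3 := (ZMod.intCast_zmod_eq_zero_iff_dvd (x ^ e - 1) p).mpr h2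
  push_cast at h3
  exact sub_eq_zero.mp h3

/-- The small powers of a faithful character are primitive. -/
theorem faithful_pow_primitive_of_lt (hp : p.Prime) (hk : 1 ≤ k)
    (hω : ∀ x : ℤ, ω x = 1 → ((p ^ k : ℕ) : ℤ) ∣ x - 1) {e : ℕ} (he0 : 0 < e)
    (he : if k = 1 then e < p - 1 else e < p) :
    ∃ y : ℤ, IsCoprime y p ∧ ((p ^ (k - 1) : ℕ) : ℤ) ∣ y - 1 ∧ (ω ^ e) y ≠ 1 := by
  split_ifs at he with h1
  · exact primitive_of_ne_one h1 hp (faithful_pow_ne_one hp hk hω (Nat.not_dvd_of_pos_of_lt he0 he))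
  · exact faithful_pow_primitive hp (by lia) hω (Nat.not_dvd_of_pos_of_lt he0 he)

/-- Different small powers of a faithful character are different. -/
theorem faithful_pow_injective (hp : p.Prime) (hk : 1 ≤ k)
    (hω : ∀ x : ℤ, ω x = 1 → ((p ^ k : ℕ) : ℤ) ∣ x - 1) {i j : ℕ} (hij : i < j)
    (hj : j - i < p - 1) : ω ^ i ≠ ω ^ j := by
  intro h
  refine faithful_pow_ne_one hp hk hω (Nat.not_dvd_of_pos_of_lt (by lia : 0 < j - i) hj) ?_
  have h1 : ω ^ j = ω ^ i * ω ^ (j - i) := by rw [← pow_add]; congr 1; lia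
  rw [← h] at h1
  exact (mul_eq_left.mp h1.symm)

end faithful

/-- The odd character modulo `4`, with complex values. -/
noncomputable def chiFour : DirichletCharacter ℂ 4 := ZMod.χ₄.ringHomComp (Int.castRingHom ℂ)

/-- The even primitive character modulo `8`, with complex values. -/
noncomputable def chiEight : DirichletCharacter ℂ 8 := ZMod.χ₈.ringHomComp (Int.castRingHom ℂ)

theorem chiFour_apply (x : ZMod 4) : chiFour x = (ZMod.χ₄ x : ℂ) := rfl

theorem chiEight_apply (x : ZMod 8) : chiEight x = (ZMod.χ₈ x : ℂ) := rfl

/-- Modulo `2 ^ k` with `2 ≤ k` there is a primitive character. -/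
theorem exists_primitive_two_pow {k : ℕ} (hk : 2 ≤ k) :
    ∃ φ : DirichletCharacter ℂ (2 ^ k), φ ((1 + 2 ^ (k - 1) : ℤ) : ZMod (2 ^ k)) ≠ 1 := by
  refine DirichletCharacter.exists_apply_ne_one_of_hasEnoughRootsOfUnity ℂ fun h ↦ ?_
  have h1 : ((1 : ℤ) : ZMod (2 ^ k)) = ((1 + 2 ^ (k - 1) : ℤ) : ZMod (2 ^ k)) := by
    rw [h]; simp
  rw [ZMod.intCast_eq_intCast_iff_dvd_sub] at h1
  have h2 : 2 ^ k ∣ 2 ^ (k - 1) := by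
    have : (1 + 2 ^ (k - 1) - 1 : ℤ) = ((2 ^ (k - 1) : ℕ) : ℤ) := by push_cast; ring
    rw [this] at h1
    exact_mod_cast h1
  have := Nat.le_of_dvd (by positivity) h2
  exact absurd this (not_le.mpr (Nat.pow_lt_pow_right (by norm_num) (by lia)))

theorem isCoprime_one_add_two_pow {k : ℕ} (hk : 2 ≤ k) : IsCoprime (1 + 2 ^ (k - 1) : ℤ) 2 := by
  have : (2 : ℤ) ^ (k - 1) = 2 * 2 ^ (k - 2) := by
    rw [← pow_succ']; congr 1; lia
  rw [this]
  exact isCoprime_one_left.add_mul_left_left _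

/-- Twisting by characters of smaller level does not affect primitivity. -/
theorem mul_apply_one_add_two_pow {k m : ℕ} (hm : m < k) (hk : 2 ≤ k)
    (φ : DirichletCharacter ℂ (2 ^ k)) (θ : DirichletCharacter ℂ (2 ^ m)) :
    (φ * DirichletCharacter.changeLevel (pow_dvd_pow 2 hm.le) θ)
      ((1 + 2 ^ (k - 1) : ℤ) : ZMod (2 ^ k)) = φ ((1 + 2 ^ (k - 1) : ℤ) : ZMod (2 ^ k)) := by
  have hcop : IsCoprime (1 + 2 ^ (k - 1) : ℤ) ((2 ^ k : ℕ) : ℤ) := by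
    push_cast; exact (isCoprime_one_add_two_pow hk).pow_right
  rw [MulChar.mul_apply, DirichletCharacter.changeLevel_eq_cast_of_dvd' _ _ hcop,
    θ.apply_eq_one_of_dvd_sub_one, mul_one]
  rw [add_sub_cancel_left]
  push_cast
  exact pow_dvd_pow 2 (by lia)

/-- Existence of admissible characters modulo the exact power of `p` in `c`. The excluded moduli
`2`, `3` and `4` have too few primitive characters. -/
theorem exists_isAdmissibleAt_local {q c p k : ℕ} (ε : DirichletCharacter ℂ q) (hp : p.Prime)
    (hc : c ≠ 0) (hk : c.factorization p = k) (hk1 : 1 ≤ k) (h2 : p ^ k ≠ 2)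
    (h34 : p ^ k = 3 ∨ p ^ k = 4 → q ∣ c / p) :
    ∃ φ : DirichletCharacter ℂ (p ^ k), IsAdmissibleAt ε c φ p := by
  have hpc : p ∣ c := by
    by_contra h
    rw [Nat.factorization_eq_zero_of_not_dvd h] at hk
    lia
  by_cases hp2 : p = 2
  · subst hp2
    have hk2 : 2 ≤ k := by
      by_contra h
      have : k = 1 := by lia
      simp [this] at h2
    obtain ⟨φ, hφ⟩ := exists_primitive_two_pow hk2
    have hprim : ∀ φ : DirichletCharacter ℂ (2 ^ k),
        φ ((1 + 2 ^ (k - 1) : ℤ) : ZMod (2 ^ k)) ≠ 1 →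
        ∃ y : ℤ, IsCoprime y (2 : ℕ) ∧ ((2 ^ (k - 1) : ℕ) : ℤ) ∣ y - 1 ∧ φ y ≠ 1 := fun φ hφ ↦
      ⟨1 + 2 ^ (k - 1), isCoprime_one_add_two_pow hk2, by simp, hφ⟩
    rcases hk2.eq_or_lt with rfl | hk3
    · exact ⟨φ, isAdmissibleAt_of_dvd_div hp hpc (h34 (Or.inr (by norm_num)))
        (exists_primitive_of_local hp hc hk hk1 (hprim φ hφ))⟩
    · set θ : DirichletCharacter ℂ (2 ^ k) :=
        DirichletCharacter.changeLevel (pow_dvd_pow 2 hk2) (chiFour : DirichletCharacter ℂ (2 ^ 2))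
        with hθ
      have hne : φ ≠ φ * θ := by
        intro h
        have h1 : θ = 1 := mul_eq_left.mp h.symm
        rw [hθ, DirichletCharacter.changeLevel_eq_one_iff] at h1
        have h3 : chiFour 3 = 1 := by
          rw [show chiFour = 1 from h1]; exact MulChar.one_apply (by decide)
        rw [chiFour_apply, show ZMod.χ₄ 3 = -1 by decide] at h3
        norm_num at h3
      have hφθ : (φ * θ) ((1 + 2 ^ (k - 1) : ℤ) : ZMod (2 ^ k)) ≠ 1 := by
        rwa [mul_apply_one_add_two_pow hk3 hk2]
      rcases isAdmissibleAt_or_isAdmissibleAt ε hp hc hk hk1 (hprim φ hφ) (hprim _ hφθ) hne with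
        h | h
      exacts [⟨_, h⟩, ⟨_, h⟩]
  · obtain ⟨ω, hω⟩ := exists_faithful_character hp hp2 k
    have hp3 : 3 ≤ p := by have := hp.two_le; lia
    have h1 := faithful_pow_primitive_of_lt hp hk1 hω one_pos (by split_ifs <;> lia)
    by_cases h3 : p ^ k = 3
    · exact ⟨ω ^ 1, isAdmissibleAt_of_dvd_div hp hpc (h34 (Or.inl h3))
        (exists_primitive_of_local hp hc hk hk1 h1)⟩
    · have hp5 : k = 1 → 4 ≤ p - 1 := by
        intro hk'
        rw [hk', pow_one] at h3
        have : p ≠ 4 := by rintro rfl; revert hp; decide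
        lia
      have h2 := faithful_pow_primitive_of_lt hp hk1 hω two_pos (by
        split_ifs with h
        · have := hp5 h; lia
        · lia)
      rcases isAdmissibleAt_or_isAdmissibleAt ε hp hc hk hk1 h1 h2
        (faithful_pow_injective hp hk1 hω one_lt_two (by lia)) with h | h
      exacts [⟨_, h⟩, ⟨_, h⟩]

/-! ### Gluing characters -/

theorem mul_changeLevel_apply {d₁ d₂ : ℕ} (ψ₁ : DirichletCharacter ℂ d₁)
    (ψ₂ : DirichletCharacter ℂ d₂) {x : ℤ} (hx : IsCoprime x ((d₁ * d₂ : ℕ) : ℤ)) :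
    (DirichletCharacter.changeLevel (dvd_mul_right d₁ d₂) ψ₁ *
      DirichletCharacter.changeLevel (dvd_mul_left d₂ d₁) ψ₂) x = ψ₁ x * ψ₂ x := by
  rw [MulChar.mul_apply, DirichletCharacter.changeLevel_eq_cast_of_dvd' _ _ hx,
    DirichletCharacter.changeLevel_eq_cast_of_dvd' _ _ hx]

theorem isAdmissibleAt_mul {q c d₁ d₂ : ℕ} {ε : DirichletCharacter ℂ q} (hd : d₁ * d₂ ∣ c)
    (hcop : d₁.Coprime d₂) {ψ₁ : DirichletCharacter ℂ d₁} {ψ₂ : DirichletCharacter ℂ d₂}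
    (h₁ : ∀ p : ℕ, p.Prime → p ∣ d₁ → IsAdmissibleAt ε c ψ₁ p)
    (h₂ : ∀ p : ℕ, p.Prime → p ∣ d₂ → IsAdmissibleAt ε c ψ₂ p)
    (p : ℕ) (hp : p.Prime) (hpd : p ∣ d₁ * d₂) :
    IsAdmissibleAt ε c (DirichletCharacter.changeLevel (dvd_mul_right d₁ d₂) ψ₁ *
      DirichletCharacter.changeLevel (dvd_mul_left d₂ d₁) ψ₂) p := by
  have hcopx : ∀ x : ℤ, IsCoprime x c → IsCoprime x ((d₁ * d₂ : ℕ) : ℤ) := fun x hx ↦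
    hx.of_isCoprime_of_dvd_right (Int.natCast_dvd_natCast.mpr hd)
  have hndvd : p ∣ d₁ → p ∣ d₂ → False := fun h h' ↦
    hp.one_lt.ne' (Nat.eq_one_of_dvd_coprimes hcop h h')
  rcases hp.dvd_mul.mp hpd with h | h
  · exact (h₁ p hp h).mul (fun x hx ↦ mul_changeLevel_apply ψ₁ ψ₂ (hcopx x hx)) hp
      (hpd.trans hd) ((dvd_mul_left _ _).trans hd) (hndvd h)
  · exact (h₂ p hp h).mul
      (fun x hx ↦ by rw [mul_changeLevel_apply ψ₁ ψ₂ (hcopx x hx), mul_comm]) hp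
      (hpd.trans hd) ((dvd_mul_right _ _).trans hd) fun h' ↦ hndvd h' h

theorem isAdmissibleAt_prime_pow {q c p k : ℕ} {ε : DirichletCharacter ℂ q} (hp : p.Prime)
    {φ : DirichletCharacter ℂ (p ^ k)} (h : IsAdmissibleAt ε c φ p) (r : ℕ) (hr : r.Prime)
    (hrd : r ∣ p ^ k) : IsAdmissibleAt ε c φ r := by
  rw [(Nat.prime_dvd_prime_iff_eq hr hp).mp (hr.dvd_of_dvd_pow hrd)]
  exact h

/-- Admissible characters modulo prime powers can be glued. -/
theorem exists_isAdmissibleAt {q c : ℕ} (ε : DirichletCharacter ℂ q) (d : ℕ) (hd : d ∣ c)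
    (hd0 : d ≠ 0) (h : ∀ p k : ℕ, p.Prime → p ∣ d → d.factorization p = k →
      ∃ φ : DirichletCharacter ℂ (p ^ k), IsAdmissibleAt ε c φ p) :
    ∃ ψ : DirichletCharacter ℂ d, ∀ p : ℕ, p.Prime → p ∣ d → IsAdmissibleAt ε c ψ p := by
  induction d using Nat.recOnPosPrimePosCoprime with
  | prime_pow p n hp hn =>
    obtain ⟨φ, hφ⟩ := h p n hp (dvd_pow_self p hn.ne') (by simp [hp.factorization_pow])
    exact ⟨φ, isAdmissibleAt_prime_pow hp hφ⟩
  | zero => exact absurd rfl hd0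
  | one => exact ⟨1, fun p hp hp1 ↦ absurd (Nat.dvd_one.mp hp1) hp.one_lt.ne'⟩
  | coprime a b ha hb hab iha ihb =>
    obtain ⟨ψ₁, h₁⟩ := iha ((dvd_mul_right a b).trans hd) (by lia) fun p k hp hpa hk ↦ by
      refine h p k hp (hpa.mul_right b) ?_
      rw [Nat.factorization_eq_of_coprime_left hab (by simp [hp, hpa]; lia), hk]
    obtain ⟨ψ₂, h₂⟩ := ihb ((dvd_mul_left b a).trans hd) (by lia) fun p k hp hpb hk ↦ by
      refine h p k hp (hpb.mul_left a) ?_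
      rw [Nat.factorization_eq_of_coprime_right hab (by simp [hp, hpb]; lia), hk]
    exact ⟨_, isAdmissibleAt_mul hd hab h₁ h₂⟩

/-! ### The component at a prime dividing the conductor -/

theorem exists_dedekindTransform_ne_zero_raise {q₁ q₂ c p : ℕ} [NeZero q₁] [NeZero c]
    {χ : DirichletCharacter ℂ q₁} {ε : DirichletCharacter ℂ q₂} (hχ : χ.IsPrimitive)
    (hp : p.Prime) (hpq : p ∣ q₁) (hpq' : ¬ p ∣ q₂) (hq : q₂ ∣ c) (j : ℕ)
    (h : ∃ ψ : DirichletCharacter ℂ c, dedekindTransform χ ε c ψ ≠ 0) :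
    ∃ ψ : DirichletCharacter ℂ (p ^ j * c), dedekindTransform χ ε (p ^ j * c) ψ ≠ 0 := by
  induction j with
  | zero => rwa [pow_zero, one_mul]
  | succ j ih =>
    have : NeZero (p ^ j * c) := ⟨mul_ne_zero (pow_ne_zero _ hp.ne_zero) (NeZero.ne c)⟩
    rw [pow_succ', mul_assoc]
    by_cases hpc : p ∣ p ^ j * c
    · exact exists_dedekindTransform_ne_zero_mul_of_dvd hχ hp hpq hpq' hpc ih
    · exact exists_dedekindTransform_ne_zero_mul_of_not_dvd hχ hp (hq.mul_left _) hpc ih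

/-- The modulus `c` is split as `m p ^ k d`, where `p` divides `q₁`. The character is trivial at the
primes of `m`, it is `φ` at `p`, and `ψ` at the primes of `d`. -/
theorem exists_dedekindTransform_ne_zero_of_component {q₁ q₂ c m d p k γ a b : ℕ} [NeZero q₁]
    [NeZero q₂] [NeZero c] {χ : DirichletCharacter ℂ q₁} {ε : DirichletCharacter ℂ q₂}
    (hχ : χ.IsPrimitive) (hε : ε.IsPrimitive) (hq : q₁ * q₂ ∣ c) (hc : c = m * (p ^ k * d))
    (hp : p.Prime) (hpq : p ∣ q₁) (hmp : m.Coprime p) (hmd : m.Coprime d) (hpd : p.Coprime d)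
    (hm : m = 2 ^ b * 3 ^ a) (hγ : γ ≤ k) (hdrop : γ = k ∨ ¬ p ∣ q₂)
    (φ : DirichletCharacter ℂ (p ^ γ)) (ψ : DirichletCharacter ℂ d)
    (hφ : γ = 0 ∨ ∃ y : ℤ, IsCoprime y p ∧ ((p ^ (γ - 1) : ℕ) : ℤ) ∣ y - 1 ∧ φ y ≠ 1)
    (hψ : ∀ r : ℕ, r.Prime → r ∣ d → IsAdmissibleAt ε c ψ r)
    (hmq : ∀ r : ℕ, r.Prime → r ∣ m → r ∣ q₂ ∧ ¬ r ∣ q₁ ∧ φ r * ψ r ≠ χ⁻¹ r)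
    (hχε : χ (-1) = ε (-1)) (hodd : χ (-1) * (φ (-1) * ψ (-1)) = -1) :
    ∃ ψ' : DirichletCharacter ℂ c, dedekindTransform χ ε c ψ' ≠ 0 := by
  have hc0 : c ≠ 0 := NeZero.ne c
  set c' := m * (p ^ γ * d) with hc'
  have hcc' : c = p ^ (k - γ) * c' := by
    rw [hc, hc', ← Nat.sub_add_cancel hγ, pow_add, Nat.add_sub_cancel]; ring
  have hc'0 : c' ≠ 0 := fun h ↦ hc0 (by rw [hcc', h, mul_zero])
  have : NeZero c' := ⟨hc'0⟩
  have hq₂c : q₂ ∣ c := (dvd_mul_left q₂ q₁).trans hq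
  have hq' : q₂ ∣ c' := by
    rcases hdrop with rfl | h
    · rwa [hcc', Nat.sub_self, pow_zero, one_mul] at hq₂c
    · refine Nat.Coprime.dvd_of_dvd_mul_left
        (Nat.Coprime.pow_right (k - γ) (hp.coprime_iff_not_dvd.mpr h).symm) ?_
      rwa [← hcc']
  have hfact : c'.factorization p = γ := by
    have h0 : p ^ γ ≠ 0 := pow_ne_zero _ hp.ne_zero
    have hd0 : d ≠ 0 := fun h ↦ hc'0 (by rw [hc', h]; simp)
    have hm0 : m ≠ 0 := fun h ↦ hc'0 (by rw [hc', h]; simp)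
    rw [hc', Nat.factorization_mul hm0 (mul_ne_zero h0 hd0), Nat.factorization_mul h0 hd0,
      Finsupp.add_apply, Finsupp.add_apply, hp.factorization_pow, Finsupp.single_eq_same,
      Nat.factorization_eq_zero_of_not_dvd (hp.coprime_iff_not_dvd.mp hmp.symm),
      Nat.factorization_eq_zero_of_not_dvd (hp.coprime_iff_not_dvd.mp hpd), zero_add, add_zero]
  have hcop : (p ^ γ).Coprime d := Nat.Coprime.pow_left _ hpd
  have hφadm : ∀ r : ℕ, r.Prime → r ∣ p ^ γ → IsAdmissibleAt ε c' φ r := by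
    rcases Nat.eq_zero_or_pos γ with h0 | hγ0
    · intro r hr hrd
      rw [h0, pow_zero] at hrd
      exact absurd (Nat.dvd_one.mp hrd) hr.one_lt.ne'
    have hpc' : p ∣ c' := ((dvd_pow_self p hγ0.ne').mul_right d).mul_left m
    refine isAdmissibleAt_prime_pow hp (isAdmissibleAt_of_dvd_div hp hpc' ?_
      (exists_primitive_of_local hp hc'0 hfact hγ0 (hφ.resolve_left hγ0.ne')))
    rcases hdrop with rfl | h
    · refine Nat.dvd_div_of_mul_dvd ?_
      rw [Nat.sub_self, pow_zero, one_mul] at hcc'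
      rw [← hcc']
      exact (Nat.mul_dvd_mul_right hpq q₂).trans hq
    · refine Nat.Coprime.dvd_of_dvd_mul_left (hp.coprime_iff_not_dvd.mpr h).symm ?_
      rwa [Nat.mul_div_cancel' hpc']
  have hψadm : ∀ r : ℕ, r.Prime → r ∣ d → IsAdmissibleAt ε c' ψ r := fun r hr hrd ↦
    (hψ r hr hrd).of_dvd (hcc' ▸ dvd_mul_left c' _) ((hrd.mul_left _).mul_left _)
  have hval := fun x hx ↦ mul_changeLevel_apply φ ψ (x := x) hx
  have hval1 := hval (-1) isCoprime_one_left.neg_left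
  simp only [Int.cast_neg, Int.cast_one] at hval1
  have key : ∃ ψ' : DirichletCharacter ℂ c', dedekindTransform χ ε c' ψ' ≠ 0 := by
    refine exists_dedekindTransform_ne_zero_of_isAdmissibleAt hχ hε hq' hc'
      (Nat.Coprime.mul_right (hmp.pow_right _) hmd) hm _ (fun r hr hrm ↦ ?_)
      (isAdmissibleAt_mul (dvd_mul_left _ _) hcop hφadm hψadm) ?_ ?_
    · obtain ⟨h1, h2, h3⟩ := hmq r hr hrm
      refine ⟨h1, h2, ?_⟩
      have := hval r (Nat.isCoprime_iff_coprime.mpr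
        ((Nat.Coprime.mul_right (hmp.pow_right _) hmd).coprime_dvd_left hrm))
      simp only [Int.cast_natCast] at this
      rwa [this]
    · rw [hval1, hodd]
    · rw [hval1, ← hχε, hodd]
  rcases hdrop with rfl | h
  · rw [Nat.sub_self, pow_zero, one_mul] at hcc'
    rwa [← hcc'] at key
  · have := exists_dedekindTransform_ne_zero_raise hχ hp hpq h hq' (k - γ) key
    rwa [← hcc'] at this

/-- For all prescribed parities `s` and all values `z r`, `r ∈ X`, there is a character whose level
is a power `p ^ γ` (of level `1`, or primitive modulo `p ^ γ`) that has parity `s` and avoids the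
values `z r` on `X`. Lowering the level to `γ < k` is allowed only if `k = 1` or `p ^ k ∣ 8`. For
primitive characters of levels `q₁` and `q₂` with `p ∣ q₁`, and `p ^ k` the exact power of `p` in a
multiple of `q₁ q₂`, this excludes `p ∣ q₂`. -/
def HasAvoidingCharacter (p k : ℕ) (X : Finset ℕ) : Prop :=
  ∀ (s : ℂ) (z : ℕ → ℂ), s = 1 ∨ s = -1 → ∃ γ ≤ k, (γ = k ∨ k = 1 ∨ p ^ k ∣ 8) ∧
    ∃ φ : DirichletCharacter ℂ (p ^ γ),
      (γ = 0 ∨ ∃ y : ℤ, IsCoprime y p ∧ ((p ^ (γ - 1) : ℕ) : ℤ) ∣ y - 1 ∧ φ y ≠ 1) ∧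
      φ (-1) = s ∧ ∀ r ∈ X, φ r ≠ z r

/-- A character of prime level can be replaced by one of level `1` if it is trivial. -/
theorem exists_primitive_or_trivial {p : ℕ} (hp : p.Prime) (φ : DirichletCharacter ℂ (p ^ 1)) :
    ∃ γ ≤ 1, ∃ φ' : DirichletCharacter ℂ (p ^ γ),
      (γ = 0 ∨ ∃ y : ℤ, IsCoprime y p ∧ ((p ^ (γ - 1) : ℕ) : ℤ) ∣ y - 1 ∧ φ' y ≠ 1) ∧
      ∀ x : ℤ, IsCoprime x p → φ' x = φ x := by
  by_cases h : φ = 1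
  · refine ⟨0, zero_le_one, 1, Or.inl rfl, fun x hx ↦ ?_⟩
    rw [h, MulChar.one_apply, MulChar.one_apply]
    · exact (ZMod.coe_int_isUnit_iff_isCoprime _ _).mpr (by rw [pow_one]; exact hx.symm)
    · exact (ZMod.coe_int_isUnit_iff_isCoprime _ _).mpr (by simpa using isCoprime_one_left)
  · exact ⟨1, le_rfl, φ, Or.inr (primitive_of_ne_one rfl hp h), fun _ _ ↦ rfl⟩

/-- The candidates are the powers `ω ^ (e + 2 t)`, `t < n`, of a faithful character. Each element of
`X` excludes at most one of them, and at most one fails to be primitive if `2 ≤ k`. -/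
theorem hasAvoidingCharacter_of_card_lt {p k n : ℕ} {X : Finset ℕ} (hp : p.Prime) (hp2 : p ≠ 2)
    (hk : 1 ≤ k) (hX : ∀ r ∈ X, ¬ p ∣ r)
    (hpow : ∀ r ∈ X, ∀ t : ℕ, 0 < t → t < n → ¬ ((p ^ k : ℕ) : ℤ) ∣ (r : ℤ) ^ (2 * t) - 1)
    (hn : X.card + (if k = 1 then 0 else 1) < n) (hnp : k ≠ 1 → n ≤ p) :
    HasAvoidingCharacter p k X := by
  intro s z hs
  obtain ⟨ω, hω⟩ := exists_faithful_character hp hp2 k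
  have hneg := faithful_apply_neg_one hp hp2 hk hω
  obtain ⟨e, he⟩ : ∃ e : ℕ, (-1 : ℂ) ^ e = s := by
    rcases hs with rfl | rfl
    exacts [⟨0, by simp⟩, ⟨1, by simp⟩]
  have hcopr : ∀ r ∈ X, IsCoprime (r : ℤ) p := fun r hr ↦
    Nat.isCoprime_iff_coprime.mpr (hp.coprime_iff_not_dvd.mpr (hX r hr)).symm
  have hcop : ∀ r ∈ X, IsCoprime (r : ℤ) ((p ^ k : ℕ) : ℤ) := fun r hr ↦ by
    rw [Nat.cast_pow]; exact (hcopr r hr).pow_right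
  have hval : ∀ t, (ω ^ (e + 2 * t)) (-1) = s := by
    intro t
    have := ω.pow_apply_intCast (x := -1) isCoprime_one_left.neg_left (e + 2 * t)
    simp only [Int.cast_neg, Int.cast_one] at this
    rw [this, hneg, pow_add, he, pow_mul]
    simp
  obtain ⟨t, ht1, ht2⟩ : ∃ t, (k ≠ 1 → ¬ p ∣ e + 2 * t) ∧
      ∀ r ∈ X, (ω ^ (e + 2 * t)) ((r : ℤ) : ZMod (p ^ k)) ≠ z r := by
    by_contra! H
    set Y : Finset ℕ := if k = 1 then ∅ else {p} with hY
    have hXY : (X ∪ Y).card < (Finset.range n).card := by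
      rw [Finset.card_range]
      refine (Finset.card_union_le _ _).trans_lt (lt_of_eq_of_lt ?_ hn)
      rw [hY]
      split_ifs <;> simp
    -- The obstruction to the exponent `e + 2 t` is an element of `X`, or `p` for nonprimitivity.
    have hf : ∀ t, ∃ r ∈ X ∪ Y, (r ∈ X ∧ (ω ^ (e + 2 * t)) ((r : ℤ) : ZMod (p ^ k)) = z r) ∨
        (k ≠ 1 ∧ r = p ∧ p ∣ e + 2 * t) := by
      intro t
      by_cases h : k ≠ 1 ∧ p ∣ e + 2 * t
      · exact ⟨p, Finset.mem_union_right _ (by simp [hY, h.1]), Or.inr ⟨h.1, rfl, h.2⟩⟩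
      · obtain ⟨r, hr, hr'⟩ := H t fun h1 h2 ↦ h ⟨h1, h2⟩
        exact ⟨r, Finset.mem_union_left _ hr, Or.inl ⟨hr, hr'⟩⟩
    choose f hf1 hf2 using hf
    obtain ⟨t, ht, t', ht', hne, hff⟩ :=
      Finset.exists_ne_map_eq_of_card_lt_of_maps_to hXY (f := f) fun t _ ↦ hf1 t
    wlog hlt : t < t' generalizing t t'
    · exact this t' ht' t ht hne.symm hff.symm (lt_of_le_of_ne (not_lt.mp hlt) hne.symm)
    rw [Finset.mem_range] at ht ht'
    rcases hf2 t with ⟨hr, h1⟩ | ⟨hk1, hr, h1⟩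
    · rcases hf2 t' with ⟨-, h2⟩ | ⟨-, h2, -⟩
      · rw [← hff, ← h1] at h2
        have := dvd_pow_sub_one_of_faithful hω (hcop _ hr) (by lia) h2.symm
        rw [show e + 2 * t' - (e + 2 * t) = 2 * (t' - t) by lia] at this
        exact hpow _ hr (t' - t) (by lia) (by lia) this
      · exact hX _ hr (by rw [hff, h2])
    · rcases hf2 t' with ⟨h2, -⟩ | ⟨-, -, h2⟩
      · exact hX _ h2 (by rw [← hff, hr])
      · have h3 : p ∣ 2 * (t' - t) := by
          have := Nat.dvd_sub h2 h1
          rwa [show e + 2 * t' - (e + 2 * t) = 2 * (t' - t) by lia] at this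
        rcases hp.dvd_mul.mp h3 with h4 | h4
        · exact hp2 ((Nat.prime_dvd_prime_iff_eq hp Nat.prime_two).mp h4)
        · have := Nat.le_of_dvd (by lia) h4
          have := hnp hk1
          lia
  rcases eq_or_ne k 1 with rfl | hk1
  · obtain ⟨γ, hγ, φ, hφ, hφx⟩ := exists_primitive_or_trivial hp (ω ^ (e + 2 * t))
    refine ⟨γ, hγ, Or.inr (Or.inl rfl), φ, hφ, ?_, fun r hr ↦ ?_⟩
    · have := hφx (-1) isCoprime_one_left.neg_left
      simp only [Int.cast_neg, Int.cast_one] at this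
      rw [this, hval]
    · have := hφx r (hcopr r hr)
      rw [Int.cast_natCast] at this
      rw [this]
      simpa using ht2 r hr
  · refine ⟨k, le_rfl, Or.inl rfl, ω ^ (e + 2 * t),
      Or.inr (faithful_pow_primitive hp (by lia) hω (ht1 hk1)), hval t, fun r hr ↦ ?_⟩
    simpa using ht2 r hr

theorem hasAvoidingCharacter_of_odd {p k : ℕ} {X : Finset ℕ} (hp : p.Prime) (hp2 : p ≠ 2)
    (hk : 1 ≤ k) (hX : X ⊆ {2, 3}) (hpX : p ∉ X) (h3 : p = 3 → k = 1 → X = ∅)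
    (h5 : p = 5 → k = 1 → X ≠ {2, 3}) : HasAvoidingCharacter p k X := by
  have hX23 : ∀ r ∈ X, r = 2 ∨ r = 3 := fun r hr ↦ by simpa using hX hr
  have hdvd : ∀ r ∈ X, ¬ p ∣ r := by
    intro r hr h
    have hrp : r.Prime := by rcases hX23 r hr with rfl | rfl <;> norm_num
    rw [Nat.prime_dvd_prime_iff_eq hp hrp] at h
    exact hpX (h ▸ hr)
  have hcard : X.card ≤ 2 := (Finset.card_le_card hX).trans (by simp)
  have hpk : p ∣ p ^ k := dvd_pow_self p (by lia)
  have hp4 : p ≠ 4 := by rintro rfl; revert hp; decide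
  have hp6 : p ≠ 6 := by rintro rfl; revert hp; decide
  have hp3 : 3 ≤ p := by have := hp.two_le; lia
  rcases eq_or_ne k 1 with rfl | hk1
  · rw [pow_one] at hpk
    rcases eq_or_ne p 3 with rfl | hp3'
    · rw [h3 rfl rfl]
      exact hasAvoidingCharacter_of_card_lt (n := 1) hp hp2 le_rfl (by simp) (by simp) (by simp)
        (by simp)
    rcases eq_or_ne p 5 with rfl | hp5
    · have hc1 : X.card < 2 := by
        have := Finset.card_lt_card (lt_of_le_of_ne hX (h5 rfl rfl))
        simpa using this
      refine hasAvoidingCharacter_of_card_lt (n := 2) hp hp2 le_rfl hdvd ?_ (by simpa using hc1)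
        (by simp)
      intro r hr t ht ht'
      obtain rfl : t = 1 := by lia
      rcases hX23 r hr with rfl | rfl <;> norm_num
    · refine hasAvoidingCharacter_of_card_lt (n := 3) hp hp2 le_rfl hdvd ?_ (by simp; lia)
        (by simp)
      intro r hr t ht ht' h
      rw [pow_one] at h
      have h7 : 7 ≤ p := by lia
      have key : ∀ N : ℕ, (N = 3 ∨ N = 15 ∨ N = 8 ∨ N = 80) → ¬ (p : ℤ) ∣ (N : ℤ) := by
        intro N hN h
        have h' : p ∣ N := by exact_mod_cast h
        have h8 : p ∣ 240 := by
          rcases hN with rfl | rfl | rfl | rfl <;> exact h'.trans (by norm_num)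
        have h9 : p ∈ Nat.primeFactors 240 := Nat.mem_primeFactors.mpr ⟨hp, h8, by norm_num⟩
        have h10 : Nat.primeFactors 240 = {2, 3, 5} := by decide +kernel
        rw [h10] at h9
        simp at h9
        lia
      interval_cases t <;> rcases hX23 r hr with rfl | rfl
      · exact key 3 (by simp) (by simpa using h)
      · exact key 8 (by simp) (by simpa using h)
      · exact key 15 (by simp) (by simpa using h)
      · exact key 80 (by simp) (by simpa using h)
  · -- The numbers `2 ^ (2 t) - 1` and `3 ^ (2 t) - 1` for small `t` have no square factor `p ^ 2`.
    have hp2k : ∀ z : ℤ, ((p ^ k : ℕ) : ℤ) ∣ z → (p : ℤ) ^ 2 ∣ z := fun z hz ↦ by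
      refine Dvd.dvd.trans ?_ hz
      rw [Nat.cast_pow]
      exact pow_dvd_pow _ (by lia)
    rcases eq_or_ne p 3 with rfl | hp3'
    · have hX2 : X ⊆ {2} := fun r hr ↦ by
        rcases hX23 r hr with rfl | rfl
        · simp
        · exact absurd hr hpX
      have hc1 : X.card ≤ 1 := (Finset.card_le_card hX2).trans (by simp)
      refine hasAvoidingCharacter_of_card_lt (n := 3) hp hp2 hk hdvd ?_ (by simp [hk1]; lia)
        (by simp)
      intro r hr t ht ht' h
      have h := hp2k _ h
      obtain rfl : r = 2 := by simpa using hX2 hr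
      interval_cases t <;> revert h <;> norm_num
    · refine hasAvoidingCharacter_of_card_lt (n := 4) hp hp2 hk hdvd ?_ (by simp [hk1]; lia)
        (fun _ ↦ by lia)
      intro r hr t ht ht' h
      have h := hp2k _ h
      have h5 : 5 ≤ p := by lia
      have h0 : (p : ℤ) ^ 2 ≤ 728 := by
        refine (Int.le_of_dvd ?_ h).trans ?_
        · interval_cases t <;> rcases hX23 r hr with rfl | rfl <;> norm_num
        · interval_cases t <;> rcases hX23 r hr with rfl | rfl <;> norm_num
      have h27 : p ≤ 26 := by
        by_contra hlt
        have : (27 : ℤ) ≤ p := by exact_mod_cast (by lia : 27 ≤ p)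
        nlinarith
      clear hp2k hpk hp2 hp4 hp6 hp3 hp3' h3 h0 hdvd
      interval_cases t <;> rcases hX23 r hr with rfl | rfl <;> interval_cases p <;>
        revert h <;> norm_num

/-- A primitive character modulo `2 ^ k` is adjusted by the odd character modulo `4` for the parity,
and by the even character modulo `8`, which is `-1` at `3`, for the value at `3`. -/
theorem hasAvoidingCharacter_two_of_le {k : ℕ} {X : Finset ℕ} (hk : 4 ≤ k) (hX : X ⊆ {3}) :
    HasAvoidingCharacter 2 k X := by
  intro s z hs
  have hk2 : 2 ≤ k := by lia
  obtain ⟨φ, hφ⟩ := exists_primitive_two_pow hk2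
  set θ₄ : DirichletCharacter ℂ (2 ^ k) :=
    DirichletCharacter.changeLevel (pow_dvd_pow 2 hk2) (chiFour : DirichletCharacter ℂ (2 ^ 2))
    with hθ₄
  set θ₈ : DirichletCharacter ℂ (2 ^ k) :=
    DirichletCharacter.changeLevel (pow_dvd_pow 2 (by lia : 3 ≤ k))
      (chiEight : DirichletCharacter ℂ (2 ^ 3)) with hθ₈
  have hcop3 : IsCoprime (3 : ℤ) ((2 ^ k : ℕ) : ℤ) :=
    Nat.isCoprime_iff_coprime.mpr (Nat.Coprime.pow_right k (by norm_num : Nat.Coprime 3 2))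
  have h4 : θ₄ (-1) = -1 := by
    have := DirichletCharacter.changeLevel_eq_cast_of_dvd' (chiFour : DirichletCharacter ℂ (2 ^ 2))
      (pow_dvd_pow 2 hk2) (a := -1) isCoprime_one_left.neg_left
    simp only [Int.cast_neg, Int.cast_one] at this
    rw [hθ₄, this]
    change chiFour (-1) = -1
    rw [chiFour_apply, show ZMod.χ₄ (-1) = -1 by decide]
    simp
  have h8 : θ₈ (-1) = 1 := by
    have := DirichletCharacter.changeLevel_eq_cast_of_dvd' (chiEight : DirichletCharacter ℂ (2 ^ 3))
      (pow_dvd_pow 2 (by lia : 3 ≤ k)) (a := -1) isCoprime_one_left.neg_left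
    simp only [Int.cast_neg, Int.cast_one] at this
    rw [hθ₈, this]
    change chiEight (-1) = 1
    rw [chiEight_apply, show ZMod.χ₈ (-1) = 1 by decide]
    simp
  have h83 : θ₈ 3 = -1 := by
    have := DirichletCharacter.changeLevel_eq_cast_of_dvd' (chiEight : DirichletCharacter ℂ (2 ^ 3))
      (pow_dvd_pow 2 (by lia : 3 ≤ k)) hcop3
    rw [Int.cast_ofNat, Int.cast_ofNat] at this
    rw [hθ₈, this]
    change chiEight 3 = -1
    rw [chiEight_apply, show ZMod.χ₈ 3 = -1 by decide]
    simp
  obtain ⟨φ₁, h1, hs1⟩ : ∃ φ₁ : DirichletCharacter ℂ (2 ^ k),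
      φ₁ ((1 + 2 ^ (k - 1) : ℤ) : ZMod (2 ^ k)) ≠ 1 ∧ φ₁ (-1) = s := by
    have hsq : φ (-1) * φ (-1) = 1 := by rw [← map_mul]; simp
    by_cases h : φ (-1) = s
    · exact ⟨φ, hφ, h⟩
    · refine ⟨φ * θ₄, by rwa [mul_apply_one_add_two_pow (by lia) hk2], ?_⟩
      rw [MulChar.mul_apply, h4]
      rcases mul_self_eq_one_iff.mp hsq with h' | h' <;> rcases hs with rfl | rfl <;>
        simp [h'] at h ⊢
  obtain ⟨φ₂, h2, hs2, h3⟩ : ∃ φ₂ : DirichletCharacter ℂ (2 ^ k),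
      φ₂ ((1 + 2 ^ (k - 1) : ℤ) : ZMod (2 ^ k)) ≠ 1 ∧ φ₂ (-1) = s ∧ φ₂ 3 ≠ z 3 := by
    by_cases h : φ₁ 3 = z 3
    · refine ⟨φ₁ * θ₈, by rwa [mul_apply_one_add_two_pow (by lia) hk2], ?_, ?_⟩
      · rw [MulChar.mul_apply, h8, mul_one, hs1]
      · rw [MulChar.mul_apply, h83, ← h]
        have h0 := (φ₁.apply_ne_zero_iff 3).mpr hcop3
        rw [Int.cast_ofNat] at h0
        intro h'
        exact h0 (by linear_combination (-1 / 2) * h')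
    · exact ⟨φ₁, h1, hs1, h⟩
  refine ⟨k, le_rfl, Or.inl rfl, φ₂, Or.inr ⟨1 + 2 ^ (k - 1), ?_, by simp, h2⟩, hs2, ?_⟩
  · exact_mod_cast isCoprime_one_add_two_pow hk2
  · intro r hr
    obtain rfl : r = 3 := by simpa using hX hr
    exact h3

theorem hasAvoidingCharacter_two_two : HasAvoidingCharacter 2 2 ∅ := by
  intro s z hs
  rcases hs with rfl | rfl
  · refine ⟨0, by lia, Or.inr (Or.inr (by norm_num)), 1, Or.inl rfl, ?_, by simp⟩
    exact MulChar.one_apply isUnit_one.neg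
  · refine ⟨2, le_rfl, Or.inl rfl, chiFour, Or.inr ⟨3, by norm_num, by norm_num, ?_⟩, ?_, by simp⟩
    · change chiFour 3 ≠ 1
      rw [chiFour_apply, show ZMod.χ₄ 3 = -1 by decide]
      norm_num
    · change chiFour (-1) = -1
      rw [chiFour_apply, show ZMod.χ₄ (-1) = -1 by decide]
      simp

/-- The four characters modulo `8` realize all combinations of the signs at `-1` and `3`. -/
theorem hasAvoidingCharacter_two_three {X : Finset ℕ} (hX : X ⊆ {3}) :
    HasAvoidingCharacter 2 3 X := by
  intro s z hs
  have hX3 : ∀ r ∈ X, r = 3 := fun r hr ↦ by simpa using hX hr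
  rcases hs with rfl | rfl
  · by_cases h : z 3 = 1
    · refine ⟨3, le_rfl, Or.inl rfl, chiEight, Or.inr ⟨5, by norm_num, by norm_num, ?_⟩, ?_,
        fun r hr ↦ ?_⟩
      · change chiEight 5 ≠ 1
        rw [chiEight_apply, show ZMod.χ₈ 5 = -1 by decide]
        norm_num
      · change chiEight (-1) = 1
        rw [chiEight_apply, show ZMod.χ₈ (-1) = 1 by decide]
        simp
      · rw [hX3 r hr, h]
        change chiEight 3 ≠ 1
        rw [chiEight_apply, show ZMod.χ₈ 3 = -1 by decide]
        norm_num
    · refine ⟨0, by lia, Or.inr (Or.inr (by norm_num)), 1, Or.inl rfl,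
        MulChar.one_apply isUnit_one.neg, fun r hr ↦ ?_⟩
      rw [hX3 r hr, MulChar.one_apply (by decide)]
      exact Ne.symm h
  · by_cases h : z 3 = 1
    · refine ⟨2, by lia, Or.inr (Or.inr (by norm_num)), chiFour,
        Or.inr ⟨3, by norm_num, by norm_num, ?_⟩, ?_, fun r hr ↦ ?_⟩
      · change chiFour 3 ≠ 1
        rw [chiFour_apply, show ZMod.χ₄ 3 = -1 by decide]
        norm_num
      · change chiFour (-1) = -1
        rw [chiFour_apply, show ZMod.χ₄ (-1) = -1 by decide]
        simp
      · rw [hX3 r hr, h]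
        change chiFour 3 ≠ 1
        rw [chiFour_apply, show ZMod.χ₄ 3 = -1 by decide]
        norm_num
    · refine ⟨3, le_rfl, Or.inl rfl, ZMod.χ₈'.ringHomComp (Int.castRingHom ℂ),
        Or.inr ⟨5, by norm_num, by norm_num, ?_⟩, ?_, fun r hr ↦ ?_⟩
      · change ((ZMod.χ₈' 5 : ℤ) : ℂ) ≠ 1
        rw [show ZMod.χ₈' 5 = -1 by decide]
        norm_num
      · change ((ZMod.χ₈' (-1) : ℤ) : ℂ) = -1
        rw [show ZMod.χ₈' (-1) = -1 by decide]
        simp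
      · rw [hX3 r hr]
        change ((ZMod.χ₈' 3 : ℤ) : ℂ) ≠ _
        rw [show ZMod.χ₈' 3 = 1 by decide, Int.cast_one]
        exact Ne.symm h

/-! ### Prescribing a value of an admissible character -/

/-- An admissible character modulo a power of `p ≥ 5` can avoid a given value at `x`. The candidates
are `ω, ω ^ 2, ω ^ 3` and, in the second case, `ω ^ 4`, where `ω` is faithful. At most one of them
is not admissible; their values at `x` are distinct in the first case, and consecutive ones have
different values in the second. -/
theorem exists_isAdmissibleAt_apply_ne_local {q c p k : ℕ} (ε : DirichletCharacter ℂ q)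
    (hp : p.Prime) (hp5 : 5 ≤ p) (hc : c ≠ 0) (hk : c.factorization p = k) (hk1 : 1 ≤ k) {x : ℤ}
    (hxp : IsCoprime x p) (hx : ¬ (p : ℤ) ∣ x ^ 2 - 1 ∨ 7 ≤ p ∧ ¬ (p : ℤ) ∣ x - 1) (z : ℂ) :
    ∃ φ : DirichletCharacter ℂ (p ^ k), IsAdmissibleAt ε c φ p ∧ φ x ≠ z := by
  obtain ⟨ω, hω⟩ := exists_faithful_character hp (by lia) k
  have hx1 : ¬ (p : ℤ) ∣ x - 1 := by
    rcases hx with h | h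
    · exact fun h' ↦ h (h'.trans ⟨x + 1, by ring⟩)
    · exact h.2
  have hpk : (p : ℤ) ∣ ((p ^ k : ℕ) : ℤ) :=
    Int.natCast_dvd_natCast.mpr (dvd_pow_self p (by lia))
  have hcop : IsCoprime x ((p ^ k : ℕ) : ℤ) := by rw [Nat.cast_pow]; exact hxp.pow_right
  have hprim : ∀ e, 0 < e → e < p - 1 →
      ∃ y : ℤ, IsCoprime y p ∧ ((p ^ (k - 1) : ℕ) : ℤ) ∣ y - 1 ∧ (ω ^ e) y ≠ 1 := fun e h0 h1 ↦
    faithful_pow_primitive_of_lt hp hk1 hω h0 (by split_ifs <;> lia)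
  have hadm : ∀ i j, 0 < i → i < j → j < p - 1 →
      IsAdmissibleAt ε c (ω ^ i) p ∨ IsAdmissibleAt ε c (ω ^ j) p := fun i j hi hij hj ↦
    isAdmissibleAt_or_isAdmissibleAt ε hp hc hk hk1 (hprim i hi (by lia)) (hprim j (by lia) hj)
      (faithful_pow_injective hp hk1 hω hij (by lia))
  have hval : ∀ i, (ω ^ i) x = z → (ω ^ (i + 1)) x ≠ z := by
    intro i h h'
    have := dvd_pow_sub_one_of_faithful hω hcop (Nat.le_succ i) (h.trans h'.symm)
    rw [show i.succ - i = 1 by lia, pow_one] at this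
    exact hx1 (hpk.trans this)
  by_contra! H
  have hbad : ∀ i, IsAdmissibleAt ε c (ω ^ i) p → (ω ^ i) x = z := fun i ↦ H _
  have a12 := hadm 1 2 (by lia) (by lia) (by lia)
  have a13 := hadm 1 3 (by lia) (by lia) (by lia)
  have a23 := hadm 2 3 (by lia) (by lia) (by lia)
  have v1 := hval 1
  have v2 := hval 2
  rcases hx with hx | ⟨hp7, -⟩
  · have v13 : (ω ^ 1) x = z → (ω ^ 3) x ≠ z := by
      intro h h'
      have := dvd_pow_sub_one_of_faithful hω hcop (by lia) (h.trans h'.symm)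
      exact hx (hpk.trans this)
    rcases a12 with h1 | h2
    · rcases a23 with h2 | h3
      · exact v1 (hbad 1 h1) (hbad 2 h2)
      · exact v13 (hbad 1 h1) (hbad 3 h3)
    · rcases a13 with h1 | h3
      · exact v1 (hbad 1 h1) (hbad 2 h2)
      · exact v2 (hbad 2 h2) (hbad 3 h3)
  · have v3 := hval 3
    have a14 := hadm 1 4 (by lia) (by lia) (by lia)
    have a24 := hadm 2 4 (by lia) (by lia) (by lia)
    by_cases h1 : IsAdmissibleAt ε c (ω ^ 1) p
    · by_cases h2 : IsAdmissibleAt ε c (ω ^ 2) p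
      · exact v1 (hbad 1 h1) (hbad 2 h2)
      · exact v3 (hbad 3 (a23.resolve_left h2)) (hbad 4 (a24.resolve_left h2))
    · exact v3 (hbad 3 (a13.resolve_left h1)) (hbad 4 (a14.resolve_left h1))

/-- The same for a modulus `d` with prime factors `p ≥ 5`, except that `d = 1` has to be allowed
by `z ≠ 1`. -/
theorem exists_isAdmissibleAt_apply_ne {q c d : ℕ} (ε : DirichletCharacter ℂ q) (hc : c ≠ 0)
    (hd : d ∣ c) (hfact : ∀ p : ℕ, p.Prime → p ∣ d → d.factorization p = c.factorization p)
    {x : ℤ} (hxd : IsCoprime x d)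
    (hx : ∀ p : ℕ, p.Prime → p ∣ d → 5 ≤ p ∧
      (¬ (p : ℤ) ∣ x ^ 2 - 1 ∨ 7 ≤ p ∧ ¬ (p : ℤ) ∣ x - 1)) {z : ℂ} (hz : z ≠ 1) :
    ∃ ψ : DirichletCharacter ℂ d, (∀ p : ℕ, p.Prime → p ∣ d → IsAdmissibleAt ε c ψ p) ∧
      ψ x ≠ z := by
  have hd0 : d ≠ 0 := fun h ↦ hc (Nat.eq_zero_of_zero_dvd (h ▸ hd))
  rcases eq_or_ne d 1 with rfl | hd1
  · refine ⟨1, fun p hp hp1 ↦ absurd (Nat.dvd_one.mp hp1) hp.one_lt.ne', ?_⟩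
    rw [MulChar.one_apply ((ZMod.coe_int_isUnit_iff_isCoprime x _).mpr hxd.symm)]
    exact hz.symm
  obtain ⟨p, hp, hpd⟩ := Nat.exists_prime_and_dvd hd1
  have hk1 : 1 ≤ c.factorization p :=
    (hp.dvd_iff_one_le_factorization hc).mp (hpd.trans hd)
  set k := c.factorization p with hk
  set e := ordCompl[p] d with he
  have hde : d = p ^ k * e := by
    rw [he, hk, ← hfact p hp hpd, Nat.ordProj_mul_ordCompl_eq_self]
  have hcop : (p ^ k).Coprime e := Nat.Coprime.pow_left _ (Nat.coprime_ordCompl hp hd0)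
  have he0 : e ≠ 0 := fun h ↦ hd0 (by rw [hde, h, mul_zero])
  clear_value e
  subst hde
  obtain ⟨ψ, hψ⟩ := exists_isAdmissibleAt ε e ((dvd_mul_left _ _).trans hd) he0
    fun r j hr hre hj ↦ by
      have hrd : r ∣ p ^ k * e := hre.mul_left _
      have hrp : ¬ r ∣ p ^ k := fun h ↦ hr.one_lt.ne' (Nat.eq_one_of_dvd_coprimes hcop h hre)
      have h5 := (hx r hr hrd).1
      have hj' : c.factorization r = j := by
        rw [← hfact r hr hrd, ← hj, Nat.factorization_eq_of_coprime_right hcop]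
        exact (Nat.mem_primeFactorsList he0).mpr ⟨hr, hre⟩
      have hj1 : 1 ≤ j := by
        rw [← hj']
        exact (hr.dvd_iff_one_le_factorization hc).mp (hrd.trans hd)
      have hle : r ≤ r ^ j := Nat.le_self_pow (by lia) r
      exact exists_isAdmissibleAt_local ε hr hc hj' hj1 (by lia) (by lia)
  have hψx : ψ x ≠ 0 := (ψ.apply_ne_zero_iff x).mpr
    (hxd.of_isCoprime_of_dvd_right (Int.natCast_dvd_natCast.mpr (dvd_mul_left _ _)))
  obtain ⟨φ, hφ, hφx⟩ := exists_isAdmissibleAt_apply_ne_local ε hp (hx p hp hpd).1 hc hk.symm hk1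
    (hxd.of_isCoprime_of_dvd_right (Int.natCast_dvd_natCast.mpr hpd)) (hx p hp hpd).2 (z / ψ x)
  refine ⟨_, isAdmissibleAt_mul hd hcop (isAdmissibleAt_prime_pow hp hφ) hψ, ?_⟩
  rw [mul_changeLevel_apply φ ψ hxd]
  exact fun h ↦ hφx (by rw [← h, mul_div_cancel_right₀ _ hψx])

/-! ### The choice of the character -/

/-- There is no primitive character of level `2 M` with `M` odd, because units modulo `2 M` that are
`1` modulo `M` are `1`. -/
theorem DirichletCharacter.IsPrimitive.four_dvd {N : ℕ} [NeZero N] {χ : DirichletCharacter ℂ N}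
    (hχ : χ.IsPrimitive) (h : 2 ∣ N) : 4 ∣ N := by
  by_contra h4
  obtain ⟨M, rfl⟩ := h
  have hM0 : 0 < M := Nat.pos_of_ne_zero fun h ↦ h4 (by simp [h])
  have hM : Nat.Coprime 2 M := (Nat.prime_two.coprime_iff_not_dvd).mpr fun ⟨t, ht⟩ ↦
    h4 ⟨t, by rw [ht]; ring⟩
  obtain ⟨x, hx, hx1, hx2⟩ := hχ.exists_apply_ne_one (M := M) (dvd_mul_left _ _) (by lia)
  refine hx2 (DirichletCharacter.apply_eq_one_of_dvd_sub_one _ ?_)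
  rw [Nat.cast_mul]
  refine IsCoprime.mul_dvd (Nat.isCoprime_iff_coprime.mpr hM) ?_ hx1
  have hx3 : IsCoprime x 2 :=
    hx.of_isCoprime_of_dvd_right (Int.natCast_dvd_natCast.mpr (dvd_mul_right 2 M))
  have hodd : ¬ (2 : ℤ) ∣ x := fun h ↦ by
    have := Int.isUnit_iff.mp (hx3.isUnit_of_dvd' h dvd_rfl)
    lia
  rw [Nat.cast_ofNat]
  lia

theorem dvd_pow_factorization_of_unique_prime {q c p : ℕ} (hp : p.Prime) (hc : c ≠ 0) (hqc : q ∣ c)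
    (h : ∀ r : ℕ, r.Prime → r ∣ q → r = p) : q ∣ p ^ c.factorization p := by
  have hq0 : q ≠ 0 := fun h ↦ hc (Nat.eq_zero_of_zero_dvd (h ▸ hqc))
  have h1 := Nat.eq_prime_pow_of_unique_prime_dvd hq0 (fun {d} ↦ h d)
  rw [h1]
  refine pow_dvd_pow _ ((hp.pow_dvd_iff_le_factorization hc).mp ?_)
  rwa [← h1]

/-- Characters whose level divides `r + 1` take the same value at `r` and `-1`, so the value of `φ`
at `r` is determined by its parity. -/
theorem mul_apply_ne_inv_apply_of_dvd_add_one {q d D r : ℕ} {χ : DirichletCharacter ℂ q}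
    {φ : DirichletCharacter ℂ D} {ψ : DirichletCharacter ℂ d} (hq : q ∣ r + 1) (hD : D ∣ r + 1)
    (hodd : χ (-1) * (φ (-1) * ψ (-1)) = -1) (hψ : ψ ((-r : ℤ) : ZMod d) ≠ -1) :
    φ r * ψ r ≠ χ⁻¹ r := by
  intro h
  have hval : ∀ {N : ℕ} (η : DirichletCharacter ℂ N), N ∣ r + 1 → η r = η (-1) := by
    intro N η hN
    have := η.apply_eq_of_dvd_sub (x := r) (y := -1) (by
      rw [sub_neg_eq_add]; exact_mod_cast hN)
    simpa using this
  have hsq : ∀ {N : ℕ} (η : DirichletCharacter ℂ N), η (-1) * η (-1) = 1 := fun η ↦ by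
    rw [← map_mul]; simp
  rw [hval φ hD, hval χ⁻¹ hq, χ.inv_apply_neg_one] at h
  apply hψ
  have h1 : ψ ((-r : ℤ) : ZMod d) = ψ (-1) * ψ r := by rw [← map_mul]; simp
  rw [h1]
  linear_combination hodd + ψ (-1) * φ (-1) * h - ψ (-1) * ψ r * hsq φ

/-- At `p = 5` the values at `2` and `3` are inverse to each other and change sign together, which
makes two candidates suffice unless `ψ 6 = -1`. -/
theorem exists_avoiding_character_five {q d : ℕ} {χ : DirichletCharacter ℂ q} (hq : q ∣ 5)
    {ψ : DirichletCharacter ℂ d} (hψ : ψ 6 ≠ -1) {s : ℂ} (hs : s = 1 ∨ s = -1) :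
    ∃ γ ≤ 1, ∃ φ : DirichletCharacter ℂ (5 ^ γ),
      (γ = 0 ∨ ∃ y : ℤ, IsCoprime y (5 : ℕ) ∧ ((5 ^ (γ - 1) : ℕ) : ℤ) ∣ y - 1 ∧ φ y ≠ 1) ∧
      φ (-1) = s ∧ φ 2 * ψ 2 ≠ χ⁻¹ 2 ∧ φ 3 * ψ 3 ≠ χ⁻¹ 3 := by
  have hp : Nat.Prime 5 := by norm_num
  obtain ⟨ω, hω⟩ := exists_faithful_character hp (by norm_num) 1
  have hneg := faithful_apply_neg_one hp (by norm_num) le_rfl hω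
  obtain ⟨e, he⟩ : ∃ e : ℕ, (-1 : ℂ) ^ e = s := by
    rcases hs with rfl | rfl
    exacts [⟨0, by simp⟩, ⟨1, by simp⟩]
  have hpow : ∀ (x : ℤ), IsCoprime x (5 : ℕ) → ∀ n, (ω ^ n) x = ω x ^ n := fun x hx n ↦
    ω.pow_apply_intCast (by simpa using hx) n
  have hω2 : ω ((2 : ℤ) : ZMod (5 ^ 1)) ^ 2 = -1 := by
    rw [← ω.apply_pow_intCast, ← hneg]
    exact (ω.apply_eq_of_dvd_sub (x := 2 ^ 2) (y := -1) (by norm_num)).trans (by simp)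
  have hω3 : ω ((3 : ℤ) : ZMod (5 ^ 1)) ^ 2 = -1 := by
    rw [← ω.apply_pow_intCast, ← hneg]
    exact (ω.apply_eq_of_dvd_sub (x := 3 ^ 2) (y := -1) (by norm_num)).trans (by simp)
  have hω6 : ω ((2 : ℤ) : ZMod (5 ^ 1)) * ω ((3 : ℤ) : ZMod (5 ^ 1)) = 1 := by
    rw [← map_mul, ← Int.cast_mul]
    exact ω.apply_eq_one_of_dvd_sub_one (by norm_num)
  have hχ6 : χ⁻¹ 2 * χ⁻¹ 3 = 1 := by
    have := χ⁻¹.apply_eq_one_of_dvd_sub_one (x := 2 * 3)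
      ((Int.natCast_dvd_natCast.mpr hq).trans (by norm_num))
    rwa [Int.cast_mul, map_mul, Int.cast_ofNat, Int.cast_ofNat] at this
  have hψ6 : ψ 2 * ψ 3 = ψ 6 := by rw [← map_mul]; norm_num
  have hc2 : IsCoprime (2 : ℤ) (5 : ℕ) := by norm_num
  have hc3 : IsCoprime (3 : ℤ) (5 : ℕ) := by norm_num
  have hcm : IsCoprime (-1 : ℤ) (5 : ℕ) := isCoprime_one_left.neg_left
  obtain ⟨n, hn, h2, h3⟩ : ∃ n, (-1 : ℂ) ^ n = s ∧
      ω ((2 : ℤ) : ZMod (5 ^ 1)) ^ n * ψ 2 ≠ χ⁻¹ 2 ∧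
      ω ((3 : ℤ) : ZMod (5 ^ 1)) ^ n * ψ 3 ≠ χ⁻¹ 3 := by
    by_contra! H
    have H1 := H e he
    have H2 := H (e + 2) (by rw [pow_add, he]; simp)
    simp only [pow_add, hω2, hω3] at H2
    have hu : ω ((2 : ℤ) : ZMod (5 ^ 1)) ^ e * ω ((3 : ℤ) : ZMod (5 ^ 1)) ^ e = 1 := by
      rw [← mul_pow, hω6, one_pow]
    generalize ω ((2 : ℤ) : ZMod (5 ^ 1)) ^ e = u at *
    generalize ω ((3 : ℤ) : ZMod (5 ^ 1)) ^ e = v at *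
    by_cases h : u * ψ 2 = χ⁻¹ 2
    · by_cases h' : u * -1 * ψ 2 = χ⁻¹ 2
      · have : χ⁻¹ 2 = 0 := by linear_combination -(1 / 2) * h - (1 / 2) * h'
        rw [this, zero_mul] at hχ6
        exact zero_ne_one hχ6
      · have h3 := H2 h'
        apply hψ
        rw [← hψ6]
        linear_combination -hχ6 - (ψ 2 * ψ 3) * hu + v * ψ 3 * h - χ⁻¹ 2 * h3
    · have h3 := H1 h
      by_cases h' : u * -1 * ψ 2 = χ⁻¹ 2
      · apply hψ
        rw [← hψ6]
        linear_combination -hχ6 - (ψ 2 * ψ 3) * hu - χ⁻¹ 2 * h3 - v * ψ 3 * h'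
      · have h4 := H2 h'
        have : χ⁻¹ 3 = 0 := by linear_combination -(1 / 2) * h3 - (1 / 2) * h4
        rw [this, mul_zero] at hχ6
        exact zero_ne_one hχ6
  obtain ⟨γ, hγ, φ, hφ, hφx⟩ := exists_primitive_or_trivial hp (ω ^ n)
  refine ⟨γ, hγ, φ, hφ, ?_, ?_, ?_⟩
  · have := hφx (-1) hcm
    rw [hpow _ hcm] at this
    simp only [Int.cast_neg, Int.cast_one] at this
    rw [this, hneg, hn]
  · have := hφx 2 hc2
    rw [hpow _ hc2] at this
    rw [← this, Int.cast_ofNat] at h2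
    exact h2
  · have := hφx 3 hc3
    rw [hpow _ hc3] at this
    rw [← this, Int.cast_ofNat] at h3
    exact h3

/-- The character `ψ` exists if the exponent of `2` in `c` is not `1`. The components are chosen
with respect to the largest prime factor `p` of `q₁`. -/
theorem exists_dedekindTransform_ne_zero_of_factorization_two {q₁ q₂ c : ℕ} [NeZero q₁] [NeZero q₂]
    [NeZero c] {χ : DirichletCharacter ℂ q₁} {ε : DirichletCharacter ℂ q₂} (hχ : χ.IsPrimitive)
    (hε : ε.IsPrimitive) (hq₁ : q₁ ≠ 1) (hq : q₁ * q₂ ∣ c) (h2 : c.factorization 2 ≠ 1)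
    (hχε : χ (-1) = ε (-1)) :
    ∃ ψ : DirichletCharacter ℂ c, dedekindTransform χ ε c ψ ≠ 0 := by
  have hc0 : c ≠ 0 := NeZero.ne c
  have hq₁c : q₁ ∣ c := (dvd_mul_right _ _).trans hq
  have hq₂c : q₂ ∣ c := (dvd_mul_left _ _).trans hq
  have hle : ∀ {r n : ℕ}, r.Prime → r ^ n ∣ c → n ≤ c.factorization r := fun hr h ↦
    (hr.pow_dvd_iff_le_factorization hc0).mp h
  obtain ⟨p, hpmem, hmax⟩ := Finset.exists_max_image q₁.primeFactors id
    (Nat.nonempty_primeFactors.mpr (by have := NeZero.pos q₁; lia))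
  have hp : p.Prime := Nat.prime_of_mem_primeFactors hpmem
  have hpq : p ∣ q₁ := Nat.dvd_of_mem_primeFactors hpmem
  have hmax : ∀ r : ℕ, r.Prime → r ∣ q₁ → r ≤ p := fun r hr hrq ↦
    hmax r (Nat.mem_primeFactors.mpr ⟨hr, hrq, NeZero.ne q₁⟩)
  set k := c.factorization p with hk
  have hk1 : 1 ≤ k := hle hp (by rw [pow_one]; exact hpq.trans hq₁c)
  -- Exact powers of primes dividing both levels.
  have hboth : ∀ r : ℕ, r.Prime → r ∣ q₁ → r ∣ q₂ →
      2 ≤ c.factorization r ∧ (r = 2 → 4 ≤ c.factorization r) := by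
    intro r hr h1 h2
    refine ⟨hle hr ((pow_two r ▸ mul_dvd_mul h1 h2).trans hq), ?_⟩
    rintro rfl
    exact hle hr ((mul_dvd_mul (hχ.four_dvd h1) (hε.four_dvd h2)).trans hq)
  -- The primes at which `ψ` has to be unramified: the modulus at them is `3` or `4`, and its only
  -- primitive character may cancel the ramification of `ε`.
  set X : Finset ℕ := ({2, 3} : Finset ℕ).filter fun r ↦ r ∣ q₂ ∧ r ^ c.factorization r ≤ 4 with hX
  have hX23 : X ⊆ {2, 3} := Finset.filter_subset _ _
  have hXprime : ∀ r ∈ X, r.Prime := fun r hr ↦ by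
    have := hX23 hr
    simp only [Finset.mem_insert, Finset.mem_singleton] at this
    rcases this with rfl | rfl <;> norm_num
  have hXq₂ : ∀ r ∈ X, r ∣ q₂ := fun r hr ↦ (Finset.mem_filter.mp hr).2.1
  have hXpow : ∀ r ∈ X, r ^ c.factorization r ≤ 4 := fun r hr ↦ (Finset.mem_filter.mp hr).2.2
  have hX2 : 2 ∈ X → c.factorization 2 = 2 := fun h ↦ by
    have h1 : 1 ≤ c.factorization 2 :=
      hle Nat.prime_two (by rw [pow_one]; exact (hXq₂ 2 h).trans hq₂c)
    have h3 := hXpow 2 h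
    by_contra hne
    have : 2 ^ 3 ≤ 2 ^ c.factorization 2 := Nat.pow_le_pow_right (by norm_num) (by lia)
    lia
  have hX3 : 3 ∈ X → c.factorization 3 = 1 := fun h ↦ by
    have h1 : 1 ≤ c.factorization 3 :=
      hle Nat.prime_three (by rw [pow_one]; exact (hXq₂ 3 h).trans hq₂c)
    have h3 := hXpow 3 h
    by_contra hne
    have : 3 ^ 2 ≤ 3 ^ c.factorization 3 := Nat.pow_le_pow_right (by norm_num) (by lia)
    lia
  have hXq₁ : ∀ r ∈ X, ¬ r ∣ q₁ := by
    intro r hr h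
    have h1 := hboth r (hXprime r hr) h (hXq₂ r hr)
    have h3 := hX23 hr
    simp only [Finset.mem_insert, Finset.mem_singleton] at h3
    rcases h3 with rfl | rfl
    · have := hX2 hr; lia
    · have := hX3 hr; lia
  have hpX : p ∉ X := fun h ↦ hXq₁ p h hpq
  -- The part of `c` at the primes of `X`.
  set b := if 2 ∈ X then 2 else 0 with hb
  set a := if 3 ∈ X then 1 else 0 with ha
  set m := 2 ^ b * 3 ^ a with hm
  have hmX : ∀ r : ℕ, r.Prime → r ∣ m → r ∈ X := by
    intro r hr hrm
    rcases hr.dvd_mul.mp hrm with h | h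
    · obtain rfl := (Nat.prime_dvd_prime_iff_eq hr Nat.prime_two).mp (hr.dvd_of_dvd_pow h)
      by_contra h0
      rw [hb, if_neg h0] at h
      simp at h
    · obtain rfl := (Nat.prime_dvd_prime_iff_eq hr Nat.prime_three).mp (hr.dvd_of_dvd_pow h)
      by_contra h0
      rw [ha, if_neg h0] at h
      simp at h
  have hXm : ∀ r ∈ X, r ^ c.factorization r ∣ m := by
    intro r hr
    have h3 := hX23 hr
    simp only [Finset.mem_insert, Finset.mem_singleton] at h3
    rcases h3 with rfl | rfl
    · rw [hX2 hr, hm, hb, if_pos hr]; exact dvd_mul_right _ _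
    · rw [hX3 hr, hm, ha, if_pos hr]; exact dvd_mul_left _ _
  have hmc : m ∣ c := by
    refine Nat.Coprime.mul_dvd_of_dvd_of_dvd (Nat.Coprime.pow _ _ (by norm_num)) ?_ ?_
    · rw [hb]
      split_ifs with h
      · have := Nat.ordProj_dvd c 2
        rwa [hX2 h] at this
      · simp
    · rw [ha]
      split_ifs with h
      · have := Nat.ordProj_dvd c 3
        rwa [hX3 h] at this
      · simp
  have hmp : m.Coprime p := (hp.coprime_iff_not_dvd.mpr fun h ↦ hpX (hmX p hp h)).symm
  obtain ⟨d, hd⟩ : m * p ^ k ∣ c :=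
    Nat.Coprime.mul_dvd_of_dvd_of_dvd (hmp.pow_right k) hmc (Nat.ordProj_dvd c p)
  have hnd : ∀ r : ℕ, r.Prime → r ^ c.factorization r ∣ m * p ^ k → ¬ r ∣ d := by
    intro r hr h1 h2
    refine Nat.pow_succ_factorization_not_dvd hc0 hr ?_
    rw [pow_succ]
    conv_rhs => rw [hd]
    exact mul_dvd_mul h1 h2
  have hXd : ∀ r ∈ X, ¬ r ∣ d := fun r hr ↦ hnd r (hXprime r hr) ((hXm r hr).mul_right _)
  have hpd : ¬ p ∣ d := hnd p hp (dvd_mul_left _ _)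
  have hmd : m.Coprime d := Nat.coprime_of_dvd fun r hr h ↦ hXd r (hmX r hr h)
  have hpd' : p.Coprime d := hp.coprime_iff_not_dvd.mpr hpd
  have hdc : d ∣ c := hd ▸ dvd_mul_left _ _
  have hd0 : d ≠ 0 := fun h ↦ hc0 (Nat.eq_zero_of_zero_dvd (h ▸ hdc))
  have hfact : ∀ r : ℕ, r.Prime → r ∣ d → d.factorization r = c.factorization r := by
    intro r hr hrd
    conv_rhs => rw [hd]
    exact (Nat.factorization_eq_of_coprime_right (hmd.mul_left (hpd'.pow_left k))
      ((Nat.mem_primeFactorsList hd0).mpr ⟨hr, hrd⟩)).symm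
  have hunit : ∀ r ∈ X, ∀ ψ : DirichletCharacter ℂ d, ψ r ≠ 0 := fun r hr ψ ↦ by
    have := ψ.apply_ne_zero_iff (r : ℤ)
    rw [Int.cast_natCast] at this
    exact this.mpr (Nat.isCoprime_iff_coprime.mpr
      ((hXprime r hr).coprime_iff_not_dvd.mpr (hXd r hr)))
  -- Given the components, the transform does not vanish. If the level at `p` is lowered, then `p`
  -- does not divide `q₂`, as otherwise the exponent `k` of `p` in `c` would be too large.
  have reduce : ∀ ψ : DirichletCharacter ℂ d,
      (∀ r : ℕ, r.Prime → r ∣ d → IsAdmissibleAt ε c ψ r) →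
      ∀ γ ≤ k, (γ = k ∨ k = 1 ∨ p ^ k ∣ 8) → ∀ φ : DirichletCharacter ℂ (p ^ γ),
      (γ = 0 ∨ ∃ y : ℤ, IsCoprime y p ∧ ((p ^ (γ - 1) : ℕ) : ℤ) ∣ y - 1 ∧ φ y ≠ 1) →
      χ (-1) * (φ (-1) * ψ (-1)) = -1 → (∀ r ∈ X, φ r * ψ r ≠ χ⁻¹ r) →
      ∃ ψ : DirichletCharacter ℂ c, dedekindTransform χ ε c ψ ≠ 0 := by
    intro ψ hψ γ hγ hdrop φ hφ hodd hval
    refine exists_dedekindTransform_ne_zero_of_component hχ hε hq (by rw [← mul_assoc]; exact hd)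
      hp hpq hmp hmd hpd' hm hγ ?_ φ ψ hφ hψ
      (fun r hr hrm ↦ ⟨hXq₂ r (hmX r hr hrm), hXq₁ r (hmX r hr hrm), hval r (hmX r hr hrm)⟩)
      hχε hodd
    refine hdrop.imp_right fun h hpq₂ ↦ ?_
    obtain ⟨hb2, hb4⟩ := hboth p hp hpq hpq₂
    rcases h with h | h
    · lia
    · have hp2 : p = 2 := (Nat.prime_dvd_prime_iff_eq hp Nat.prime_two).mp
        (hp.dvd_of_dvd_pow (n := 3) (((dvd_pow_self p (by lia)).trans h).trans (by norm_num)))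
      have h4 := hb4 hp2
      rw [hp2] at h
      have := Nat.le_of_dvd (by norm_num) h
      have : 2 ^ 4 ≤ 2 ^ k := Nat.pow_le_pow_right (by norm_num) h4
      lia
  have hsq : ∀ {N : ℕ} (η : DirichletCharacter ℂ N), η (-1) * η (-1) = 1 := fun η ↦ by
    rw [← map_mul]; simp
  have hsign : ∀ ψ : DirichletCharacter ℂ d,
      -(χ (-1) * ψ (-1)) = 1 ∨ -(χ (-1) * ψ (-1)) = -1 := fun ψ ↦ by
    refine mul_self_eq_one_iff.mp ?_
    linear_combination ψ (-1) * ψ (-1) * hsq χ + hsq ψ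
  have hodd : ∀ (ψ : DirichletCharacter ℂ d) (s : ℂ), s = -(χ (-1) * ψ (-1)) →
      χ (-1) * (s * ψ (-1)) = -1 := fun ψ s hs ↦ by
    rw [hs]
    linear_combination -(ψ (-1) * ψ (-1)) * hsq χ - hsq ψ
  have generic : HasAvoidingCharacter p k X →
      ∃ ψ : DirichletCharacter ℂ c, dedekindTransform χ ε c ψ ≠ 0 := by
    intro H
    obtain ⟨ψ, hψ⟩ := exists_isAdmissibleAt ε d hdc hd0 fun r j hr hrd hj ↦ by
      have hj' : c.factorization r = j := by rw [← hfact r hr hrd, hj]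
      have hrc := hrd.trans hdc
      have hj1 : 1 ≤ j := by
        rw [← hj']
        exact (hr.dvd_iff_one_le_factorization hc0).mp hrc
      have hrj : r ∣ r ^ j := dvd_pow_self r (by lia)
      refine exists_isAdmissibleAt_local ε hr hc0 hj' hj1 (fun h ↦ ?_) fun h ↦ ?_
      · rw [h] at hrj
        obtain rfl := (Nat.prime_dvd_prime_iff_eq hr Nat.prime_two).mp hrj
        have : j = 1 := Nat.pow_right_injective le_rfl (by simpa using h)
        lia
      · have hr23 : r = 2 ∨ r = 3 := by
          rcases h with h | h
          · rw [h] at hrj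
            exact Or.inr ((Nat.prime_dvd_prime_iff_eq hr Nat.prime_three).mp hrj)
          · rw [h] at hrj
            exact Or.inl ((Nat.prime_dvd_prime_iff_eq hr Nat.prime_two).mp
              (hr.dvd_of_dvd_pow (n := 2) (by simpa using hrj)))
        have hrq₂ : ¬ r ∣ q₂ := fun hrq₂ ↦ hXd r
          (Finset.mem_filter.mpr ⟨by simpa using hr23, hrq₂, by rw [hj']; lia⟩) hrd
        refine Nat.Coprime.dvd_of_dvd_mul_left (hr.coprime_iff_not_dvd.mpr hrq₂).symm ?_
        rwa [Nat.mul_div_cancel' hrc]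
    obtain ⟨γ, hγ, hdrop, φ, hφ, hφs, hφX⟩ :=
      H (-(χ (-1) * ψ (-1))) (fun r ↦ χ⁻¹ r / ψ r) (hsign ψ)
    exact reduce ψ hψ γ hγ hdrop φ hφ (hodd ψ _ hφs) fun r hr h ↦
      hφX r hr (by rw [← h, mul_div_cancel_right₀ _ (hunit r hr ψ)])
  have hge : 2 ∈ X ∨ p = 2 → 3 ∈ X ∨ p = 3 → ∀ r : ℕ, r.Prime → r ∣ d → 5 ≤ r := by
    intro h2 h3 r hr hrd
    have hr2 : r ≠ 2 := by
      rintro rfl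
      exact h2.elim (fun h ↦ hXd 2 h hrd) fun h ↦ hpd (h ▸ hrd)
    have hr3 : r ≠ 3 := by
      rintro rfl
      exact h3.elim (fun h ↦ hXd 3 h hrd) fun h ↦ hpd (h ▸ hrd)
    have hr4 : r ≠ 4 := by rintro rfl; revert hr; decide
    have := hr.two_le
    lia
  -- If the exact power of `p` in `c` is `r + 1`, with `{p, r} = {2, 3}`, then the value at `r` of
  -- the component at `p` is fixed by its parity, and the condition at `r` is put on the other
  -- components.
  have special : ∀ r : ℕ, (r = 2 ∧ p = 3 ∨ r = 3 ∧ p = 2) → p ^ k = r + 1 → X = {r} →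
      HasAvoidingCharacter p k ∅ →
      ∃ ψ : DirichletCharacter ℂ c, dedekindTransform χ ε c ψ ≠ 0 := by
    intro r hr hpk hXr H
    have hrX : r ∈ X := by simp [hXr]
    have hrd : IsCoprime (-r : ℤ) d := (Nat.isCoprime_iff_coprime.mpr
      ((hXprime r hrX).coprime_iff_not_dvd.mpr (hXd r hrX))).neg_left
    obtain ⟨ψ, hψ, hψr⟩ := exists_isAdmissibleAt_apply_ne ε hc0 hdc hfact hrd (z := -1)
      (fun t ht htd ↦ by
        have h5 := hge (by rcases hr with ⟨rfl, h⟩ | ⟨rfl, h⟩ <;> simp [hrX, h])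
          (by rcases hr with ⟨rfl, h⟩ | ⟨rfl, h⟩ <;> simp [hrX, h]) t ht htd
        refine ⟨h5, Or.inl fun h ↦ ?_⟩
        rcases hr with ⟨rfl, -⟩ | ⟨rfl, -⟩
        · have h3 : t ∣ 3 := by
            rw [show (-(2 : ℕ) : ℤ) ^ 2 - 1 = (3 : ℕ) by norm_num] at h
            exact_mod_cast h
          have := Nat.le_of_dvd (by norm_num) h3
          lia
        · have h3 : t ∣ 2 ^ 3 := by
            rw [show (-(3 : ℕ) : ℤ) ^ 2 - 1 = (2 ^ 3 : ℕ) by norm_num] at h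
            exact_mod_cast h
          have := Nat.le_of_dvd (by norm_num) (ht.dvd_of_dvd_pow h3)
          lia) (by norm_num)
    obtain ⟨γ, hγ, hdrop, φ, hφ, hφs, -⟩ := H (-(χ (-1) * ψ (-1))) (fun _ ↦ 0) (hsign ψ)
    have hq₁k : q₁ ∣ r + 1 := by
      rw [← hpk]
      refine dvd_pow_factorization_of_unique_prime hp hc0 hq₁c fun t ht htq ↦ ?_
      have h1 := hmax t ht htq
      have h2 := ht.two_le
      have h3 : t ≠ r := fun h ↦ hXq₁ r hrX (h ▸ htq)
      lia
    refine reduce ψ hψ γ hγ hdrop φ hφ (hodd ψ _ hφs) fun r' hr' ↦ ?_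
    obtain rfl : r' = r := by simpa [hXr] using hr'
    exact mul_apply_ne_inv_apply_of_dvd_add_one hq₁k (hpk ▸ pow_dvd_pow p hγ)
      (hodd ψ _ hφs) hψr
  have hsub : ∀ r t : ℕ, ({r, t} : Finset ℕ) = {2, 3} → r = p → X ⊆ {t} := by
    intro r t hrt hrp u hu
    have h1 := hX23 hu
    rw [← hrt, Finset.mem_insert] at h1
    rcases h1 with h1 | h1
    · exact absurd (h1.trans hrp ▸ hu) hpX
    · exact h1
  by_cases hp2 : p = 2
  · have hXs := hsub 2 3 rfl hp2.symm
    have hk2 : 2 ≤ k := by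
      have : k ≠ 1 := by rw [hk, hp2]; exact h2
      lia
    rcases Finset.subset_singleton_iff.mp hXs with h0 | h0
    · refine generic ?_
      rw [hp2]
      rcases hk2.eq_or_lt with h | h
      · rw [← h, h0]; exact hasAvoidingCharacter_two_two
      · rcases (Nat.succ_le_of_lt h).eq_or_lt with h | h
        · rw [← h]; exact hasAvoidingCharacter_two_three hXs
        · exact hasAvoidingCharacter_two_of_le h hXs
    · rcases hk2.eq_or_lt with h | h
      · refine special 3 (Or.inr ⟨rfl, hp2⟩) (by rw [hp2, ← h]; norm_num) h0 ?_
        rw [hp2, ← h]; exact hasAvoidingCharacter_two_two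
      · refine generic ?_
        rw [hp2]
        rcases (Nat.succ_le_of_lt h).eq_or_lt with h | h
        · rw [← h]; exact hasAvoidingCharacter_two_three hXs
        · exact hasAvoidingCharacter_two_of_le h hXs
  by_cases h3 : p = 3 ∧ k = 1 ∧ X ≠ ∅
  · obtain ⟨hp3, hk1', hne⟩ := h3
    have hXs := (Finset.subset_singleton_iff.mp
      (hsub 3 2 (by decide) hp3.symm)).resolve_left hne
    exact special 2 (Or.inl ⟨rfl, hp3⟩) (by rw [hp3, hk1']; norm_num) hXs
      (hasAvoidingCharacter_of_odd hp hp2 hk1 (by simp) (by simp) (fun _ _ ↦ rfl)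
        fun _ _ ↦ by decide)
  by_cases h5 : p = 5 ∧ k = 1 ∧ X = {2, 3}
  · obtain ⟨hp5, hk1', hX5⟩ := h5
    have h2X : 2 ∈ X := by simp [hX5]
    have h3X : 3 ∈ X := by simp [hX5]
    have hd6 : IsCoprime (6 : ℤ) d := by
      have : Nat.Coprime (2 * 3) d :=
        (Nat.prime_two.coprime_iff_not_dvd.mpr (hXd 2 h2X)).mul_left
          (Nat.prime_three.coprime_iff_not_dvd.mpr (hXd 3 h3X))
      exact_mod_cast Nat.isCoprime_iff_coprime.mpr this
    obtain ⟨ψ, hψ, hψ6⟩ := exists_isAdmissibleAt_apply_ne ε hc0 hdc hfact hd6 (z := -1)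
      (fun t ht htd ↦ by
        have h5 := hge (Or.inl h2X) (Or.inl h3X) t ht htd
        have ht5 : t ≠ 5 := fun h ↦ hpd (hp5 ▸ h ▸ htd)
        have ht6 : t ≠ 6 := by rintro rfl; revert ht; decide
        refine ⟨h5, Or.inr ⟨by lia, fun h ↦ ?_⟩⟩
        have h6 : t ∣ 5 := by norm_num at h; exact_mod_cast h
        have := Nat.le_of_dvd (by norm_num) h6
        lia) (by norm_num)
    rw [Int.cast_ofNat] at hψ6
    have hq₁5 : q₁ ∣ 5 := by
      have := dvd_pow_factorization_of_unique_prime hp hc0 hq₁c fun t ht htq ↦ by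
        have h1 := hmax t ht htq
        have h2 := ht.two_le
        have h3 : t ≠ 2 := fun h ↦ hXq₁ 2 h2X (h ▸ htq)
        have h4 : t ≠ 3 := fun h ↦ hXq₁ 3 h3X (h ▸ htq)
        have h5 : t ≠ 4 := by rintro rfl; revert ht; decide
        lia
      rwa [← hk, hk1', hp5, pow_one] at this
    subst hp5
    obtain ⟨γ, hγ, φ, hφ, hφs, hφ2, hφ3⟩ :=
      exists_avoiding_character_five (χ := χ) hq₁5 hψ6 (hsign ψ)
    refine reduce ψ hψ γ (by lia) (Or.inr (Or.inl hk1')) φ hφ (hodd ψ _ hφs) fun r hr ↦ ?_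
    rw [hX5] at hr
    simp only [Finset.mem_insert, Finset.mem_singleton] at hr
    rcases hr with rfl | rfl
    · exact_mod_cast hφ2
    · exact_mod_cast hφ3
  · refine generic (hasAvoidingCharacter_of_odd hp hp2 hk1 hX23 hpX (fun h h' ↦ ?_)
      fun h h' h'' ↦ h5 ⟨h, h', h''⟩)
    by_contra hne
    exact h3 ⟨h, h', hne⟩

/-- If `2` divides `c` exactly, then it is a new prime for `c / 2`, because no primitive character
has level exactly divisible by `2`. -/
theorem exists_dedekindTransform_ne_zero {q₁ q₂ c : ℕ} [NeZero q₁] [NeZero q₂] [NeZero c]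
    {χ : DirichletCharacter ℂ q₁} {ε : DirichletCharacter ℂ q₂} (hχ : χ.IsPrimitive)
    (hε : ε.IsPrimitive) (hq₁ : q₁ ≠ 1) (hq : q₁ * q₂ ∣ c) (hχε : χ (-1) = ε (-1)) :
    ∃ ψ : DirichletCharacter ℂ c, dedekindTransform χ ε c ψ ≠ 0 := by
  by_cases h2 : c.factorization 2 = 1
  · have hc0 : c ≠ 0 := NeZero.ne c
    have h4 : ¬ 4 ∣ c := fun h ↦ by
      have := (Nat.prime_two.pow_dvd_iff_le_factorization hc0 (k := 2)).mp h
      lia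
    have h2c : 2 ∣ c := (Nat.prime_two.dvd_iff_one_le_factorization hc0).mpr h2.ge
    obtain ⟨u, rfl⟩ := h2c
    have hu : ¬ 2 ∣ u := fun ⟨t, ht⟩ ↦ h4 ⟨t, by rw [ht]; ring⟩
    have : NeZero u := ⟨fun h ↦ hu (h ▸ dvd_zero 2)⟩
    have hq' : Nat.Coprime (q₁ * q₂) 2 := by
      refine (Nat.prime_two.coprime_iff_not_dvd.mpr fun h ↦ h4 ?_).symm
      rcases Nat.prime_two.dvd_mul.mp h with h | h
      · exact ((hχ.four_dvd h).mul_right q₂).trans hq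
      · exact ((hε.four_dvd h).mul_left q₁).trans hq
    have hqu : q₁ * q₂ ∣ u := hq'.dvd_of_dvd_mul_left hq
    refine exists_dedekindTransform_ne_zero_mul_of_not_dvd hχ Nat.prime_two
      ((dvd_mul_left _ _).trans hqu) hu ?_
    refine exists_dedekindTransform_ne_zero_of_factorization_two hχ hε hq₁ hqu ?_ hχε
    rw [Nat.factorization_eq_zero_of_not_dvd hu]
    exact zero_ne_one
  · exact exists_dedekindTransform_ne_zero_of_factorization_two hχ hε hq₁ hq h2 hχε

/-! ### Nonvanishing of the Dedekind sum -/

theorem conj_apply_eq_inv_apply {N : ℕ} [NeZero N] (χ : DirichletCharacter ℂ N) (a : ZMod N) :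
    (starRingEnd ℂ) (χ a) = χ⁻¹ a := MulChar.star_apply' χ a

theorem dedekindTransform_inv_eq_sum {q₁ q₂ c : ℕ} [NeZero q₁] [NeZero q₂]
    (χ₁ : DirichletCharacter ℂ q₁) (χ₂ : DirichletCharacter ℂ q₂) (ψ : DirichletCharacter ℂ c) :
    dedekindTransform χ₁⁻¹ χ₂⁻¹ c ψ = ∑ a ∈ Finset.range c, ψ a * dedekindSum χ₁ χ₂ a c := by
  simp only [dedekindTransform, dedekindSum, twistedB1Sum, twistedB1, Finset.mul_sum,
    conj_apply_eq_inv_apply]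
  rw [Finset.sum_comm]
  refine Finset.sum_congr rfl fun a _ ↦ Finset.sum_congr rfl fun j _ ↦
    Finset.sum_congr rfl fun n _ ↦ ?_
  push_cast
  ring

theorem DirichletCharacter.IsPrimitive.inv {N : ℕ} {χ : DirichletCharacter ℂ N}
    (hχ : χ.IsPrimitive) : χ⁻¹.IsPrimitive := by
  rw [DirichletCharacter.isPrimitive_def] at hχ ⊢
  rw [DirichletCharacter.conductor_inv, hχ]

theorem exists_dedekindSum_ne_zero {q₁ q₂ : ℕ} [NeZero q₁] [NeZero q₂]
    {χ₁ : DirichletCharacter ℂ q₁} {χ₂ : DirichletCharacter ℂ q₂}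
    (hprim₁ : χ₁.IsPrimitive) (hprim₂ : χ₂.IsPrimitive) (hχ₁ : χ₁ ≠ 1)
    (hparity : χ₁ (-1) * χ₂ (-1) = 1) {c : ℕ} (hc : 0 < c) (hq : q₁ * q₂ ∣ c) :
    ∃ a : ℤ, IsCoprime a (c : ℤ) ∧ dedekindSum χ₁ χ₂ a c ≠ 0 := by
  have : NeZero c := ⟨hc.ne'⟩
  have hq₁ : q₁ ≠ 1 := by
    rintro rfl
    exact hχ₁ (DirichletCharacter.level_one χ₁)
  have hsq : χ₂ (-1) * χ₂ (-1) = 1 := by rw [← map_mul]; simp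
  obtain ⟨ψ, hψ⟩ := exists_dedekindTransform_ne_zero hprim₁.inv hprim₂.inv hq₁ hq (by
    rw [DirichletCharacter.inv_apply_neg_one, DirichletCharacter.inv_apply_neg_one]
    linear_combination χ₂ (-1) * hparity - χ₁ (-1) * hsq)
  rw [dedekindTransform_inv_eq_sum] at hψ
  obtain ⟨a, -, ha⟩ := Finset.exists_ne_zero_of_sum_ne_zero hψ
  refine ⟨a, (ψ.apply_ne_zero_iff a).mp ?_, right_ne_zero_of_mul ha⟩
  rw [Int.cast_natCast]
  exact left_ne_zero_of_mul ha

theorem mainTheorem3 {q₁ q₂ : ℕ} [NeZero q₁] [NeZero q₂]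
    (χ₁ : DirichletCharacter ℂ q₁) (χ₂ : DirichletCharacter ℂ q₂)
    (hprim₁ : χ₁.IsPrimitive) (hprim₂ : χ₂.IsPrimitive)
    (hχ₁ : χ₁ ≠ 1) (hχ₂ : χ₂ ≠ 1)
    (hparity : χ₁ (-1) * χ₂ (-1) = 1) :
    (∀ c : ℕ, 0 < c → q₁ * q₂ ∣ c →
      ∃ a : ℤ, IsCoprime a (c : ℤ) ∧ dedekindSum χ₁ χ₂ a c ≠ 0) ∧
    (∃ γ : CongruenceSubgroup.Gamma0 (q₁ * q₂), dedekindSumGamma0 χ₁ χ₂ γ ≠ 0) := by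
  have h1 : ∀ c : ℕ, 0 < c → q₁ * q₂ ∣ c →
      ∃ a : ℤ, IsCoprime a (c : ℤ) ∧ dedekindSum χ₁ χ₂ a c ≠ 0 := fun c hc hq ↦
    exists_dedekindSum_ne_zero hprim₁ hprim₂ hχ₁ hparity hc hq
  refine ⟨h1, ?_⟩
  have hc : 0 < q₁ * q₂ := Nat.mul_pos (NeZero.pos q₁) (NeZero.pos q₂)
  obtain ⟨a, ⟨u, v, huv⟩, hne⟩ := h1 (q₁ * q₂) hc dvd_rfl
  let g : SL(2, ℤ) := ⟨!![a, -v; ((q₁ * q₂ : ℕ) : ℤ), u], by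
    rw [Matrix.det_fin_two_of]; linear_combination huv⟩
  have hg : g ∈ CongruenceSubgroup.Gamma0 (q₁ * q₂) := by
    rw [CongruenceSubgroup.Gamma0_mem]
    change (((q₁ * q₂ : ℕ) : ℤ) : ZMod (q₁ * q₂)) = 0
    rw [Int.cast_natCast, ZMod.natCast_self]
  refine ⟨⟨g, hg⟩, ?_⟩
  have h10 : g 1 0 = ((q₁ * q₂ : ℕ) : ℤ) := rfl
  have h00 : g 0 0 = a := rfl
  rw [dedekindSumGamma0, if_pos (by rw [h10]; exact_mod_cast hc), h10, h00, Int.toNat_natCast]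
  exact hne
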